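/- Let $\mathcal V$ be a (locally small) complete symmetric monoidal closed category. Indexes (weights) of limits and colimits are defined on small $\mathcal V$-categories. Let $\mathcal P$ be any class of indexes $W:K\to\mathcal V$ for limits, and let $A$ be any small $\mathcal V$-category. A presheaf $F:A^{op}\to\mathcal V$ is called $\mathcal P$-flat if its (pointwise) left Kan extension $-*F:[A,\mathcal V]\to\mathcal V$ along the Yoneda embedding $A^{op}\to[A,\mathcal V]$ exists and preserves all limits with index in $\mathcal P$. Let $\mathrm{Flat}_{\mathcal P}$ be the class of all $\mathcal P$-flat presheaves on small $\mathcal V$-categories, and let $\mathrm{Flat}_{\mathcal P}(A)$ be the full sub-$\mathcal V$-category of $[A^{op},\mathcal V]$ on the $\mathcal P$-flat presheaves. For a class $\Phi$ of presheaves, a $\Phi$-colimit is a colimit with index in $\Phi$; $\Phi$-cocomplete means having all $\Phi$-colimits, and $\Phi$-cocontinuous means preserving them. **Theorem 2.5.** $\mathrm{Flat}_{\mathcal P}(A)$ is the free $\mathrm{Flat}_{\mathcal P}$-cocompletion of $A$ in the sense of Kelly. Explicitly, put $\Phi=\mathrm{Flat}_{\mathcal P}$ and $\bar A=\mathrm{Flat}_{\mathcal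 P}(A)$. 1. $\bar A$ is the closure of $A$ in $[A^{op},\mathcal V]$ under $\Phi$-colimits: it is the smallest full subcategory that contains the representables and is closed under the formation of $\Phi$-colimits in $[A^{op},\mathcal V]$ (the $\Phi$-colimits concerned exist in $[A^{op},\mathcal V]$). In particular $a\mapsto A(-,a)$ defines a $\mathcal V$-functor $K:A\to\bar A$, and $K$ is fully faithful. 2. $\bar A$ is $\Phi$-cocomplete. 3. For every possibly large $\mathcal V$-category $B$, let $[A,B]'$ be the full subcategory of $[A,B]$ on the functors that admit a (pointwise) left Kan extension along $K$. The $\mathcal V$-category $\Phi\text{-}\mathrm{Cocts}[\bar A,B]$ of $\Phi$-cocontinuous $\mathcal V$-functors $\bar A\to B$ exists (that is, its hom-objects exist in $\mathcal V$), restriction along $K$ takes it into $[A,B]'$, and left Kan extension along $K$ is an equivalence of $\mathcal V$-categories $$\mathrm{Lan}_K:[A,B]'\;\simeq\;\Phi\text{-}\mathrm{Cocts}[\bar A,B]$$ with inverse the restriction along $K$. 4. If $B$ is $\Phi$-cocomplete, then $[A,B]'=[A,B]$. -/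

import Mathlib

open CategoryTheory Opposite Limits
open MonoidalCategory
open scoped MonoidalClosed
universe w v u₁ u₂ u₃ u₄ uB
noncomputable section

namespace PFlat

section Transformations

variable {V : Type v} [Category.{w} V] [MonoidalCategory V]
  {C : Type u₁} [EnrichedCategory V C] {D : Type u₂} [EnrichedCategory V D]
  {C' : Type u₃} [EnrichedCategory V C']

lemma eId_tensor_eComp {a b : C} {X : V} (f : X ⟶ (a ⟶[V] b)) :
    (eId V a ⊗ₘ f) ≫ eComp V a a b = (λ_ X).hom ≫ f := by
  rw [MonoidalCategory.tensorHom_def', Category.assoc, ← cancel_epi (λ_ X).inv,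
    Iso.inv_hom_id_assoc, ← leftUnitor_inv_naturality_assoc, e_id_comp, Category.comp_id]

lemma tensor_eId_eComp {a b : C} {X : V} (f : X ⟶ (a ⟶[V] b)) :
    (f ⊗ₘ eId V b) ≫ eComp V a b b = (ρ_ X).hom ≫ f := by
  rw [MonoidalCategory.tensorHom_def, Category.assoc, ← cancel_epi (ρ_ X).inv,
    Iso.inv_hom_id_assoc, ← rightUnitor_inv_naturality_assoc, e_comp_id, Category.comp_id]

lemma tensor_comp_left {X Y Z W W' : V} (f : X ⟶ Y) (g : Y ⟶ Z) (h : W ⟶ W') :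
    (f ≫ g ⊗ₘ h) = (f ⊗ₘ h) ≫ g ▷ W' := by
  simp [MonoidalCategory.tensorHom_def']

lemma tensor_comp_right {X Y Z W W' : V} (f : X ⟶ Y) (g : Y ⟶ Z) (h : W ⟶ W') :
    (h ⊗ₘ f ≫ g) = (h ⊗ₘ f) ≫ W' ◁ g := by
  simp [MonoidalCategory.tensorHom_def]

lemma comp_tensor_left {X Y Z W W' : V} (f : X ⟶ Y) (g : Y ⟶ Z) (h : W ⟶ W') :
    (f ≫ g ⊗ₘ h) = f ▷ W ≫ (g ⊗ₘ h) := by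
  simp [MonoidalCategory.tensorHom_def]

lemma comp_tensor_left_assoc {X Y Z W W' T : V} (f : X ⟶ Y) (g : Y ⟶ Z) (h : W ⟶ W')
    (k : Z ⊗ W' ⟶ T) : (f ≫ g ⊗ₘ h) ≫ k = f ▷ W ≫ (g ⊗ₘ h) ≫ k := by
  rw [comp_tensor_left, Category.assoc]

lemma comp_tensor_right {X Y Z W W' : V} (f : X ⟶ Y) (g : Y ⟶ Z) (h : W ⟶ W') :
    (h ⊗ₘ f ≫ g) = W ◁ f ≫ (h ⊗ₘ g) := by
  simp [MonoidalCategory.tensorHom_def']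

lemma comp_tensor_right_assoc {X Y Z W W' T : V} (f : X ⟶ Y) (g : Y ⟶ Z) (h : W ⟶ W')
    (k : W' ⊗ Z ⟶ T) : (h ⊗ₘ f ≫ g) ≫ k = W ◁ f ≫ (h ⊗ₘ g) ≫ k := by
  rw [comp_tensor_right, Category.assoc]

/-- Associativity of composition for generalized elements. -/
lemma eComp_eComp {a b c d : C} {X Y Z : V} (f : X ⟶ (a ⟶[V] b)) (g : Y ⟶ (b ⟶[V] c))
    (h : Z ⟶ (c ⟶[V] d)) :
    ((f ⊗ₘ g) ≫ eComp V a b c ⊗ₘ h) ≫ eComp V a c d =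
      (α_ X Y Z).hom ≫ (f ⊗ₘ (g ⊗ₘ h) ≫ eComp V b c d) ≫ eComp V a b d := by
  rw [tensor_comp_left, tensor_comp_right, Category.assoc, Category.assoc,
    ← associator_naturality_assoc, e_assoc']

/-- Precomposition `D(y, z) ⟶ D(x, z)` with an element `𝟙_ V ⟶ D(x, y)`. -/
def precompose {x y : D} (p : 𝟙_ V ⟶ (x ⟶[V] y)) (z : D) : (y ⟶[V] z) ⟶ (x ⟶[V] z) :=
  (λ_ _).inv ≫ p ▷ (y ⟶[V] z) ≫ eComp V x y z

lemma comp_precompose {x y z : D} (p : 𝟙_ V ⟶ (x ⟶[V] y)) {X : V} (f : X ⟶ (y ⟶[V] z)) :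
    f ≫ precompose p z = (λ_ X).inv ≫ (p ⊗ₘ f) ≫ eComp V x y z := by
  rw [precompose, leftUnitor_inv_naturality_assoc, MonoidalCategory.tensorHom_def',
    Category.assoc]

lemma eComp_precompose {x y z t : D} (p : 𝟙_ V ⟶ (x ⟶[V] y)) {X Y : V}
    (f : X ⟶ (y ⟶[V] z)) (g : Y ⟶ (z ⟶[V] t)) :
    (f ⊗ₘ g) ≫ eComp V y z t ≫ precompose p t =
      (f ≫ precompose p z ⊗ₘ g) ≫ eComp V x z t := by
  rw [← Category.assoc, comp_precompose, comp_precompose, comp_tensor_left (λ_ X).inv,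
    Category.assoc, eComp_eComp, leftUnitor_tensor_inv, Category.assoc]

variable [BraidedCategory V]

/-- `X`-graded `V`-natural transformations `F ⟶ G`: families `X ⟶ D(F a, G a)` such that the two
composites `X ⊗ C(a, b) ⟶ D(F a, G b)` agree. For `X = 𝟙_ V` these are the usual `V`-natural
transformations. -/
@[ext]
structure GTrans (X : V) (F G : EnrichedFunctor V C D) where
  app : ∀ a : C, X ⟶ (F.obj a ⟶[V] G.obj a)
  naturality : ∀ a b : C,
    (β_ X (a ⟶[V] b)).hom ≫ (F.map a b ⊗ₘ app b) ≫ eComp V (F.obj a) (F.obj b) (G.obj b) =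
      (app a ⊗ₘ G.map a b) ≫ eComp V (F.obj a) (G.obj a) (G.obj b)

namespace GTrans

variable {F G H : EnrichedFunctor V C D} {X Y : V}

/-- Change of grading. -/
@[simps]
def precomp (f : Y ⟶ X) (σ : GTrans X F G) : GTrans Y F G where
  app a := f ≫ σ.app a
  naturality a b := by
    rw [comp_tensor_left, comp_tensor_right, Category.assoc, Category.assoc, ← σ.naturality a b,
      BraidedCategory.braiding_naturality_left_assoc]

/-- The identity `V`-natural transformation. -/
@[simps]
def refl (F : EnrichedFunctor V C D) : GTrans (𝟙_ V) F F where
  app a := eId V (F.obj a)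
  naturality a b := by
    rw [eId_tensor_eComp, tensor_eId_eComp, braiding_tensorUnit_left]
    simp

/-- Vertical composition. -/
@[simps]
def comp (σ : GTrans X F G) (τ : GTrans Y G H) : GTrans (X ⊗ Y) F H where
  app a := (σ.app a ⊗ₘ τ.app a) ≫ eComp V (F.obj a) (G.obj a) (H.obj a)
  naturality a b := by
    have h2 := eComp_eComp (σ.app a) (G.map a b) (τ.app b)
    rw [← σ.naturality a b, comp_tensor_left (β_ X (a ⟶[V] b)).hom, Category.assoc, eComp_eComp,
      ← Iso.inv_comp_eq] at h2
    rw [eComp_eComp, ← τ.naturality a b, comp_tensor_right (β_ Y (a ⟶[V] b)).hom, Category.assoc,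
      ← h2, BraidedCategory.braiding_tensor_left_hom]
    simp only [Category.assoc]

/-- Restriction of a transformation along a `V`-functor. -/
@[simps]
def whisker (K : EnrichedFunctor V C' C) (σ : GTrans X F G) :
    GTrans X (K.comp V F) (K.comp V G) where
  app a := σ.app (K.obj a)
  naturality a b := by
    have h := σ.naturality (K.obj a) (K.obj b)
    change (β_ X _).hom ≫ (K.map a b ≫ F.map _ _ ⊗ₘ σ.app (K.obj b)) ≫ eComp V _ _ _ =
      (σ.app (K.obj a) ⊗ₘ K.map a b ≫ G.map _ _) ≫ eComp V _ _ _
    rw [comp_tensor_left, comp_tensor_right, Category.assoc, Category.assoc, ← h,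
      BraidedCategory.braiding_naturality_right_assoc]

/-- A `V`-natural transformation is a `V`-natural isomorphism. -/
def IsInvertible (σ : GTrans (𝟙_ V) F G) : Prop :=
  ∃ τ : GTrans (𝟙_ V) G F, (σ.comp τ).precomp (λ_ (𝟙_ V)).inv = refl F ∧
    (τ.comp σ).precomp (λ_ (𝟙_ V)).inv = refl G

end GTrans

/-- `N` with `π` is the `V`-object of `V`-natural transformations `F ⟶ G`, i.e. the end
`∫_a D(F a, G a)`. -/
def IsNatObj {F G : EnrichedFunctor V C D} {N : V} (π : GTrans N F G) : Prop :=
  ∀ ⦃X : V⦄ (σ : GTrans X F G), ∃! f : X ⟶ N, ∀ a, f ≫ π.app a = σ.app a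

/-- The `V`-object of `V`-natural transformations `F ⟶ G` exists. -/
class HasNatObj (F G : EnrichedFunctor V C D) : Prop where
  exists_isNatObj : ∃ (N : V) (π : GTrans N F G), IsNatObj π

/-- The `V`-object `[C, D](F, G) = ∫_a D(F a, G a)`. -/
def NatObj (F G : EnrichedFunctor V C D) [h : HasNatObj F G] : V :=
  h.exists_isNatObj.choose

namespace NatObj

variable (F G H : EnrichedFunctor V C D) [h : HasNatObj F G]

/-- The universal transformation. -/
def π : GTrans (NatObj F G) F G := h.exists_isNatObj.choose_spec.choose

lemma isNatObj : IsNatObj (π F G) := h.exists_isNatObj.choose_spec.choose_spec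

variable {F G}

/-- The map to `[C, D](F, G)` classifying a graded transformation. -/
def lift {X : V} (σ : GTrans X F G) : X ⟶ NatObj F G := (isNatObj F G σ).choose

lemma lift_π {X : V} (σ : GTrans X F G) (a : C) : lift σ ≫ (π F G).app a = σ.app a :=
  (isNatObj F G σ).choose_spec.1 a

lemma hom_ext {X : V} {f g : X ⟶ NatObj F G}
    (hfg : ∀ a, f ≫ (π F G).app a = g ≫ (π F G).app a) : f = g :=
  (isNatObj F G ((π F G).precomp f)).unique (fun _ => rfl) (fun a => (hfg a).symm)

end NatObj

/-- The `V`-category whose objects are indexed by `J`, the index `j` standing for the `V`-functor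
`ι j`, with hom-objects the `V`-objects of `V`-natural transformations. -/
@[reducible]
def functorEnrichment {J : Type u₃} (ι : J → EnrichedFunctor V C D)
    (h : ∀ i j, HasNatObj (ι i) (ι j)) : EnrichedCategory V J where
  Hom i j := NatObj (ι i) (ι j)
  id i := NatObj.lift (GTrans.refl (ι i))
  comp i j k := NatObj.lift ((NatObj.π (ι i) (ι j)).comp (NatObj.π (ι j) (ι k)))
  id_comp i j := by
    refine NatObj.hom_ext fun a => ?_
    simp only [Category.assoc, NatObj.lift_π, GTrans.comp_app, Category.id_comp]
    rw [← comp_tensor_left_assoc, NatObj.lift_π, GTrans.refl_app, eId_tensor_eComp,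
      Iso.inv_hom_id_assoc]
  comp_id i j := by
    refine NatObj.hom_ext fun a => ?_
    simp only [Category.assoc, NatObj.lift_π, GTrans.comp_app, Category.id_comp]
    rw [← comp_tensor_right_assoc, NatObj.lift_π, GTrans.refl_app, tensor_eId_eComp,
      Iso.inv_hom_id_assoc]
  assoc i j k l := by
    refine NatObj.hom_ext fun a => ?_
    simp only [Category.assoc, NatObj.lift_π, GTrans.comp_app]
    rw [← comp_tensor_right_assoc, NatObj.lift_π, ← comp_tensor_left_assoc, NatObj.lift_π,
      GTrans.comp_app, GTrans.comp_app, eComp_eComp, Iso.inv_hom_id_assoc]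

end Transformations

section Existence

variable {V : Type v} [Category.{w} V] [MonoidalCategory V] [SymmetricCategory V]
  [MonoidalClosed V] [HasLimits V]
  {A : Type w} [EnrichedCategory V A] {D : Type u₂} [EnrichedCategory V D]

instance (F G : EnrichedFunctor V A D) : HasNatObj F G where
  exists_isNatObj := by
    let p₁ : (∏ᶜ fun a : A => (F.obj a ⟶[V] G.obj a)) ⟶
      ∏ᶜ fun p : A × A => (ihom (p.1 ⟶[V] p.2)).obj (F.obj p.1 ⟶[V] G.obj p.2) :=
      Pi.lift fun p => MonoidalClosed.curry
        ((F.map p.1 p.2 ⊗ₘ Pi.π _ p.2) ≫ eComp V _ _ _)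
    let p₂ : (∏ᶜ fun a : A => (F.obj a ⟶[V] G.obj a)) ⟶
      ∏ᶜ fun p : A × A => (ihom (p.1 ⟶[V] p.2)).obj (F.obj p.1 ⟶[V] G.obj p.2) :=
      Pi.lift fun p => MonoidalClosed.curry
        ((β_ _ _).hom ≫ (Pi.π _ p.1 ⊗ₘ G.map p.1 p.2) ≫ eComp V _ _ _)
    have hp₁ : ∀ (X : V) (f : X ⟶ ∏ᶜ fun a : A => (F.obj a ⟶[V] G.obj a)) (p : A × A),
        f ≫ p₁ ≫ Pi.π _ p = MonoidalClosed.curry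
          ((F.map p.1 p.2 ⊗ₘ f ≫ Pi.π _ p.2) ≫ eComp V _ _ _) := by
      intro X f p
      rw [Pi.lift_π, ← MonoidalClosed.curry_natural_left, comp_tensor_right, Category.assoc]
    have hp₂ : ∀ (X : V) (f : X ⟶ ∏ᶜ fun a : A => (F.obj a ⟶[V] G.obj a)) (p : A × A),
        f ≫ p₂ ≫ Pi.π _ p = MonoidalClosed.curry
          ((β_ _ _).hom ≫ (f ≫ Pi.π _ p.1 ⊗ₘ G.map p.1 p.2) ≫ eComp V _ _ _) := by
      intro X f p
      rw [Pi.lift_π, ← MonoidalClosed.curry_natural_left, comp_tensor_left, Category.assoc,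
        BraidedCategory.braiding_naturality_right_assoc]
    have key : ∀ (X : V) (f : X ⟶ ∏ᶜ fun a : A => (F.obj a ⟶[V] G.obj a)),
        f ≫ p₁ = f ≫ p₂ ↔ ∀ a b : A,
          (β_ X (a ⟶[V] b)).hom ≫ (F.map a b ⊗ₘ f ≫ Pi.π _ b) ≫ eComp V _ _ _ =
            (f ≫ Pi.π _ a ⊗ₘ G.map a b) ≫ eComp V _ _ _ := by
      intro X f
      constructor
      · intro h a b
        have h' := congrArg (· ≫ Pi.π _ (a, b)) h
        simp only [Category.assoc, hp₁, hp₂] at h'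
        rw [MonoidalClosed.curry_injective h', SymmetricCategory.symmetry_assoc]
      · intro h
        refine Pi.hom_ext _ _ fun p => ?_
        rw [Category.assoc, Category.assoc, hp₁, hp₂, ← h, SymmetricCategory.symmetry_assoc]
    refine ⟨equalizer p₁ p₂, ⟨fun a => equalizer.ι p₁ p₂ ≫ Pi.π _ a,
      (key _ _).1 (equalizer.condition p₁ p₂)⟩, fun X σ => ?_⟩
    refine ⟨equalizer.lift (Pi.lift σ.app) ((key _ _).2 ?_), ?_, ?_⟩
    · intro a b
      simpa using σ.naturality a b
    · intro a
      simp
    · intro f hf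
      refine equalizer.hom_ext (Pi.hom_ext _ _ fun a => ?_)
      simpa using hf a

end Existence

section SelfEnrichment

variable {V : Type v} [Category.{w} V] [MonoidalCategory V] [MonoidalClosed V]

/-- Currying, valued in the hom-object of `V` as a `V`-category. -/
def hcurry {X Y Z : V} (f : X ⊗ Y ⟶ Z) : Y ⟶ EnrichedCategory.Hom X Z :=
  MonoidalClosed.curry f

/-- Uncurrying, from the hom-object of `V` as a `V`-category. -/
def huncurry {X Y Z : V} (f : Y ⟶ EnrichedCategory.Hom X Z) : X ⊗ Y ⟶ Z :=
  MonoidalClosed.uncurry f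

lemma hcurry_huncurry {X Y Z : V} (f : Y ⟶ EnrichedCategory.Hom X Z) :
    hcurry (huncurry f) = f :=
  MonoidalClosed.curry_uncurry f

lemma huncurry_hcurry {X Y Z : V} (f : X ⊗ Y ⟶ Z) : huncurry (hcurry f) = f :=
  MonoidalClosed.uncurry_curry f

lemma comp_hcurry {X Y Y' Z : V} (g : Y' ⟶ Y) (f : X ⊗ Y ⟶ Z) :
    g ≫ hcurry f = hcurry (X ◁ g ≫ f) :=
  (MonoidalClosed.curry_natural_left g f).symm

lemma self_id (X : V) : eId V X = hcurry (ρ_ X).hom := rfl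

/-- Composition of generalized elements of internal homs. -/
lemma self_comp {a b c X Y : V} (f : X ⟶ EnrichedCategory.Hom a b)
    (g : Y ⟶ EnrichedCategory.Hom b c) :
    (f ⊗ₘ g) ≫ eComp V a b c = hcurry ((α_ a X Y).inv ≫ huncurry f ▷ Y ≫ huncurry g) := by
  have key : ∀ (f : X ⟶ (ihom a).obj b) (g : Y ⟶ (ihom b).obj c),
      (f ⊗ₘ g) ≫ MonoidalClosed.comp a b c = MonoidalClosed.curry
        ((α_ a X Y).inv ≫ MonoidalClosed.uncurry f ▷ Y ≫ MonoidalClosed.uncurry g) := by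
    intro f g
    have h : (a ◁ (f ⊗ₘ g)) ≫ (α_ a _ _).inv = (α_ a X Y).inv ≫ (a ◁ f) ▷ Y ≫ _ ◁ g := by
      simp [MonoidalCategory.tensorHom_def]
    rw [MonoidalClosed.comp_eq, ← MonoidalClosed.curry_natural_left,
      MonoidalClosed.compTranspose_eq, MonoidalClosed.uncurry_eq, MonoidalClosed.uncurry_eq,
      reassoc_of% h, comp_whiskerRight, Category.assoc]
    simp only [whisker_exchange_assoc]
    rfl
  exact key f g

end SelfEnrichment

section Representables

variable {V : Type v} [Category.{w} V] [MonoidalCategory V] [MonoidalClosed V]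
  {B : Type u₁} [EnrichedCategory V B]

/-- The representable `V`-functor `B(b, -) : B ⟶ V`. -/
abbrev corep (b : B) : EnrichedFunctor V B V where
  obj c := (b ⟶[V] c)
  map c d := hcurry (eComp V b c d)
  map_id c := by
    rw [comp_hcurry, self_id]
    congr 1
    rw [← cancel_epi (ρ_ _).inv, e_comp_id, Iso.inv_hom_id]
  map_comp c d e := by
    rw [self_comp, huncurry_hcurry, huncurry_hcurry, comp_hcurry, e_assoc]

end Representables

section Yoneda

variable {V : Type v} [Category.{w} V] [MonoidalCategory V] [SymmetricCategory V]
  [MonoidalClosed V] {B : Type u₁} [EnrichedCategory V B]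

/-- The action of `B(b', b)` by precomposition, as a graded transformation `B(b, -) ⟶ B(b', -)`. -/
def corepMap (b b' : B) : GTrans (b' ⟶[V] b) (corep (V := V) b) (corep b') where
  app c := hcurry ((β_ (b ⟶[V] c) (b' ⟶[V] b)).hom ≫ eComp V b' b c)
  naturality c d := by
    dsimp only [corep]
    rw [self_comp, self_comp, huncurry_hcurry, huncurry_hcurry, huncurry_hcurry, huncurry_hcurry,
      comp_hcurry]
    congr 1
    rw [BraidedCategory.braiding_naturality_left_assoc, ← e_assoc,
      BraidedCategory.braiding_tensor_left_hom]
    simp only [Category.assoc, Iso.inv_hom_id_assoc, Iso.hom_inv_id_assoc, comp_whiskerRight]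
    rw [← MonoidalCategory.whiskerLeft_comp_assoc, SymmetricCategory.symmetry]
    simp

lemma corepMap_comp (a b c d : B) :
    ((β_ (b ⟶[V] a) (c ⟶[V] b)).hom ≫ eComp V c b a) ≫ (corepMap (V := V) a c).app d =
      ((corepMap a b).app d ⊗ₘ (corepMap b c).app d) ≫
        eComp V ((corep a).obj d) ((corep b).obj d) ((corep c).obj d) := by
  dsimp only [corepMap, corep]
  rw [self_comp, huncurry_hcurry, huncurry_hcurry, comp_hcurry]
  congr 1
  rw [comp_whiskerRight, Category.assoc, BraidedCategory.braiding_naturality_left_assoc,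
    ← e_assoc, MonoidalCategory.whiskerLeft_comp, Category.assoc,
    BraidedCategory.braiding_naturality_right_assoc,
    BraidedCategory.braiding_naturality_right_assoc,
    BraidedCategory.braiding_tensor_left_hom, BraidedCategory.braiding_tensor_right_hom]
  simp only [Category.assoc, Iso.hom_inv_id_assoc]

variable [HasLimits V] {A : Type w} [EnrichedCategory V A]

/-- Small `V`-categories `A` have enriched functor categories `[A, D]`. -/
instance {D : Type u₂} [EnrichedCategory V D] : EnrichedCategory V (EnrichedFunctor V A D) :=
  functorEnrichment (fun F => F) fun _ _ => inferInstance

section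

variable {D : Type u₂} [EnrichedCategory V D]

/-- The map to the hom-object `[A, D](F, G)` classifying a graded transformation. -/
def homLift {X : V} {F G : EnrichedFunctor V A D} (σ : GTrans X F G) : X ⟶ (F ⟶[V] G) :=
  NatObj.lift σ

/-- The universal transformation on the hom-object `[A, D](F, G)`. -/
def homπ (F G : EnrichedFunctor V A D) : GTrans (F ⟶[V] G) F G := NatObj.π F G

lemma homLift_π {X : V} {F G : EnrichedFunctor V A D} (σ : GTrans X F G) (a : A) :
    homLift σ ≫ (homπ F G).app a = σ.app a :=
  NatObj.lift_π σ a

lemma homπ_ext {X : V} {F G : EnrichedFunctor V A D} {f g : X ⟶ (F ⟶[V] G)}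
    (h : ∀ a, f ≫ (homπ F G).app a = g ≫ (homπ F G).app a) : f = g :=
  NatObj.hom_ext h

lemma eId_π (F : EnrichedFunctor V A D) (a : A) :
    eId V F ≫ (homπ F F).app a = eId V (F.obj a) :=
  NatObj.lift_π _ _

lemma eComp_π (F G H : EnrichedFunctor V A D) (a : A) :
    eComp V F G H ≫ (homπ F H).app a =
      ((homπ F G).app a ⊗ₘ (homπ G H).app a) ≫ eComp V (F.obj a) (G.obj a) (H.obj a) :=
  NatObj.lift_π _ _

end

variable (V A) in
/-- The Yoneda embedding `Aᵒᵖ ⟶ [A, V]`, sending `a` to `A(a, -)`. -/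
def coyoneda : EnrichedFunctor V Aᵒᵖ (EnrichedFunctor V A V) where
  obj a := corep a.unop
  map a b := homLift (corepMap a.unop b.unop)
  map_id a := by
    refine homπ_ext fun c => ?_
    rw [eId_π, Category.assoc, homLift_π]
    change eId V a.unop ≫ hcurry ((β_ _ _).hom ≫ eComp V a.unop a.unop c) =
      hcurry (ρ_ (a.unop ⟶[V] c)).hom
    rw [comp_hcurry, BraidedCategory.braiding_naturality_right_assoc,
      ← braiding_leftUnitor]
    congr 2
    rw [← cancel_epi (λ_ (a.unop ⟶[V] c)).inv, e_id_comp, Iso.inv_hom_id]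
  map_comp a b c := by
    refine homπ_ext fun d => ?_
    rw [Category.assoc, Category.assoc, eComp_π, homLift_π,
      MonoidalCategory.tensorHom_comp_tensorHom_assoc, homLift_π, homLift_π]
    exact corepMap_comp a.unop b.unop c.unop d

variable (V A) in
/-- The isomorphism of `V`-categories `A ≅ Aᵒᵖᵒᵖ`. -/
def toOpOp : EnrichedFunctor V A Aᵒᵖᵒᵖ where
  obj a := op (op a)
  map a b := 𝟙 (a ⟶[V] b)
  map_id a := Category.comp_id _
  map_comp a b c := by
    change eComp V a b c ≫ 𝟙 _ = (𝟙 _ ⊗ₘ 𝟙 _) ≫ (β_ _ _).hom ≫ (β_ _ _).hom ≫ eComp V a b c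
    rw [SymmetricCategory.symmetry_assoc]
    simp

variable (V A) in
/-- The Yoneda embedding `A ⟶ [Aᵒᵖ, V]`, sending `a` to `A(-, a)`. -/
def yoneda : EnrichedFunctor V A (EnrichedFunctor V Aᵒᵖ V) :=
  (toOpOp V A).comp V (coyoneda V Aᵒᵖ)

end Yoneda

/-! ### Opposite functors, subcategories and restriction -/

section Constructions

variable {V : Type v} [Category.{w} V] [MonoidalCategory V] [BraidedCategory V]
  {C : Type u₁} [EnrichedCategory V C] {D : Type u₂} [EnrichedCategory V D]
  {A : Type u₃} [EnrichedCategory V A]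

/-- The opposite `V`-functor. -/
abbrev opFunctor (F : EnrichedFunctor V C D) : EnrichedFunctor V Cᵒᵖ Dᵒᵖ where
  obj c := op (F.obj c.unop)
  map c d := F.map d.unop c.unop
  map_id c := F.map_id c.unop
  map_comp c d e := by
    rw [tensorHom_eComp_op_eq, eComp_op_eq, Category.assoc]
    exact congrArg _ (F.map_comp e.unop d.unop c.unop)

/-- A full subcategory of a (possibly large) category of `V`-functors: its objects are the
`V`-functors with the property `Q`. -/
structure FullSub (Q : EnrichedFunctor V C D → Prop) where
  functor : EnrichedFunctor V C D
  property : Q functor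

namespace FullSub

variable {Q : EnrichedFunctor V C D → Prop}

/-- If the `V`-objects of `V`-natural transformations between functors with property `Q` exist,
these functors form a `V`-category. -/
instance [∀ S T : FullSub Q, HasNatObj S.functor T.functor] : EnrichedCategory V (FullSub Q) :=
  functorEnrichment FullSub.functor inferInstance

variable [h : ∀ S T : FullSub Q, HasNatObj S.functor T.functor]

/-- The universal transformation on a hom-object. -/
def homπ (S T : FullSub Q) : GTrans (S ⟶[V] T) S.functor T.functor :=
  NatObj.π S.functor T.functor

/-- The map to a hom-object classifying a graded transformation. -/
def homLift {X : V} {S T : FullSub Q} (σ : GTrans X S.functor T.functor) : X ⟶ (S ⟶[V] T) :=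
  NatObj.lift σ

lemma homLift_π {X : V} {S T : FullSub Q} (σ : GTrans X S.functor T.functor) (c : C) :
    homLift σ ≫ (homπ S T).app c = σ.app c :=
  NatObj.lift_π σ c

lemma homπ_ext {X : V} {S T : FullSub Q} {f g : X ⟶ (S ⟶[V] T)}
    (hfg : ∀ c, f ≫ (homπ S T).app c = g ≫ (homπ S T).app c) : f = g :=
  NatObj.hom_ext hfg

lemma eId_π (S : FullSub Q) (c : C) :
    eId V S ≫ (homπ S S).app c = eId V (S.functor.obj c) :=
  NatObj.lift_π _ _

lemma eComp_π (S T U : FullSub Q) (c : C) :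
    eComp V S T U ≫ (homπ S U).app c = ((homπ S T).app c ⊗ₘ (homπ T U).app c) ≫
      eComp V (S.functor.obj c) (T.functor.obj c) (U.functor.obj c) :=
  NatObj.lift_π _ _

variable {Q' : EnrichedFunctor V A D → Prop}
  [h' : ∀ S T : FullSub Q', HasNatObj S.functor T.functor]

/-- Restriction along a `V`-functor `K : A ⟶ C`, as a `V`-functor between categories of
`V`-functors. -/
def restriction (K : EnrichedFunctor V A C) (hK : ∀ S : FullSub Q, Q' (K.comp V S.functor)) :
    EnrichedFunctor V (FullSub Q) (FullSub Q') where
  obj S := ⟨K.comp V S.functor, hK S⟩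
  map S T := homLift ((homπ S T).whisker K)
  map_id S := by
    refine homπ_ext fun a => ?_
    rw [Category.assoc, homLift_π, eId_π]
    exact eId_π S (K.obj a)
  map_comp S T U := by
    refine homπ_ext fun a => ?_
    rw [Category.assoc, Category.assoc, homLift_π, eComp_π,
      MonoidalCategory.tensorHom_comp_tensorHom_assoc, homLift_π, homLift_π]
    exact eComp_π S T U (K.obj a)

end FullSub

end Constructions

/-! ### Weighted limits and colimits -/

section WeightedLimits

variable {V : Type v} [Category.{w} V] [MonoidalCategory V] [MonoidalClosed V]
  {K : Type u₁} [EnrichedCategory V K] {B : Type u₂} [EnrichedCategory V B]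
  {D : Type u₃} [EnrichedCategory V D]

/-- The action `W k ⊗ K(k, l) ⟶ W l` of a `V`-functor `W : K ⟶ V`. -/
def act (W : EnrichedFunctor V K V) (k l : K) : W.obj k ⊗ (k ⟶[V] l) ⟶ W.obj l :=
  huncurry (W.map k l)

/-- A `W`-weighted cylinder over `G` with vertex `b`: a `V`-natural transformation
`W ⟶ B(b, G -)`, given by its components `W k ⟶ B(b, G k)`. -/
@[ext]
structure Cyl (W : EnrichedFunctor V K V) (G : EnrichedFunctor V K B) (b : B) where
  app : ∀ k : K, W.obj k ⟶ (b ⟶[V] G.obj k)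
  naturality : ∀ k l : K, act W k l ≫ app l =
    (app k ⊗ₘ G.map k l) ≫ eComp V b (G.obj k) (G.obj l)

/-- The `X`-graded version: a `V`-natural family `X ⊗ W k ⟶ B(b, G k)`, i.e. a map
`X ⟶ [K, V](W, B(b, G -))`. -/
@[ext]
structure GCyl (X : V) (W : EnrichedFunctor V K V) (G : EnrichedFunctor V K B) (b : B) where
  app : ∀ k : K, X ⊗ W.obj k ⟶ (b ⟶[V] G.obj k)
  naturality : ∀ k l : K, (α_ X (W.obj k) (k ⟶[V] l)).hom ≫ X ◁ act W k l ≫ app l =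
    (app k ⊗ₘ G.map k l) ≫ eComp V b (G.obj k) (G.obj l)

/-- The cylinder `t : W ⟶ B(c, G -)` exhibits `c` as the limit `{W, G}` of `G` weighted by `W`:
it induces an isomorphism `B(b, c) ≅ [K, V](W, B(b, G -))` for every `b`, i.e. bijections between
the maps `X ⟶ B(b, c)` and the `X`-graded transformations `W ⟶ B(b, G -)`. -/
def Cyl.IsLimit {W : EnrichedFunctor V K V} {G : EnrichedFunctor V K B} {c : B}
    (t : Cyl W G c) : Prop :=
  ∀ ⦃X : V⦄ ⦃b : B⦄ (s : GCyl X W G b),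
    ∃! f : X ⟶ (b ⟶[V] c), ∀ k, (f ⊗ₘ t.app k) ≫ eComp V b c (G.obj k) = s.app k

/-- The image of a cylinder under a `V`-functor. -/
def Cyl.map {W : EnrichedFunctor V K V} {G : EnrichedFunctor V K B} {c : B} (t : Cyl W G c)
    (S : EnrichedFunctor V B D) : Cyl W (G.comp V S) (S.obj c) where
  app k := t.app k ≫ S.map c (G.obj k)
  naturality k l := by
    have h : act W k l ≫ t.app l ≫ S.map c (G.obj l) =
        (t.app k ⊗ₘ G.map k l) ≫ eComp V c (G.obj k) (G.obj l) ≫ S.map c (G.obj l) := by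
      rw [← Category.assoc, t.naturality, Category.assoc]
    rw [S.map_comp, MonoidalCategory.tensorHom_comp_tensorHom_assoc] at h
    exact h

end WeightedLimits

section Colimits

variable {V : Type v} [Category.{w} V] [MonoidalCategory V] [SymmetricCategory V]
  [MonoidalClosed V]
  {K : Type u₁} [EnrichedCategory V K] {B : Type u₂} [EnrichedCategory V B]
  {D : Type u₃} [EnrichedCategory V D]

/-- A cocylinder `W ⟶ B(G -, c)` under `G : K ⟶ B`, with weight `W : Kᵒᵖ ⟶ V`: a cylinder in
`Bᵒᵖ`. -/
abbrev Cocyl (W : EnrichedFunctor V Kᵒᵖ V) (G : EnrichedFunctor V K B) (c : B) :=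
  Cyl W (opFunctor G) (op c)

/-- The cocylinder `t : W ⟶ B(G -, c)` exhibits `c` as the colimit `W * G` of `G` weighted by
`W`: colimits in `B` are limits in `Bᵒᵖ`. -/
def Cocyl.IsColimit {W : EnrichedFunctor V Kᵒᵖ V} {G : EnrichedFunctor V K B} {c : B}
    (t : Cocyl W G c) : Prop :=
  Cyl.IsLimit t

/-- The image of a cocylinder under a `V`-functor. -/
def Cocyl.map {W : EnrichedFunctor V Kᵒᵖ V} {G : EnrichedFunctor V K B} {c : B}
    (t : Cocyl W G c) (S : EnrichedFunctor V B D) : Cocyl W (G.comp V S) (S.obj c) :=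
  Cyl.map t (opFunctor S)

end Colimits

/-! ### Kan extensions -/

section Kan

variable {V : Type v} [Category.{w} V] [MonoidalCategory V] [SymmetricCategory V]
  [MonoidalClosed V]
  {A : Type u₁} [EnrichedCategory V A] {C : Type u₂} [EnrichedCategory V C]
  {B : Type u₃} [EnrichedCategory V B]

/-- The presheaf `C(K -, c) : Aᵒᵖ ⟶ V`. -/
abbrev nerve (K : EnrichedFunctor V A C) (c : C) : EnrichedFunctor V Aᵒᵖ V :=
  (opFunctor K).comp V (corep (op c))

lemma act_nerve (K : EnrichedFunctor V A C) (c : C) (a b : A) :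
    act (nerve K c) (op a) (op b) =
      (K.obj a ⟶[V] c) ◁ K.map b a ≫ (β_ _ _).hom ≫ eComp V (K.obj b) (K.obj a) c := by
  change huncurry (K.map b a ≫ hcurry ((β_ (K.obj a ⟶[V] c) (K.obj b ⟶[V] K.obj a)).hom ≫
    eComp V (K.obj b) (K.obj a) c)) = _
  rw [comp_hcurry, huncurry_hcurry]

set_option linter.unusedSectionVars false in
lemma kanCocyl_aux (K : EnrichedFunctor V A C) (F : EnrichedFunctor V A B)
    (T : EnrichedFunctor V C B) {a b : A} (q : 𝟙_ V ⟶ (F.obj a ⟶[V] T.obj (K.obj a)))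
    (p : 𝟙_ V ⟶ (F.obj b ⟶[V] T.obj (K.obj b))) (c : C)
    (h : (β_ _ _).hom ≫ (F.map b a ⊗ₘ q) ≫ eComp V (F.obj b) (F.obj a) (T.obj (K.obj a)) =
      (p ⊗ₘ K.map b a ≫ T.map (K.obj b) (K.obj a)) ≫
        eComp V (F.obj b) (T.obj (K.obj b)) (T.obj (K.obj a))) :
    ((K.obj a ⟶[V] c) ◁ K.map b a ≫ (β_ _ _).hom ≫ eComp V (K.obj b) (K.obj a) c) ≫
      T.map (K.obj b) c ≫ precompose p (T.obj c) =
        (β_ _ _).hom ≫ (F.map b a ⊗ₘ T.map (K.obj a) c ≫ precompose q (T.obj c)) ≫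
          eComp V (F.obj b) (F.obj a) (T.obj c) := by
  rw [Category.assoc, Category.assoc, BraidedCategory.braiding_naturality_right_assoc,
    EnrichedFunctor.map_comp_assoc, ← comp_tensor_left_assoc, eComp_precompose, comp_precompose,
    ← h, comp_precompose]
  congr 1
  rw [braiding_tensorUnit_left]
  simp only [Category.assoc, Iso.inv_hom_id_assoc]
  rw [comp_tensor_left (ρ_ _).inv, Category.assoc, eComp_eComp,
    comp_tensor_right (λ_ _).inv, Category.assoc]
  simp

/-- The cocylinder `C(K a, c) ⟶ B(T K a, T c) ⟶ B(F a, T c)` given by a `V`-functor `T : C ⟶ B` and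
a `V`-natural transformation `φ : F ⟶ T K`. -/
def kanCocyl (K : EnrichedFunctor V A C) (F : EnrichedFunctor V A B)
    (T : EnrichedFunctor V C B) (φ : GTrans (𝟙_ V) F (K.comp V T)) (c : C) :
    Cocyl (nerve K c) F (T.obj c) where
  app a := T.map (K.obj a.unop) c ≫
    precompose (y := T.obj (K.obj a.unop)) (φ.app a.unop) (T.obj c)
  naturality := by
    rintro ⟨a⟩ ⟨b⟩
    rw [act_nerve, tensorHom_eComp_op_eq]
    exact kanCocyl_aux K F T (φ.app a) (φ.app b) c (φ.naturality b a)

/-- `T : C ⟶ B` with `φ : F ⟶ T K` is the (pointwise) left Kan extension `Lan_K F`, i.e.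
`T c = C(K -, c) * F` for every `c`. -/
def IsLan (K : EnrichedFunctor V A C) (F : EnrichedFunctor V A B)
    (T : EnrichedFunctor V C B) (φ : GTrans (𝟙_ V) F (K.comp V T)) : Prop :=
  ∀ c : C, (kanCocyl K F T φ c).IsColimit

/-- `F` admits a left Kan extension along `K`. -/
def AdmitsLan (K : EnrichedFunctor V A C) (F : EnrichedFunctor V A B) : Prop :=
  ∃ (T : EnrichedFunctor V C B) (φ : GTrans (𝟙_ V) F (K.comp V T)), IsLan K F T φ

end Kan

/-! ### Classes of indexes, flatness and cocompletions -/

section Flatness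

variable {V : Type v} [Category.{w} V] [MonoidalCategory V] [SymmetricCategory V]
  [MonoidalClosed V]

variable (V) in
/-- A class of (small) indexes for limits: `V`-functors `K ⟶ V` with `K` small. -/
abbrev LimitClass :=
  ∀ (K : Type w) [EnrichedCategory V K], EnrichedFunctor V K V → Prop

variable (V) in
/-- A class of (small) indexes for colimits: presheaves `Kᵒᵖ ⟶ V` with `K` small. -/
abbrev ColimitClass :=
  ∀ (K : Type w) [EnrichedCategory V K], EnrichedFunctor V Kᵒᵖ V → Prop

section

variable {B : Type u₁} [EnrichedCategory V B] {D : Type u₂} [EnrichedCategory V D]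

/-- `S` preserves all limits with index in `P`. -/
def Continuous (P : LimitClass V) (S : EnrichedFunctor V B D) : Prop :=
  ∀ (K : Type w) [EnrichedCategory V K] (W : EnrichedFunctor V K V), P K W →
    ∀ (G : EnrichedFunctor V K B) (c : B) (t : Cyl W G c), t.IsLimit → (t.map S).IsLimit

/-- `S` preserves all colimits with index in `Φ`. -/
def Cocontinuous (Φ : ColimitClass V) (S : EnrichedFunctor V B D) : Prop :=
  ∀ (K : Type w) [EnrichedCategory V K] (W : EnrichedFunctor V Kᵒᵖ V), Φ K W →
    ∀ (G : EnrichedFunctor V K B) (c : B) (t : Cocyl W G c), t.IsColimit → (t.map S).IsColimit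

variable (B) in
/-- `B` has all colimits with index in `Φ`. -/
def Cocomplete (Φ : ColimitClass V) : Prop :=
  ∀ (K : Type w) [EnrichedCategory V K] (W : EnrichedFunctor V Kᵒᵖ V), Φ K W →
    ∀ G : EnrichedFunctor V K B, ∃ (c : B) (t : Cocyl W G c), t.IsColimit

/-- The full subcategory of `B` on the objects in `Q` is closed under the formation of colimits
with index in `Φ`: the `Φ`-colimits in `B` of diagrams with values in `Q` exist and are in `Q`. -/
def ClosedUnderColimits (Φ : ColimitClass V) (Q : Set B) : Prop :=
  ∀ (K : Type w) [EnrichedCategory V K] (W : EnrichedFunctor V Kᵒᵖ V), Φ K W →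
    ∀ G : EnrichedFunctor V K B, (∀ k, G.obj k ∈ Q) →
      (∃ (c : B) (t : Cocyl W G c), t.IsColimit) ∧
        ∀ (c : B) (t : Cocyl W G c), t.IsColimit → c ∈ Q

/-- Corestriction of a `V`-functor to a full subcategory of a functor category `[X, D]`. -/
def corestrict [HasLimits V] {X : Type w} [EnrichedCategory V X]
    {Q : EnrichedFunctor V X D → Prop}
    (G : EnrichedFunctor V B (EnrichedFunctor V X D)) (h : ∀ b, Q (G.obj b)) :
    EnrichedFunctor V B (FullSub Q) where
  obj b := ⟨G.obj b, h b⟩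
  map a b := G.map a b
  map_id b := G.map_id b
  map_comp a b c := G.map_comp a b c

/-- Left Kan extension along `K : A ⟶ M` is an equivalence of `V`-categories, with inverse the
restriction along `K`, from the `V`-functors `A ⟶ B` that admit a left Kan extension along `K` to
the `Φ`-cocontinuous `V`-functors `M ⟶ B`. The instance argument and `hK` say that the latter form
a `V`-category and that their restrictions along `K` are among the former. -/
def LanEquivalence [HasLimits V] (Φ : ColimitClass V) {A : Type w} [EnrichedCategory V A]
    {M : Type u₁} [EnrichedCategory V M] (K : EnrichedFunctor V A M)
    (B : Type uB) [EnrichedCategory V B]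
    [∀ S T : FullSub (Cocontinuous (B := M) (D := B) Φ), HasNatObj S.functor T.functor]
    (hK : ∀ S : FullSub (Cocontinuous (B := M) (D := B) Φ), AdmitsLan K (K.comp V S.functor)) :
    Prop :=
  ∃ (L : EnrichedFunctor V (FullSub (AdmitsLan (B := B) K))
      (FullSub (Cocontinuous (B := M) (D := B) Φ)))
    (η : GTrans (𝟙_ V) (EnrichedFunctor.id V _) (L.comp V (FullSub.restriction K hK)))
    (ε : GTrans (𝟙_ V) ((FullSub.restriction K hK).comp V L) (EnrichedFunctor.id V _)),
    η.IsInvertible ∧ ε.IsInvertible ∧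
      ∀ F : FullSub (AdmitsLan (B := B) K),
        IsLan K F.functor (L.obj F).functor
          ((FullSub.homπ F ((FullSub.restriction K hK).obj (L.obj F))).precomp (η.app F))

/-- `K : A ⟶ M` exhibits `M` as the free `Φ`-cocompletion of the small `V`-category `A`: `K` is
fully faithful, `M` is `Φ`-cocomplete and, for every possibly large `B`, the `V`-category of
`Φ`-cocontinuous `M ⟶ B` exists and is equivalent, by left Kan extension and restriction along
`K`, to that of the `V`-functors `A ⟶ B` admitting a left Kan extension along `K`; these are all
the `V`-functors `A ⟶ B` if `B` is `Φ`-cocomplete. -/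
structure IsFreeCocompletion [HasLimits V] (Φ : ColimitClass V) {A : Type w}
    [EnrichedCategory V A] {M : Type u₁} [EnrichedCategory V M]
    (K : EnrichedFunctor V A M) : Prop where
  fullyFaithful : ∀ a b, IsIso (K.map a b)
  cocomplete : Cocomplete M Φ
  hasNatObj : ∀ (B : Type uB) [EnrichedCategory V B]
    (S T : FullSub (Cocontinuous (B := M) (D := B) Φ)), HasNatObj S.functor T.functor
  restrict : ∀ (B : Type uB) [EnrichedCategory V B]
    (S : FullSub (Cocontinuous (B := M) (D := B) Φ)), AdmitsLan K (K.comp V S.functor)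
  lanEquivalence : ∀ (B : Type uB) [EnrichedCategory V B],
    haveI := hasNatObj B
    LanEquivalence Φ K B (restrict B)
  admitsLan : ∀ (B : Type uB) [EnrichedCategory V B], Cocomplete B Φ →
    ∀ F : EnrichedFunctor V A B, AdmitsLan K F

end

variable [HasLimits V] (P : LimitClass V)

/-- A presheaf `F : Aᵒᵖ ⟶ V` is `P`-flat if its left Kan extension `- * F : [A, V] ⟶ V` along the
Yoneda embedding `Aᵒᵖ ⟶ [A, V]` (exists and) preserves all `P`-limits. -/
def IsFlat {A : Type w} [EnrichedCategory V A] (F : EnrichedFunctor V Aᵒᵖ V) : Prop :=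
  ∃ (T : EnrichedFunctor V (EnrichedFunctor V A V) V)
    (φ : GTrans (𝟙_ V) F ((coyoneda V A).comp V T)),
    IsLan (coyoneda V A) F T φ ∧ Continuous P T

/-- The class of all `P`-flat presheaves on small `V`-categories. -/
def flatClass : ColimitClass V := fun _ _ W => IsFlat P W

variable (A : Type w) [EnrichedCategory V A]

/-- The full subcategory `Flat_P(A)` of `[Aᵒᵖ, V]` on the `P`-flat presheaves. -/
abbrev FlatCat := FullSub (IsFlat P (A := A))

/-- `Q` is the closure of (the representables on) `A` in `[Aᵒᵖ, V]` under `Φ`-colimits. -/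
def IsClosure (Φ : ColimitClass V) (Q : Set (EnrichedFunctor V Aᵒᵖ V)) : Prop :=
  IsLeast {Q | (∀ a, (yoneda V A).obj a ∈ Q) ∧ ClosedUnderColimits Φ Q} Q

end Flatness

end PFlat

end

/-! Write M * F for the coend ∫^a M a ⊗ F a. Flatness of F says that - * F exists on [A, V] and
preserves `P`-limits. Since V is complete but not assumed cocomplete, existence is a genuine
condition, and every colimit built below comes from it. The Yoneda isomorphism replaces the Kan
extension in the definition by explicit universal families (`TensorFunctor`, and `TensorData` with
the factors exchanged).

Closure under flat colimits rests on Fubini for coends. If W is a flat weight on K, every G k is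
flat and H = ∫^k G k ⊗ W k pointwise, then M * H = ∫^k (M * G k) ⊗ W k (`colimTensorData`). So - * H
is the functor M ↦ (k ↦ M * G k) from [A, V] to [K, V] followed by - * W. The first preserves
`P`-limits because limits in [K, V] can be computed pointwise, the second because W is flat; hence H
is flat (`isFlat_of_isColimit_ev`). Flat colimits do exist pointwise in functor categories, as
values of - * W (`exists_isColimit_ev`). Representables are flat because tensoring with A(-, a) is
evaluation at a, which is itself represented by A(a, -) and so preserves limits (`isFlat_rep`).
Every flat F is the F-weighted colimit of representables (`isColimit_densityCocyl`), which gives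
minimality of the closure.

For the universal property let M be the category of flat presheaves and Y : A ⟶ M the Yoneda
embedding. Flat colimits in M are pointwise, so each M(Y a, -), being evaluation at a, is
cocontinuous (`cocontinuous_corep_flatYoneda`), and therefore every left Kan extension along Y is
cocontinuous (`IsLan.isColimit_map`). Conversely a cocontinuous S preserves the canonical colimit c
= c * Y, so it is the Kan extension of its restriction (`isSelfLan_of_cocontinuous`).
Transformations out of such an S are thus determined by, and extend from, their restrictions to the
small category A: hom-objects exist (`IsSelfLan.hasNatObj`) and restriction is fully faithful
(`isIso_restriction_map`). It is essentially surjective because Y is fully faithful, which makes the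
units of Kan extensions invertible (`IsLan.exists_isInversePair`). `lanEquivalence_of_isSelfLan`
assembles these facts. -/

noncomputable section

namespace PFlat

/-! ### Calculus of generalized elements of hom-objects -/

section GeneralizedComposition

variable {V : Type v} [Category.{w} V] [MonoidalCategory V]
  {C : Type u₁} [EnrichedCategory V C] {D : Type u₂} [EnrichedCategory V D]

/-- Composition of generalized elements of hom-objects. -/
def gcomp {a b c : C} {X Y : V} (f : X ⟶ (a ⟶[V] b)) (g : Y ⟶ (b ⟶[V] c)) :
    X ⊗ Y ⟶ (a ⟶[V] c) :=
  (f ⊗ₘ g) ≫ eComp V a b c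

end GeneralizedComposition

local infixr:81 " ⋄ " => gcomp

section GeneralizedComposition

variable {V : Type v} [Category.{w} V] [MonoidalCategory V]
  {C : Type u₁} [EnrichedCategory V C] {D : Type u₂} [EnrichedCategory V D]

variable {a b c d : C} {X X' Y Y' Z : V}

lemma gcomp_def (f : X ⟶ (a ⟶[V] b)) (g : Y ⟶ (b ⟶[V] c)) :
    (f ⊗ₘ g) ≫ eComp V a b c = f ⋄ g := rfl

lemma gcomp_assoc (f : X ⟶ (a ⟶[V] b)) (g : Y ⟶ (b ⟶[V] c)) (h : Z ⟶ (c ⟶[V] d)) :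
    (f ⋄ g) ⋄ h = (α_ X Y Z).hom ≫ f ⋄ g ⋄ h :=
  eComp_eComp f g h

lemma gcomp_assoc' (f : X ⟶ (a ⟶[V] b)) (g : Y ⟶ (b ⟶[V] c)) (h : Z ⟶ (c ⟶[V] d)) :
    f ⋄ g ⋄ h = (α_ X Y Z).inv ≫ (f ⋄ g) ⋄ h := by
  rw [gcomp_assoc, Iso.inv_hom_id_assoc]

lemma comp_gcomp (p : X' ⟶ X) (f : X ⟶ (a ⟶[V] b)) (g : Y ⟶ (b ⟶[V] c)) :
    (p ≫ f) ⋄ g = p ▷ Y ≫ f ⋄ g :=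
  comp_tensor_left_assoc _ _ _ _

lemma gcomp_comp (p : Y' ⟶ Y) (f : X ⟶ (a ⟶[V] b)) (g : Y ⟶ (b ⟶[V] c)) :
    f ⋄ (p ≫ g) = X ◁ p ≫ f ⋄ g :=
  comp_tensor_right_assoc _ _ _ _

lemma eId_gcomp (f : X ⟶ (a ⟶[V] b)) : eId V a ⋄ f = (λ_ X).hom ≫ f := eId_tensor_eComp f

lemma gcomp_eId (f : X ⟶ (a ⟶[V] b)) : f ⋄ eId V b = (ρ_ X).hom ≫ f := tensor_eId_eComp f

lemma id_gcomp_id : 𝟙 (a ⟶[V] b) ⋄ 𝟙 (b ⟶[V] c) = eComp V a b c := by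
  simp [gcomp]

lemma gcomp_map (F : EnrichedFunctor V C D) (f : X ⟶ (a ⟶[V] b)) (g : Y ⟶ (b ⟶[V] c)) :
    (f ⋄ g) ≫ F.map a c = (f ≫ F.map a b) ⋄ (g ≫ F.map b c) := by
  rw [gcomp, Category.assoc, F.map_comp, MonoidalCategory.tensorHom_comp_tensorHom_assoc]
  rfl

lemma eComp_map (F : EnrichedFunctor V C D) :
    eComp V a b c ≫ F.map a c = F.map a b ⋄ F.map b c :=
  F.map_comp a b c

lemma precompose_eq (p : 𝟙_ V ⟶ (a ⟶[V] b)) (f : X ⟶ (b ⟶[V] c)) :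
    f ≫ precompose p c = (λ_ X).inv ≫ p ⋄ f :=
  comp_precompose p f

variable [BraidedCategory V]

lemma GTrans.nat {F G : EnrichedFunctor V C D} (σ : GTrans X F G) (a b : C) :
    (β_ X (a ⟶[V] b)).hom ≫ F.map a b ⋄ σ.app b = σ.app a ⋄ G.map a b :=
  σ.naturality a b

end GeneralizedComposition


/-! ### V-valued functors as objects with an action -/

section Actions

variable {V : Type v} [Category.{w} V] [MonoidalCategory V] [MonoidalClosed V]
  {K : Type u₁} [EnrichedCategory V K]

lemma huncurry_comp {X Y Y' Z : V} (g : Y' ⟶ Y) (f : Y ⟶ EnrichedCategory.Hom X Z) :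
    huncurry (g ≫ f) = X ◁ g ≫ huncurry f :=
  MonoidalClosed.uncurry_natural_left g f

lemma huncurry_injective {X Y Z : V} {f g : Y ⟶ EnrichedCategory.Hom X Z}
    (h : huncurry f = huncurry g) : f = g := by
  rw [← hcurry_huncurry f, h, hcurry_huncurry]

lemma huncurry_gcomp {a b c X Y : V} (f : X ⟶ EnrichedCategory.Hom a b)
    (g : Y ⟶ EnrichedCategory.Hom b c) :
    huncurry (f ⋄ g) = (α_ a X Y).inv ≫ huncurry f ▷ Y ≫ huncurry g := by
  rw [gcomp, self_comp, huncurry_hcurry]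

lemma huncurry_eId (X : V) : huncurry (eId V X) = (ρ_ X).hom := by
  rw [self_id, huncurry_hcurry]

variable (W : EnrichedFunctor V K V)

lemma act_id (k : K) : W.obj k ◁ eId V k ≫ act W k k = (ρ_ _).hom := by
  rw [act, ← huncurry_comp, W.map_id, huncurry_eId]

lemma act_comp (k l m : K) :
    W.obj k ◁ eComp V k l m ≫ act W k m =
      (α_ _ _ _).inv ≫ act W k l ▷ (l ⟶[V] m) ≫ act W l m := by
  rw [act, ← huncurry_comp, eComp_map, huncurry_gcomp]
  rfl

lemma act_act (k l m : K) :
    act W k l ▷ (l ⟶[V] m) ≫ act W l m = (α_ _ _ _).hom ≫ W.obj k ◁ eComp V k l m ≫ act W k m := by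
  rw [act_comp, Iso.hom_inv_id_assoc]

lemma whiskerLeft_act {k l : K} {X : V} (f : X ⟶ (k ⟶[V] l)) :
    W.obj k ◁ f ≫ act W k l = huncurry (f ≫ W.map k l) := (huncurry_comp _ _).symm

/-- The `V`-functor to `V` given by an action on objects. -/
abbrev ofAct (obj : K → V) (a : ∀ k l, obj k ⊗ (k ⟶[V] l) ⟶ obj l)
    (hid : ∀ k, obj k ◁ eId V k ≫ a k k = (ρ_ _).hom)
    (hcomp : ∀ k l m, obj k ◁ eComp V k l m ≫ a k m =
      (α_ _ _ _).inv ≫ a k l ▷ (l ⟶[V] m) ≫ a l m) : EnrichedFunctor V K V where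
  obj := obj
  map k l := hcurry (a k l)
  map_id k := by rw [comp_hcurry, hid, self_id]
  map_comp k l m := by
    rw [self_comp, huncurry_hcurry, huncurry_hcurry, comp_hcurry, hcomp]

lemma act_ofAct (obj : K → V) (a hid hcomp) (k l : K) :
    act (ofAct obj a hid hcomp) k l = a k l := huncurry_hcurry _

lemma act_corep (b k l : K) : act (corep (V := V) b) k l = eComp V b k l := huncurry_hcurry _

lemma act_compFunctor {L : Type u₂} [EnrichedCategory V L] (S : EnrichedFunctor V L K) (k l : L) :
    act (S.comp V W) k l = _ ◁ S.map k l ≫ act W (S.obj k) (S.obj l) := by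
  rw [whiskerLeft_act]; rfl

end Actions

section LeftActions

variable {V : Type v} [Category.{w} V] [MonoidalCategory V] [SymmetricCategory V] [MonoidalClosed V]
  {K : Type u₁} [EnrichedCategory V K] (W : EnrichedFunctor V Kᵒᵖ V)

/-- The action `W l ⊗ K(k, l) ⟶ W k` of a presheaf. -/
def ract (k l : K) : W.obj (op l) ⊗ (k ⟶[V] l) ⟶ W.obj (op k) :=
  act W (op l) (op k)

/-- The left action `K(k, l) ⊗ W l ⟶ W k` of a presheaf. -/
def lact (k l : K) : (k ⟶[V] l) ⊗ W.obj (op l) ⟶ W.obj (op k) :=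
  (β_ _ _).hom ≫ ract W k l

lemma ract_eq (k l : K) : ract W k l = (β_ _ _).hom ≫ lact W k l := by
  rw [lact, SymmetricCategory.symmetry_assoc]

end LeftActions

/-! ### Braiding-free criteria for weighted limits and colimits, and their invariance -/

section ColimitCriterion

variable {V : Type v} [Category.{w} V] [MonoidalCategory V] [SymmetricCategory V] [MonoidalClosed V]
  {K : Type u₁} [EnrichedCategory V K] {B : Type u₂} [EnrichedCategory V B]
  {W : EnrichedFunctor V Kᵒᵖ V} {G : EnrichedFunctor V K B} {c : B}

namespace Cocyl

/-- The components of a cocylinder. -/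
def leg (t : Cocyl W G c) (k : K) : W.obj (op k) ⟶ (G.obj k ⟶[V] c) := t.app (op k)

/-- Composition in `Bᵒᵖ` is composition in `B` after a braiding; the braiding built into `lact`
cancels it, so no braiding remains in the naturality condition. -/
lemma lact_leg (t : Cocyl W G c) (k l : K) :
    lact W k l ≫ t.leg k = G.map k l ⋄ t.leg l := by
  have h : ract W k l ≫ t.leg k = (β_ _ _).hom ≫ G.map k l ⋄ t.leg l :=
    (t.naturality (op l) (op k)).trans (tensorHom_eComp_op_eq V _ _)
  rw [lact, Category.assoc, h, SymmetricCategory.symmetry_assoc]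

/-- A cocylinder given by its components. -/
def ofLegs (leg : ∀ k : K, W.obj (op k) ⟶ (G.obj k ⟶[V] c))
    (h : ∀ k l, lact W k l ≫ leg k = G.map k l ⋄ leg l) : Cocyl W G c where
  app k := leg k.unop
  naturality k l := by
    have h' := congrArg (fun t => (β_ _ _).hom ≫ t) (h l.unop k.unop)
    simp only [lact, Category.assoc, SymmetricCategory.symmetry_assoc] at h'
    exact h'.trans (tensorHom_eComp_op_eq V (x := op (G.obj l.unop)) (y := op (G.obj k.unop))
      (z := op c) (leg k.unop) (G.map l.unop k.unop)).symm

end Cocyl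

-- Two ways of reversing three factors. It carries the grading object from one side of a weight to
-- the other when cocylinders are compared with cylinders in `Bᵒᵖ`.
omit [MonoidalClosed V] in
lemma braiding_hexagon (X Y Z : V) :
    (α_ X Y Z).hom ≫ (β_ X (Y ⊗ Z)).hom ≫ (β_ Y Z).hom ▷ X =
      (β_ (X ⊗ Y) Z).hom ≫ Z ◁ (β_ X Y).hom ≫ (α_ Z Y X).inv := by
  rw [← BraidedCategory.braiding_naturality_left_assoc, BraidedCategory.braiding_tensor_left_hom,
    BraidedCategory.braiding_tensor_right_hom]
  simp

/-- The universal property of a colimit, in terms of the left action of the weight. -/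
lemma Cocyl.isColimit_iff (t : Cocyl W G c) :
    t.IsColimit ↔ ∀ ⦃X : V⦄ ⦃b : B⦄ (s : ∀ k : K, W.obj (op k) ⊗ X ⟶ (G.obj k ⟶[V] b)),
      (∀ k l : K, lact W k l ▷ X ≫ s k = (α_ _ _ _).hom ≫ G.map k l ⋄ s l) →
      ∃! f : X ⟶ (c ⟶[V] b), ∀ k, t.leg k ⋄ f = s k := by
  have key : ∀ {X : V} {b : B} (f : X ⟶ (c ⟶[V] b)) (k : K) (s : X ⊗ W.obj (op k) ⟶ _),
      ((f ⊗ₘ t.app (op k)) ≫ eComp V (op b) (op c) (op (G.obj k)) = s ↔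
        t.leg k ⋄ f = (β_ _ _).hom ≫ s) := by
    intro X b f k s
    rw [tensorHom_eComp_op_eq, ← cancel_epi (β_ (W.obj (op k)) X).hom,
      SymmetricCategory.symmetry_assoc]
    rfl
  constructor
  · intro h X b s hs
    -- Braiding the grading object to the left turns the family into a graded cylinder in `Bᵒᵖ`.
    have hs : ∀ k l : K, (α_ X (W.obj (op l)) (k ⟶[V] l)).hom ≫ X ◁ ract W k l ≫
        (β_ _ _).hom ≫ s k = (β_ _ _).hom ≫ G.map k l ⋄ ((β_ _ _).hom ≫ s l) := by
      intro k l
      rw [BraidedCategory.braiding_naturality_right_assoc, ract_eq, comp_whiskerRight,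
        Category.assoc, hs, reassoc_of% braiding_hexagon X, Iso.inv_hom_id_assoc,
        gcomp_comp]
    obtain ⟨f, hf, hf'⟩ := h (X := X) (b := op b)
      ⟨fun k => (β_ _ _).hom ≫ s k.unop, fun k l =>
        (hs l.unop k.unop).trans (tensorHom_eComp_op_eq V (x := op (G.obj l.unop))
          (y := op (G.obj k.unop)) (z := op b) _ _).symm⟩
    refine ⟨f, fun k => ?_, fun g hg => hf' g fun k => ?_⟩
    · have := (key f k _).1 (hf (op k))
      rwa [SymmetricCategory.symmetry_assoc] at this
    · refine (key g k.unop _).2 ?_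
      rw [SymmetricCategory.symmetry_assoc]
      exact hg _
  · intro h X b s
    have hs : ∀ k l : K, lact W k l ▷ X ≫ (β_ _ _).hom ≫ s.app (op k) =
        (α_ _ _ _).hom ≫ G.map k l ⋄ ((β_ _ _).hom ≫ s.app (op l)) := by
      intro k l
      have h1 : (α_ X (W.obj (op l)) (k ⟶[V] l)).hom ≫ X ◁ ract W k l ≫ s.app (op k) =
          (β_ _ _).hom ≫ gcomp (a := G.obj k) (b := G.obj l) (c := b.unop) (G.map k l)
            (s.app (op l)) :=
        (s.naturality (op l) (op k)).trans (tensorHom_eComp_op_eq V _ _)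
      rw [ract_eq, MonoidalCategory.whiskerLeft_comp, Category.assoc] at h1
      rw [gcomp_comp, ← cancel_epi ((β_ (W.obj (op l)) (k ⟶[V] l)).hom ▷ X),
        ← cancel_epi (β_ X _).hom, ← cancel_epi (α_ _ _ _).hom]
      trans (β_ _ _).hom ≫ G.map k l ⋄ s.app (op l)
      · rw [← h1]
        simp only [BraidedCategory.braiding_naturality_left_assoc,
          SymmetricCategory.symmetry_assoc]
      · rw [reassoc_of% braiding_hexagon X,
          Iso.inv_hom_id_assoc, ← MonoidalCategory.whiskerLeft_comp_assoc _ (β_ _ _).hom,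
          SymmetricCategory.symmetry, MonoidalCategory.whiskerLeft_id, Category.id_comp]
    obtain ⟨f, hf, hf'⟩ := h (fun k => (β_ _ _).hom ≫ s.app (op k)) hs
    exact ⟨f, fun k => (key f k.unop _).2 (hf _), fun g hg => hf' g fun k => (key g k _).1 (hg _)⟩

end ColimitCriterion

section LimitCriterion

variable {V : Type v} [Category.{w} V] [MonoidalCategory V] [MonoidalClosed V]
  {K : Type u₁} [EnrichedCategory V K] {B : Type u₂} [EnrichedCategory V B]
  {D : Type u₃} [EnrichedCategory V D]
  {W W' : EnrichedFunctor V K V} {G : EnrichedFunctor V K B} {c : B}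

lemma Cyl.isLimit_iff (t : Cyl W G c) :
    t.IsLimit ↔ ∀ ⦃X : V⦄ ⦃b : B⦄ (s : ∀ k : K, X ⊗ W.obj k ⟶ (b ⟶[V] G.obj k)),
      (∀ k l : K, (α_ _ _ _).hom ≫ X ◁ act W k l ≫ s l = s k ⋄ G.map k l) →
      ∃! f : X ⟶ (b ⟶[V] c), ∀ k, f ⋄ t.app k = s k :=
  ⟨fun h _ _ s hs => h ⟨s, hs⟩, fun h _ _ s => h s.app s.naturality⟩

lemma Cyl.act_app (t : Cyl W G c) (k l : K) :
    act W k l ≫ t.app l = t.app k ⋄ G.map k l := t.naturality k l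

lemma Cyl.act_gcomp_app (t : Cyl W G c) {b : B} {X : V} (f : X ⟶ (b ⟶[V] c)) (k l : K) :
    (α_ X (W.obj k) (k ⟶[V] l)).hom ≫ X ◁ act W k l ≫ f ⋄ t.app l =
      (f ⋄ t.app k) ⋄ G.map k l := by
  rw [← gcomp_comp, t.act_app, gcomp_assoc]

lemma Cyl.gcomp_map_app (t : Cyl W G c) (S : EnrichedFunctor V B D) {b : B} {X : V}
    (f : X ⟶ (b ⟶[V] c)) (k : K) :
    (f ≫ S.map b c) ⋄ (t.map S).app k = (f ⋄ t.app k) ≫ S.map b (G.obj k) :=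
  (gcomp_map S f (t.app k)).symm

/-- Restriction of a cylinder along a morphism of weights. -/
@[simps]
def Cyl.weightComp (t : Cyl W G c) (e : ∀ k, W'.obj k ⟶ W.obj k)
    (he : ∀ k l, act W' k l ≫ e l = e k ▷ _ ≫ act W k l) : Cyl W' G c where
  app k := e k ≫ t.app k
  naturality k l := by
    rw [reassoc_of% he k l, t.naturality, comp_tensor_left, Category.assoc]

lemma Cyl.IsLimit.weightComp {t : Cyl W G c} (ht : t.IsLimit) (e : ∀ k, W'.obj k ≅ W.obj k)
    (he : ∀ k l, act W' k l ≫ (e l).hom = (e k).hom ▷ _ ≫ act W k l) :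
    (t.weightComp (fun k => (e k).hom) he).IsLimit := by
  rw [Cyl.isLimit_iff] at ht ⊢
  intro X b s hs
  have he' : ∀ k l, act W k l ≫ (e l).inv = (e k).inv ▷ _ ≫ act W' k l := by
    intro k l
    rw [Iso.comp_inv_eq, Category.assoc, he]
    simp
  obtain ⟨f, hf, hf'⟩ := ht (fun k => X ◁ (e k).inv ≫ s k) fun k l => by
    rw [comp_gcomp, ← hs, ← MonoidalCategory.whiskerLeft_comp_assoc, he']
    simp
  refine ⟨f, fun k => ?_, fun g hg => hf' g fun k => ?_⟩
  · rw [Cyl.weightComp_app, gcomp_comp, hf]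
    simp
  · rw [← hg k, Cyl.weightComp_app, gcomp_comp]
    simp

lemma Cyl.IsLimit.exists_hom {c' : B} {t' : Cyl W G c'} (ht' : t'.IsLimit) (t : Cyl W G c) :
    ∃ f : 𝟙_ V ⟶ (c ⟶[V] c'), ∀ k, f ⋄ t'.app k = (λ_ _).hom ≫ t.app k := by
  obtain ⟨f, hf, -⟩ := t'.isLimit_iff.1 ht' (fun k => (λ_ _).hom ≫ t.app k) fun k l => by
    rw [leftUnitor_naturality_assoc, t.act_app, comp_gcomp]
    simp
  exact ⟨f, hf⟩

/-- The composite and the identity induce the same cylinder, so uniqueness identifies them. Only `t`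
needs to be a limit for this. -/
lemma Cyl.IsLimit.hom_comp {c' : B} {t : Cyl W G c} {t' : Cyl W G c'} (ht : t.IsLimit)
    (f : 𝟙_ V ⟶ (c ⟶[V] c')) (g : 𝟙_ V ⟶ (c' ⟶[V] c))
    (hf : ∀ k, f ⋄ t'.app k = (λ_ _).hom ≫ t.app k)
    (hg : ∀ k, g ⋄ t.app k = (λ_ _).hom ≫ t'.app k) : (λ_ _).inv ≫ f ⋄ g = eId V c := by
  refine (t.isLimit_iff.1 ht (fun k => eId V c ⋄ t.app k) fun k l =>
    t.act_gcomp_app _ k l).unique (fun k => ?_) (fun k => rfl)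
  rw [comp_gcomp, gcomp_assoc, hg, gcomp_comp, hf, eId_gcomp]
  simp

/-- If `S` preserves some limit of `G` weighted by `W`, it preserves all of them. -/
lemma Cyl.IsLimit.map_of_map {c' : B} {t : Cyl W G c} {t' : Cyl W G c'} (ht : t.IsLimit)
    (ht' : t'.IsLimit) {S : EnrichedFunctor V B D} (hS : (t'.map S).IsLimit) :
    (t.map S).IsLimit := by
  obtain ⟨f, hf⟩ := ht'.exists_hom t
  obtain ⟨g, hg⟩ := ht.exists_hom t'
  have hSf : ∀ k, (f ≫ S.map _ _) ⋄ (t'.map S).app k = (λ_ _).hom ≫ (t.map S).app k := by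
    intro k
    rw [Cyl.gcomp_map_app, hf, Category.assoc]
    rfl
  have hSg : ∀ k, (g ≫ S.map _ _) ⋄ (t.map S).app k = (λ_ _).hom ≫ (t'.map S).app k := by
    intro k
    rw [Cyl.gcomp_map_app, hg, Category.assoc]
    rfl
  -- One composite of the comparison maps suffices: existence below uses only `g'`, and uniqueness
  -- recovers `m` from `m ⋄ f'` by composing with `g'`.
  have hSfg : (λ_ _).inv ≫ (f ≫ S.map _ _) ⋄ (g ≫ S.map _ _) = eId V (S.obj c) := by
    rw [← gcomp_map, reassoc_of% ht.hom_comp f g hf hg, S.map_id]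
  generalize f ≫ S.map _ _ = f' at *
  generalize g ≫ S.map _ _ = g' at *
  rw [Cyl.isLimit_iff] at hS ⊢
  intro X b s hs
  obtain ⟨h, hh, hh'⟩ := hS s hs
  refine ⟨(ρ_ _).inv ≫ h ⋄ g', fun k => ?_, fun m hm => ?_⟩
  · rw [comp_gcomp, gcomp_assoc, hSg, gcomp_comp, hh k]
    simp
  · have := hh' ((ρ_ _).inv ≫ m ⋄ f') fun k => by
      rw [comp_gcomp, gcomp_assoc, hSf, gcomp_comp, hm k]
      simp
    rw [← this, comp_gcomp, gcomp_assoc, (Iso.inv_comp_eq _).1 hSfg, gcomp_comp, gcomp_eId]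
    simp

end LimitCriterion

section ColimitWeightChange

variable {V : Type v} [Category.{w} V] [MonoidalCategory V] [SymmetricCategory V] [MonoidalClosed V]
  {K : Type u₁} [EnrichedCategory V K] {B : Type u₂} [EnrichedCategory V B]
  {W W' : EnrichedFunctor V Kᵒᵖ V} {G : EnrichedFunctor V K B} {c : B}

/-- The dual of `Cyl.IsLimit.weightComp`: the hypothesis on legs forces `t'` to be the restriction
of `t` along the isomorphism of weights. -/
lemma Cocyl.IsColimit.of_weight_iso {t : Cocyl W G c} (ht : t.IsColimit) (t' : Cocyl W' G c)
    (e : ∀ k, W'.obj (op k) ≅ W.obj (op k))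
    (he : ∀ k l, lact W' k l ≫ (e k).hom = _ ◁ (e l).hom ≫ lact W k l)
    (h : ∀ k, t'.leg k = (e k).hom ≫ t.leg k) : t'.IsColimit := by
  have he' : ∀ k l, ract W' k l ≫ (e k).hom = (e l).hom ▷ _ ≫ ract W k l := by
    intro k l
    rw [ract_eq, ract_eq, Category.assoc, he, BraidedCategory.braiding_naturality_left_assoc]
  have h' := Cyl.IsLimit.weightComp ht (fun k => e k.unop) (fun k l => he' l.unop k.unop)
  have ht' : t' = t.weightComp (fun k => (e k.unop).hom) (fun k l => he' l.unop k.unop) :=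
    Cyl.ext (funext fun k => h k.unop)
  rw [ht']
  exact h'

end ColimitWeightChange

/-! ### Coends in V as universal balanced families -/

section Tensor

variable {V : Type v} [Category.{w} V] [MonoidalCategory V] [SymmetricCategory V] [MonoidalClosed V]
  {K : Type u₁} [EnrichedCategory V K]

/-- A family of maps `M k ⊗ F k ⟶ z` compatible with the actions of `K`. -/
@[ext]
structure Bal (M : EnrichedFunctor V K V) (F : EnrichedFunctor V Kᵒᵖ V) (z : V) where
  app : ∀ k : K, M.obj k ⊗ F.obj (op k) ⟶ z
  balanced : ∀ k l : K, act M k l ▷ F.obj (op l) ≫ app l =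
    (α_ _ _ _).hom ≫ M.obj k ◁ lact F k l ≫ app k

variable {M : EnrichedFunctor V K V} {F : EnrichedFunctor V Kᵒᵖ V} {z : V}

/-- A balanced family is universal: it exhibits `z` as the coend `∫^k M k ⊗ F k`. -/
def Bal.IsTensor (τ : Bal M F z) : Prop :=
  ∀ ⦃v : V⦄ (σ : ∀ k, M.obj k ⊗ F.obj (op k) ⟶ v),
    (∀ k l : K, act M k l ▷ F.obj (op l) ≫ σ l = (α_ _ _ _).hom ≫ M.obj k ◁ lact F k l ≫ σ k) →
    ∃! f : z ⟶ v, ∀ k, τ.app k ≫ f = σ k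

namespace Bal.IsTensor

variable {τ : Bal M F z}

/-- Since V is closed, `X ⊗ -` is a left adjoint and preserves the coend; currying makes this
explicit. -/
lemma existsUnique_left (h : τ.IsTensor) {X v : V}
    (σ : ∀ k, X ⊗ M.obj k ⊗ F.obj (op k) ⟶ v)
    (hσ : ∀ k l, X ◁ act M k l ▷ F.obj (op l) ≫ σ l =
      X ◁ (α_ _ _ _).hom ≫ X ◁ M.obj k ◁ lact F k l ≫ σ k) :
    ∃! f : X ⊗ z ⟶ v, ∀ k, X ◁ τ.app k ≫ f = σ k := by
  obtain ⟨f, hf, hf'⟩ := h (fun k => MonoidalClosed.curry (σ k)) fun k l => by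
    rw [← MonoidalClosed.curry_natural_left, hσ, ← MonoidalClosed.curry_natural_left,
      ← MonoidalClosed.curry_natural_left]
  refine ⟨MonoidalClosed.uncurry f, fun k => ?_, fun g hg => ?_⟩
  · rw [← MonoidalClosed.uncurry_natural_left, hf, MonoidalClosed.uncurry_curry]
  · rw [← hf' (MonoidalClosed.curry g) fun k => by
      rw [← MonoidalClosed.curry_natural_left, hg], MonoidalClosed.uncurry_curry]

lemma existsUnique_right (h : τ.IsTensor) {X v : V}
    (σ : ∀ k, (M.obj k ⊗ F.obj (op k)) ⊗ X ⟶ v)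
    (hσ : ∀ k l, act M k l ▷ F.obj (op l) ▷ X ≫ σ l =
      (α_ _ _ _).hom ▷ X ≫ (M.obj k ◁ lact F k l) ▷ X ≫ σ k) :
    ∃! f : z ⊗ X ⟶ v, ∀ k, τ.app k ▷ X ≫ f = σ k := by
  obtain ⟨f, hf, hf'⟩ := h.existsUnique_left (X := X) (fun k => (β_ _ _).hom ≫ σ k) fun k l => by
    rw [BraidedCategory.braiding_naturality_right_assoc, hσ,
      BraidedCategory.braiding_naturality_right_assoc,
      BraidedCategory.braiding_naturality_right_assoc]
  refine ⟨(β_ _ _).hom ≫ f, fun k => ?_, fun g hg => ?_⟩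
  · rw [BraidedCategory.braiding_naturality_left_assoc, hf, SymmetricCategory.symmetry_assoc]
  · rw [← hf' ((β_ _ _).hom ≫ g) fun k => by
      rw [BraidedCategory.braiding_naturality_right_assoc, hg], SymmetricCategory.symmetry_assoc]

lemma hom_ext (h : τ.IsTensor) {v : V} {f g : z ⟶ v} (hfg : ∀ k, τ.app k ≫ f = τ.app k ≫ g) :
    f = g :=
  (h (fun k => τ.app k ≫ g) fun k l => by rw [reassoc_of% τ.balanced]).unique hfg fun _ => rfl

lemma hom_ext_left (h : τ.IsTensor) {X v : V} {f g : X ⊗ z ⟶ v}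
    (hfg : ∀ k, X ◁ τ.app k ≫ f = X ◁ τ.app k ≫ g) : f = g := by
  apply MonoidalClosed.curry_injective
  refine h.hom_ext fun k => ?_
  rw [← MonoidalClosed.curry_natural_left, hfg, MonoidalClosed.curry_natural_left]

lemma hom_ext_right (h : τ.IsTensor) {X v : V} {f g : z ⊗ X ⟶ v}
    (hfg : ∀ k, τ.app k ▷ X ≫ f = τ.app k ▷ X ≫ g) : f = g := by
  rw [← cancel_epi (β_ X z).hom]
  refine h.hom_ext_left fun k => ?_
  rw [BraidedCategory.braiding_naturality_right_assoc, hfg,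
    BraidedCategory.braiding_naturality_right_assoc]

lemma hom_ext_middle (h : τ.IsTensor) {X Y v : V} {f g : X ⊗ z ⊗ Y ⟶ v}
    (hfg : ∀ k, X ◁ τ.app k ▷ Y ≫ f = X ◁ τ.app k ▷ Y ≫ g) : f = g := by
  apply MonoidalClosed.curry_injective
  refine h.hom_ext_right fun k => ?_
  rw [← MonoidalClosed.curry_natural_left, hfg, MonoidalClosed.curry_natural_left]

end Bal.IsTensor

/-- Universality is invariant under isomorphism. -/
lemma Bal.IsTensor.of_iso {M' : EnrichedFunctor V K V} {z' : V} {τ : Bal M F z}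
    (h : τ.IsTensor) (τ' : Bal M' F z') (e : ∀ k, M'.obj k ≅ M.obj k)
    (he : ∀ k l, act M' k l ≫ (e l).hom = (e k).hom ▷ _ ≫ act M k l) (i : z' ≅ z)
    (hτ : ∀ k, τ'.app k ≫ i.hom = (e k).hom ▷ _ ≫ τ.app k) : τ'.IsTensor := by
  have he' : ∀ k l, act M k l ≫ (e l).inv = (e k).inv ▷ _ ≫ act M' k l := by
    intro k l
    rw [Iso.comp_inv_eq, Category.assoc, he]
    simp
  intro v σ hσ
  obtain ⟨f, hf, hf'⟩ := h (fun k => (e k).inv ▷ _ ≫ σ k) fun k l => by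
    rw [← comp_whiskerRight_assoc, he', comp_whiskerRight, Category.assoc, hσ,
      whisker_exchange_assoc]
    simp
  refine ⟨i.hom ≫ f, fun k => ?_, fun g hg => ?_⟩
  · rw [reassoc_of% hτ, hf]
    simp
  · rw [← hf' (i.inv ≫ g) fun k => ?_, Iso.hom_inv_id_assoc]
    have h1 : τ.app k = (e k).inv ▷ _ ≫ τ'.app k ≫ i.hom := by
      rw [hτ]
      simp
    rw [h1, ← hg k]
    simp

/-- The balanced family underlying a cocylinder in `V`. -/
def Cocyl.toBal (t : Cocyl F M z) : Bal M F z where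
  app k := huncurry (t.leg k)
  balanced k l := by
    rw [← huncurry_comp, t.lact_leg, huncurry_gcomp, Iso.hom_inv_id_assoc]
    rfl

/-- The cocylinder in `V` given by a balanced family. -/
def Bal.toCocyl (τ : Bal M F z) : Cocyl F M z :=
  Cocyl.ofLegs (fun k => hcurry (τ.app k)) fun k l => huncurry_injective (by
    rw [huncurry_comp, huncurry_hcurry, huncurry_gcomp, huncurry_hcurry]
    exact ((Iso.inv_comp_eq _).2 (τ.balanced k l)).symm)

lemma Bal.leg_toCocyl (τ : Bal M F z) (k : K) : τ.toCocyl.leg k = hcurry (τ.app k) := rfl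

lemma Bal.toBal_toCocyl (τ : Bal M F z) : τ.toCocyl.toBal = τ := by
  ext k
  exact huncurry_hcurry _

/-- Legs into an internal hom uncurry to a balanced family. The graded universal property in V is no
stronger than the ungraded one, because tensoring with the grading object preserves coends. -/
lemma Cocyl.isColimit_iff_isTensor (t : Cocyl F M z) : t.IsColimit ↔ t.toBal.IsTensor := by
  rw [Cocyl.isColimit_iff]
  have key : ∀ {X v : V} (f : X ⟶ EnrichedCategory.Hom z v)
      (k : K) (s : F.obj (op k) ⊗ X ⟶ EnrichedCategory.Hom (M.obj k) v),
      t.leg k ⋄ f = s ↔ t.toBal.app k ▷ X ≫ huncurry f = (α_ _ _ _).hom ≫ huncurry s := by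
    intro X v f k s
    rw [← Iso.inv_comp_eq]
    constructor
    · rintro rfl
      exact (huncurry_gcomp _ _).symm
    · intro h
      exact huncurry_injective ((huncurry_gcomp _ _).trans h)
  constructor
  · intro h v σ hσ
    obtain ⟨f, hf, hf'⟩ := h (X := 𝟙_ V) (b := v) (fun k => hcurry (M.obj k ◁ (ρ_ _).hom ≫ σ k))
      fun k l => huncurry_injective (by
        rw [huncurry_comp, huncurry_hcurry, huncurry_comp, huncurry_gcomp, huncurry_hcurry]
        have := hσ k l
        rw [← Iso.inv_comp_eq] at this
        rw [← MonoidalCategory.whiskerLeft_comp_assoc, rightUnitor_naturality,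
          MonoidalCategory.whiskerLeft_comp_assoc, ← this]
        change _ = _ ≫ _ ≫ act M k l ▷ _ ≫ _
        rw [← whisker_exchange_assoc]
        simp)
    have key' : ∀ (g : z ⟶ v) k, t.leg k ⋄ hcurry ((ρ_ _).hom ≫ g) =
        hcurry (M.obj k ◁ (ρ_ _).hom ≫ σ k) ↔ t.toBal.app k ≫ g = σ k := by
      intro g k
      rw [key, huncurry_hcurry, huncurry_hcurry, rightUnitor_naturality_assoc,
        ← cancel_epi (ρ_ _).hom]
      simp
    refine ⟨(ρ_ _).inv ≫ huncurry f, fun k => ?_, fun g hg => ?_⟩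
    · rw [← key', Iso.hom_inv_id_assoc, hcurry_huncurry]
      exact hf k
    · rw [← hf' (hcurry ((ρ_ _).hom ≫ g)) fun k => (key' g k).2 (hg k), huncurry_hcurry,
        Iso.inv_hom_id_assoc]
  · intro h X v s hs
    obtain ⟨f, hf, hf'⟩ := h.existsUnique_right (X := X)
      (fun k => (α_ _ _ _).hom ≫ huncurry (s k)) fun k l => by
        have := congrArg huncurry (hs k l)
        rw [huncurry_comp, huncurry_comp, huncurry_gcomp] at this
        rw [associator_naturality_middle_assoc, this]
        simp
        rfl
    refine ⟨hcurry f, fun k => (key _ _ _).2 ?_, fun g hg => ?_⟩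
    · rw [huncurry_hcurry, hf]
    · rw [← hf' (huncurry g) fun k => (key _ _ _).1 (hg k), hcurry_huncurry]

lemma Bal.isColimit_toCocyl {τ : Bal M F z} : τ.toCocyl.IsColimit ↔ τ.IsTensor := by
  rw [Cocyl.isColimit_iff_isTensor, Bal.toBal_toCocyl]

end Tensor

/-! ### Uniqueness for limits and colimits, and preservation criteria -/

section ColimitMap

variable {V : Type v} [Category.{w} V] [MonoidalCategory V] [SymmetricCategory V] [MonoidalClosed V]
  {K : Type u₁} [EnrichedCategory V K] {B : Type u₂} [EnrichedCategory V B]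
  {D : Type u₃} [EnrichedCategory V D]

lemma Cocyl.lact_leg_gcomp {W : EnrichedFunctor V Kᵒᵖ V} {G : EnrichedFunctor V K B} {c : B}
    (t : Cocyl W G c) {X : V} {b : B} (f : X ⟶ (c ⟶[V] b)) (k l : K) :
    lact W k l ▷ X ≫ t.leg k ⋄ f = (α_ _ _ _).hom ≫ G.map k l ⋄ t.leg l ⋄ f := by
  rw [← comp_gcomp, t.lact_leg, gcomp_assoc]

lemma Cocyl.IsColimit.hom_ext {W : EnrichedFunctor V Kᵒᵖ V} {G : EnrichedFunctor V K B} {c : B}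
    {t : Cocyl W G c} (ht : t.IsColimit) {X : V} {b : B} {f g : X ⟶ (c ⟶[V] b)}
    (h : ∀ k, t.leg k ⋄ f = t.leg k ⋄ g) : f = g :=
  (t.isColimit_iff.1 ht (fun k => t.leg k ⋄ g) fun k l =>
    t.lact_leg_gcomp g k l).unique h fun _ => rfl

omit [SymmetricCategory V] in
lemma Cyl.IsLimit.hom_ext {W : EnrichedFunctor V K V} {G : EnrichedFunctor V K B} {c : B}
    {t : Cyl W G c} (ht : t.IsLimit) {X : V} {b : B} {f g : X ⟶ (b ⟶[V] c)}
    (h : ∀ k, f ⋄ t.app k = g ⋄ t.app k) : f = g :=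
  (t.isLimit_iff.1 ht (fun k => g ⋄ t.app k) fun k l =>
    t.act_gcomp_app g k l).unique h fun _ => rfl

-- True by definition; it displays the composites with `S` as `≫`, so that rewriting can see them.
omit [SymmetricCategory V] in
lemma Cyl.isLimit_map_iff {W : EnrichedFunctor V K V} {G : EnrichedFunctor V K B} {c : B}
    (t : Cyl W G c) (S : EnrichedFunctor V B D) :
    (t.map S).IsLimit ↔ ∀ ⦃X : V⦄ ⦃b : D⦄ (s : ∀ k : K, X ⊗ W.obj k ⟶ (b ⟶[V] S.obj (G.obj k))),
      (∀ k l : K, (α_ _ _ _).hom ≫ X ◁ act W k l ≫ s l = s k ⋄ (G.map k l ≫ S.map _ _)) →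
      ∃! f : X ⟶ (b ⟶[V] S.obj c), ∀ k, f ⋄ (t.app k ≫ S.map _ _) = s k :=
  (t.map S).isLimit_iff

lemma Cocyl.isColimit_map_iff {W : EnrichedFunctor V Kᵒᵖ V} {G : EnrichedFunctor V K B} {c : B}
    (t : Cocyl W G c) (S : EnrichedFunctor V B D) :
    (t.map S).IsColimit ↔
      ∀ ⦃X : V⦄ ⦃b : D⦄ (s : ∀ k : K, W.obj (op k) ⊗ X ⟶ (S.obj (G.obj k) ⟶[V] b)),
      (∀ k l : K, lact W k l ▷ X ≫ s k = (α_ _ _ _).hom ≫ (G.map k l ≫ S.map _ _) ⋄ s l) →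
      ∃! f : X ⟶ (S.obj c ⟶[V] b), ∀ k, (t.leg k ≫ S.map _ _) ⋄ f = s k :=
  (t.map S).isColimit_iff

end ColimitMap

/-! ### The Yoneda lemma for graded transformations -/

section Yoneda

variable {V : Type v} [Category.{w} V] [MonoidalCategory V] [SymmetricCategory V] [MonoidalClosed V]
  {C : Type u₁} [EnrichedCategory V C]

/-- A graded transformation between `V`-functors to `V`, in uncurried form. -/
def GTrans.ofMaps {X : V} {F G : EnrichedFunctor V C V} (app : ∀ a, F.obj a ⊗ X ⟶ G.obj a)
    (h : ∀ a b, F.obj a ◁ (β_ X (a ⟶[V] b)).hom ≫ (α_ _ _ _).inv ≫ act F a b ▷ X ≫ app b =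
      (α_ _ _ _).inv ≫ app a ▷ _ ≫ act G a b) : GTrans X F G where
  app a := hcurry (app a)
  naturality a b := huncurry_injective (by
    rw [huncurry_comp, gcomp_def, gcomp_def, huncurry_gcomp, huncurry_gcomp, huncurry_hcurry,
      huncurry_hcurry]
    exact h a b)

lemma GTrans.huncurry_nat {X : V} {F G : EnrichedFunctor V C V} (σ : GTrans X F G) (a b : C) :
    F.obj a ◁ (β_ X (a ⟶[V] b)).hom ≫ (α_ _ _ _).inv ≫ act F a b ▷ X ≫ huncurry (σ.app b) =
      (α_ _ _ _).inv ≫ huncurry (σ.app a) ▷ _ ≫ act G a b := by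
  have := congrArg huncurry (σ.nat a b)
  rwa [huncurry_comp, huncurry_gcomp, huncurry_gcomp] at this

/-- The Yoneda transformation `M a ⊗ C(a, b) ⟶ M b`. -/
def yonedaTrans (M : EnrichedFunctor V C V) (a : C) : GTrans (M.obj a) (corep a) M :=
  GTrans.ofMaps (fun b => (β_ _ _).hom ≫ act M a b) fun c d => by
    rw [act_corep]
    dsimp only [corep]
    rw [BraidedCategory.braiding_naturality_left_assoc, act_comp,
      BraidedCategory.braiding_tensor_left_hom, comp_whiskerRight]
    simp only [Category.assoc, Iso.inv_hom_id_assoc, Iso.hom_inv_id_assoc]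
    rw [← MonoidalCategory.whiskerLeft_comp_assoc, SymmetricCategory.symmetry]
    simp

lemma yonedaTrans_app (M : EnrichedFunctor V C V) (a b : C) :
    (yonedaTrans M a).app b = hcurry ((β_ _ _).hom ≫ act M a b) := rfl

/-- Naturality of `σ` on `C(a, b)`, evaluated at the identity of `a`, expresses the component at `b`
through the one at `a`. -/
lemma GTrans.eq_yonedaTrans {X : V} {M : EnrichedFunctor V C V} {a : C}
    (σ : GTrans X (corep a) M) (b : C) :
    σ.app b = ((λ_ X).inv ≫ eId V a ▷ X ≫ huncurry (σ.app a)) ≫ (yonedaTrans M a).app b := by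
  apply huncurry_injective
  rw [yonedaTrans_app, comp_hcurry, huncurry_hcurry]
  have h := σ.huncurry_nat a b
  rw [act_corep] at h
  rw [BraidedCategory.braiding_naturality_right_assoc, ← Iso.inv_comp_eq]
  have h1 := congrArg (fun t => (λ_ _).inv ≫ eId V a ▷ (X ⊗ (a ⟶[V] b)) ≫ t) h
  dsimp only at h1
  rw [associator_inv_naturality_left_assoc, ← comp_whiskerRight_assoc,
    ← whisker_exchange_assoc, associator_inv_naturality_left_assoc, ← comp_whiskerRight_assoc] at h1
  have h2 : eId V a ▷ (a ⟶[V] b) ≫ eComp V a a b = (λ_ _).hom := by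
    rw [← cancel_epi (λ_ _).inv, e_id_comp, Iso.inv_hom_id]
  simp only [comp_whiskerRight, Category.assoc, leftUnitor_tensor_inv,
    Iso.hom_inv_id_assoc] at h1 ⊢
  rw [← h1, ← comp_whiskerRight_assoc, h2, SymmetricCategory.braiding_swap_eq_inv_braiding]
  simp

end Yoneda

/-! ### Pointwise limits and colimits in functor categories -/

section Pointwise

variable {V : Type v} [Category.{w} V] [MonoidalCategory V] [SymmetricCategory V] [MonoidalClosed V]
  [HasLimits V] {A : Type w} [EnrichedCategory V A] {D : Type u₂} [EnrichedCategory V D]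
  {K : Type u₁} [EnrichedCategory V K]

lemma homπ_nat (F G : EnrichedFunctor V A D) {X : V} (f : X ⟶ (F ⟶[V] G)) (a b : A) :
    (β_ X (a ⟶[V] b)).hom ≫ F.map a b ⋄ (f ≫ (homπ F G).app b) =
      (f ≫ (homπ F G).app a) ⋄ G.map a b :=
  ((homπ F G).precomp f).nat a b

lemma homπ_nat' (F G : EnrichedFunctor V A D) {X : V} (f : X ⟶ (F ⟶[V] G)) (a b : A) :
    F.map a b ⋄ (f ≫ (homπ F G).app b) =
      (β_ (a ⟶[V] b) X).hom ≫ (f ≫ (homπ F G).app a) ⋄ G.map a b := by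
  rw [← homπ_nat, SymmetricCategory.symmetry_assoc]

lemma gcomp_π {F G H : EnrichedFunctor V A D} {X Y : V} (f : X ⟶ (F ⟶[V] G)) (g : Y ⟶ (G ⟶[V] H))
    (a : A) : (f ⋄ g) ≫ (homπ F H).app a = (f ≫ (homπ F G).app a) ⋄ (g ≫ (homπ G H).app a) := by
  rw [gcomp, Category.assoc, eComp_π, MonoidalCategory.tensorHom_comp_tensorHom_assoc]
  rfl

/-- Evaluation at `a`. -/
abbrev ev (a : A) : EnrichedFunctor V (EnrichedFunctor V A D) D where
  obj F := F.obj a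
  map F G := (homπ F G).app a
  map_id F := eId_π F a
  map_comp F G H := eComp_π F G H a

/-- Colimits in functor categories may be computed pointwise. -/
lemma Cocyl.isColimit_of_ev {W : EnrichedFunctor V Kᵒᵖ V}
    {G : EnrichedFunctor V K (EnrichedFunctor V A D)} {Z : EnrichedFunctor V A D} (t : Cocyl W G Z)
    (h : ∀ a, (t.map (ev a)).IsColimit) : t.IsColimit := by
  rw [Cocyl.isColimit_iff]
  intro X M s hs
  have h' := fun a => (t.isColimit_map_iff (ev a)).1 (h a) (fun k => s k ≫ (homπ (G.obj k) M).app a)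
    fun k l => by rw [reassoc_of% hs, gcomp_π]
  choose f hf hf' using h'
  dsimp only at hf
  -- The components were chosen separately for each `a`. Naturality is tested on the legs of the
  -- colimit at `a`, where it follows from naturality of the legs and of the `s k`.
  have nat : ∀ a b : A, (β_ X (a ⟶[V] b)).hom ≫ Z.map a b ⋄ f b = f a ⋄ M.map a b := by
    intro a b
    refine (h a).hom_ext fun k => ?_
    change (t.leg k ≫ (homπ _ _).app a) ⋄ _ = (t.leg k ≫ (homπ _ _).app a) ⋄ _
    rw [gcomp_comp, gcomp_assoc', ← homπ_nat, comp_gcomp, gcomp_assoc, hf b, gcomp_assoc', hf a,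
      ← homπ_nat, BraidedCategory.braiding_tensor_left_hom]
    simp
  refine ⟨homLift ⟨f, nat⟩, fun k => homπ_ext fun a => ?_, fun g hg => homπ_ext fun a => ?_⟩
  · rw [gcomp_π, homLift_π]
    exact hf a k
  · rw [homLift_π]
    refine hf' a _ fun k => ?_
    rw [← hg k, gcomp_π]

/-- Limits in functor categories may be computed pointwise. -/
lemma Cyl.isLimit_of_ev {W : EnrichedFunctor V K V}
    {G : EnrichedFunctor V K (EnrichedFunctor V A D)} {Z : EnrichedFunctor V A D} (t : Cyl W G Z)
    (h : ∀ a, (t.map (ev a)).IsLimit) : t.IsLimit := by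
  rw [Cyl.isLimit_iff]
  intro X M s hs
  have h' := fun a => (t.isLimit_map_iff (ev a)).1 (h a) (fun k => s k ≫ (homπ M (G.obj k)).app a)
    fun k l => by rw [reassoc_of% hs, gcomp_π]
  choose f hf hf' using h'
  dsimp only at hf
  -- Dually, naturality is tested against the limit cylinder at the target `b`.
  have nat : ∀ a b : A, (β_ X (a ⟶[V] b)).hom ≫ M.map a b ⋄ f b = f a ⋄ Z.map a b := by
    intro a b
    refine (h b).hom_ext fun k => ?_
    change _ ⋄ (t.app k ≫ (homπ _ _).app b) = _ ⋄ (t.app k ≫ (homπ _ _).app b)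
    rw [comp_gcomp, gcomp_assoc, hf b, gcomp_assoc, homπ_nat', homπ_nat', gcomp_comp, gcomp_assoc',
      hf a, BraidedCategory.braiding_tensor_right_hom]
    simp only [Category.assoc, Iso.hom_inv_id_assoc]
    rw [← comp_whiskerRight_assoc, SymmetricCategory.symmetry]
    simp
  refine ⟨homLift ⟨f, nat⟩, fun k => homπ_ext fun a => ?_, fun g hg => homπ_ext fun a => ?_⟩
  · rw [gcomp_π, homLift_π]
    exact hf a k
  · rw [homLift_π]
    refine hf' a _ fun k => ?_
    rw [← hg k, gcomp_π]

end Pointwise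

/-! ### Double opposites and the presheaves C(J -, c) -/

section Opp

variable {V : Type v} [Category.{w} V] [MonoidalCategory V] [SymmetricCategory V] [MonoidalClosed V]
  {A : Type u₁} [EnrichedCategory V A]

/-- A covariant `V`-functor as a presheaf on the opposite category. -/
abbrev opp (M : EnrichedFunctor V A V) : EnrichedFunctor V Aᵒᵖᵒᵖ V where
  obj a := M.obj a.unop.unop
  map a b := M.map a.unop.unop b.unop.unop
  map_id a := M.map_id a.unop.unop
  map_comp a b c := by
    -- Passing to the opposite twice inserts two braidings, which cancel by symmetry.
    have h : eComp V a b c = eComp V a.unop.unop b.unop.unop c.unop.unop :=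
      SymmetricCategory.symmetry_assoc _ _ _
    rw [h]
    exact M.map_comp _ _ _

lemma lact_opp (M : EnrichedFunctor V A V) (k l : A) :
    lact (opp M) (op k) (op l) = (β_ (l ⟶[V] k) (M.obj l)).hom ≫ act M l k := rfl

lemma lact_nerve {C : Type u₂} [EnrichedCategory V C] (J : EnrichedFunctor V A C) (c : C)
    (k l : A) : lact (nerve J c) k l = J.map k l ⋄ 𝟙 (J.obj l ⟶[V] c) := by
  have h : ract (nerve J c) k l = (J.obj l ⟶[V] c) ◁ J.map k l ≫ (β_ _ _).hom ≫
      eComp V (J.obj k) (J.obj l) c := act_nerve J c l k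
  rw [lact, h, BraidedCategory.braiding_naturality_right_assoc, gcomp]
  change (β_ (k ⟶[V] l) (J.obj l ⟶[V] c)).hom ≫ (β_ (J.obj l ⟶[V] c) (k ⟶[V] l)).hom ≫
    J.map k l ▷ (J.obj l ⟶[V] c) ≫ eComp V (J.obj k) (J.obj l) c =
      (J.map k l ⊗ₘ 𝟙 (J.obj l ⟶[V] c)) ≫ eComp V (J.obj k) (J.obj l) c
  rw [SymmetricCategory.symmetry_assoc, tensorHom_id]

lemma whiskerLeft_lact_nerve {C : Type u₂} [EnrichedCategory V C] (J : EnrichedFunctor V A C)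
    (c : C) (k l : A) {X : V} (f : X ⟶ (J.obj l ⟶[V] c)) :
    (k ⟶[V] l) ◁ f ≫ lact (nerve J c) k l = J.map k l ⋄ f := by
  rw [lact_nerve]
  exact (gcomp_comp f (J.map k l) (𝟙 _)).symm.trans (by rw [Category.comp_id])

section

variable {C : Type u₂} [EnrichedCategory V C] {B : Type u₃} [EnrichedCategory V B]
    {J : EnrichedFunctor V A C} {F : EnrichedFunctor V A B} {T : EnrichedFunctor V C B}

/-- The components of the unit of a left Kan extension. -/
def lanUnit (φ : GTrans (𝟙_ V) F (J.comp V T)) (a : A) : 𝟙_ V ⟶ (F.obj a ⟶[V] T.obj (J.obj a)) :=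
  φ.app a

lemma leg_kanCocyl (φ : GTrans (𝟙_ V) F (J.comp V T)) (c : C) (a : A) :
    (kanCocyl J F T φ c).leg a =
      (λ_ (J.obj a ⟶[V] c)).inv ≫ lanUnit φ a ⋄ T.map (J.obj a) c :=
  precompose_eq (b := T.obj (J.obj a)) _ _

lemma comp_leg_kanCocyl (φ : GTrans (𝟙_ V) F (J.comp V T)) (c : C) (a : A)
    {X : V} (f : X ⟶ (J.obj a ⟶[V] c)) :
    f ≫ (kanCocyl J F T φ c).leg a = (λ_ X).inv ≫ lanUnit φ a ⋄ (f ≫ T.map (J.obj a) c) := by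
  rw [leg_kanCocyl, gcomp_comp, leftUnitor_inv_naturality_assoc]

end

end Opp

/-! ### The Yoneda isomorphism and its naturality in both variables -/

section YonedaIso

variable {V : Type v} [Category.{w} V] [MonoidalCategory V] [SymmetricCategory V] [MonoidalClosed V]

/-- Naturality in the representing object; apart from braidings this is associativity of the action
on `M`. -/
lemma corepMap_gcomp_yonedaTrans {C : Type u₁} [EnrichedCategory V C] (M : EnrichedFunctor V C V)
    (k l c : C) : (corepMap k l).app c ⋄ (yonedaTrans M l).app c =
      ((β_ (l ⟶[V] k) (M.obj l)).hom ≫ act M l k) ≫ (yonedaTrans M k).app c := by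
  apply huncurry_injective
  rw [huncurry_gcomp, huncurry_comp, yonedaTrans_app, yonedaTrans_app, huncurry_hcurry,
    huncurry_hcurry]
  dsimp only [corepMap, corep]
  rw [huncurry_hcurry]
  rw [comp_whiskerRight, Category.assoc, BraidedCategory.braiding_naturality_left_assoc,
    act_comp, MonoidalCategory.whiskerLeft_comp, Category.assoc,
    BraidedCategory.braiding_naturality_right_assoc,
    BraidedCategory.braiding_naturality_right_assoc,
    BraidedCategory.braiding_tensor_left_hom, BraidedCategory.braiding_tensor_right_hom]
  simp only [Category.assoc, Iso.hom_inv_id_assoc]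

variable [HasLimits V] {A : Type w} [EnrichedCategory V A]

/-- The Yoneda isomorphism `M a ≅ [A, V](A(a, -), M)`. -/
def yonedaIso (M : EnrichedFunctor V A V) (a : A) : M.obj a ≅ (corep a ⟶[V] M) where
  hom := homLift (yonedaTrans M a)
  inv := (λ_ _).inv ≫ eId V a ▷ _ ≫ huncurry ((homπ (corep a) M).app a)
  hom_inv_id := by
    rw [leftUnitor_inv_naturality_assoc, whisker_exchange_assoc, ← huncurry_comp, homLift_π,
      yonedaTrans_app, huncurry_hcurry, BraidedCategory.braiding_naturality_left_assoc, act_id]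
    simp
  inv_hom_id := homπ_ext fun b => by
    rw [Category.assoc, homLift_π, ← GTrans.eq_yonedaTrans, Category.id_comp]

lemma yonedaIso_hom_π (M : EnrichedFunctor V A V) (a b : A) :
    (yonedaIso M a).hom ≫ (homπ (corep a) M).app b = (yonedaTrans M a).app b :=
  homLift_π _ _

lemma act_yonedaIso (M : EnrichedFunctor V A V) (k l : A) :
    ((β_ (l ⟶[V] k) (M.obj l)).hom ≫ act M l k) ≫ (yonedaIso M k).hom =
      homLift (corepMap k l) ⋄ (yonedaIso M l).hom := by
  refine homπ_ext fun c => ?_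
  rw [gcomp_π, Category.assoc, yonedaIso_hom_π, yonedaIso_hom_π, homLift_π,
    corepMap_gcomp_yonedaTrans, Category.assoc]

/-- The Yoneda isomorphism is natural in the `V`-functor. -/
lemma yonedaIso_natural (M N : EnrichedFunctor V A V) (a : A) :
    huncurry ((homπ M N).app a) ≫ (yonedaIso N a).hom = (yonedaIso M a).hom ⋄ 𝟙 (M ⟶[V] N) := by
  refine homπ_ext fun b => ?_
  rw [gcomp_π, Category.assoc, yonedaIso_hom_π, yonedaIso_hom_π, Category.id_comp]
  apply huncurry_injective
  rw [huncurry_comp, huncurry_gcomp, yonedaTrans_app, yonedaTrans_app, huncurry_hcurry,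
    huncurry_hcurry, BraidedCategory.braiding_naturality_right_assoc, comp_whiskerRight,
    Category.assoc]
  have h := congrArg (fun t => (α_ _ _ _).hom ≫ M.obj a ◁ (β_ _ _).hom ≫ t)
    ((homπ M N).huncurry_nat a b)
  rw [← MonoidalCategory.whiskerLeft_comp_assoc, SymmetricCategory.symmetry] at h
  simp only [MonoidalCategory.whiskerLeft_id, Category.id_comp, Iso.hom_inv_id_assoc] at h
  rw [h, BraidedCategory.braiding_tensor_right_hom]
  simp

/-- Under Yoneda, composing with `g` in [A, V] becomes applying the component of `g` at `a`. -/
lemma yonedaIso_gcomp {M N : EnrichedFunctor V A V} {a : A} {Y Z : V} (f : Y ⟶ M.obj a)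
    (g : Z ⟶ (M ⟶[V] N)) : (f ≫ (yonedaIso M a).hom) ⋄ g =
      f ▷ Z ≫ huncurry (g ≫ (homπ M N).app a) ≫ (yonedaIso N a).hom := by
  rw [huncurry_comp, Category.assoc, yonedaIso_natural, ← gcomp_comp, Category.comp_id, comp_gcomp]

lemma gcomp_yonedaIso_inv {M N : EnrichedFunctor V A V} {a : A} {Y Z : V}
    (f : Y ⟶ (corep a ⟶[V] M)) (g : Z ⟶ (M ⟶[V] N)) : (f ⋄ g) ≫ (yonedaIso N a).inv =
      (f ≫ (yonedaIso M a).inv) ▷ Z ≫ huncurry (g ≫ (homπ M N).app a) := by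
  rw [Iso.comp_inv_eq, Category.assoc, ← yonedaIso_gcomp, Category.assoc, Iso.inv_hom_id,
    Category.comp_id]

lemma corepMap_yonedaIso_inv (k l : A) :
    homLift (corepMap k l) ≫ (yonedaIso (corep l) k).inv = 𝟙 (l ⟶[V] k) := by
  rw [Iso.comp_inv_eq, Category.id_comp]
  refine homπ_ext fun c => ?_
  rw [homLift_π, yonedaIso_hom_π, yonedaTrans_app, act_corep]
  rfl

end YonedaIso

section

variable {V : Type v} [Category.{w} V] [MonoidalCategory V] [SymmetricCategory V] [MonoidalClosed V]
  {K : Type u₁} [EnrichedCategory V K] {B : Type u₂} [EnrichedCategory V B]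
  {W W' : EnrichedFunctor V Kᵒᵖ V} {G : EnrichedFunctor V K B} {c : B}

/-- Restriction of a cocylinder along a morphism of weights. -/
def Cocyl.weightComp (t : Cocyl W G c) (e : ∀ k, W'.obj (op k) ⟶ W.obj (op k))
    (he : ∀ k l, lact W' k l ≫ e k = _ ◁ e l ≫ lact W k l) : Cocyl W' G c :=
  Cocyl.ofLegs (fun k => e k ≫ t.leg k) fun k l => by
    rw [reassoc_of% he, t.lact_leg, gcomp_comp]

end

/-! ### Kan extensions along Yoneda are tensor product functors -/

section TensorFunctor

variable {V : Type v} [Category.{w} V] [MonoidalCategory V] [SymmetricCategory V] [MonoidalClosed V]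
  [HasLimits V] {A : Type w} [EnrichedCategory V A]

/-- The `V`-functor `T` is `M ↦ ∫^a F a ⊗ M a`. -/
structure TensorFunctor (F : EnrichedFunctor V Aᵒᵖ V)
    (T : EnrichedFunctor V (EnrichedFunctor V A V) V) where
  cocyl : ∀ M, Cocyl (opp M) F (T.obj M)
  isColimit : ∀ M, (cocyl M).IsColimit
  natural : ∀ (M N : EnrichedFunctor V A V) (a : A), (cocyl M).leg (op a) ⋄ T.map M N =
    huncurry ((homπ M N).app a) ≫ (cocyl N).leg (op a)

/-- The Yoneda isomorphism between the weights `M` and `[A, V](A(-, -), M)`. -/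
def nerveIso (M : EnrichedFunctor V A V) (a : Aᵒᵖ) :
    (opp M).obj (op a) ≅ (nerve (coyoneda V A) M).obj (op a) :=
  yonedaIso M a.unop

lemma lact_nerveIso (M : EnrichedFunctor V A V) (k l : Aᵒᵖ) :
    lact (opp M) k l ≫ (nerveIso M k).hom =
      _ ◁ (nerveIso M l).hom ≫ lact (nerve (coyoneda V A) M) k l :=
  (act_yonedaIso M k.unop l.unop).trans
    (whiskerLeft_lact_nerve (coyoneda V A) M k l (yonedaIso M l.unop).hom).symm

/-- A left Kan extension along the Yoneda embedding computes tensor products. -/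
def IsLan.tensorFunctor {F : EnrichedFunctor V Aᵒᵖ V}
    {T : EnrichedFunctor V (EnrichedFunctor V A V) V}
    {φ : GTrans (𝟙_ V) F ((coyoneda V A).comp V T)} (h : IsLan (coyoneda V A) F T φ) :
    TensorFunctor F T where
  cocyl M := (kanCocyl (coyoneda V A) F T φ M).weightComp (fun a => (nerveIso M a).hom)
    (lact_nerveIso M)
  isColimit M := (h M).of_weight_iso _ (fun a => nerveIso M a) (lact_nerveIso M) fun a => rfl
  natural M N a := by
    let φ' : 𝟙_ V ⟶ EnrichedCategory.Hom (F.obj (op a)) (T.obj (corep a)) := φ.app (op a)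
    let κ : ∀ M : EnrichedFunctor V A V,
        (corep a ⟶[V] M) ⟶ EnrichedCategory.Hom (F.obj (op a)) (T.obj M) :=
      fun M => (kanCocyl (coyoneda V A) F T φ M).leg (op a)
    have key : ∀ (M : EnrichedFunctor V A V) {X : V} (f : X ⟶ (corep a ⟶[V] M)),
        f ≫ κ M = (λ_ X).inv ≫ φ' ⋄ (f ≫ T.map (corep a) M) := fun M X f =>
      comp_leg_kanCocyl φ M (op a) f
    -- Each `κ M` is the unit `φ'` followed by the action of `T`, so the claim combines
    -- functoriality of `T` with naturality of the Yoneda isomorphism in `M`.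
    change ((yonedaIso M a).hom ≫ κ M) ⋄ T.map M N =
      huncurry ((homπ M N).app a) ≫ (yonedaIso N a).hom ≫ κ N
    rw [key, reassoc_of% yonedaIso_natural, key, gcomp_map, comp_gcomp, gcomp_assoc,
      Category.id_comp]
    simp

/-- A `V`-functor computing tensor products is a left Kan extension along the Yoneda embedding. -/
lemma TensorFunctor.exists_isLan {F : EnrichedFunctor V Aᵒᵖ V}
    {T : EnrichedFunctor V (EnrichedFunctor V A V) V} (h : TensorFunctor F T) :
    ∃ φ : GTrans (𝟙_ V) F ((coyoneda V A).comp V T), IsLan (coyoneda V A) F T φ := by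
  -- The unit at `a` is forced: the leg at `a` of the coend for `M = A(a, -)`, evaluated at the
  -- identity of `a`.
  let p : ∀ a : A, 𝟙_ V ⟶ EnrichedCategory.Hom (F.obj (op a)) (T.obj (corep a)) :=
    fun a => eId V a ≫ (h.cocyl (corep a)).leg (op a)
  have hp : ∀ (a : A) (M : EnrichedFunctor V A V),
      p a ⋄ T.map (corep a) M = (λ_ _).hom ≫ (yonedaIso M a).inv ≫ (h.cocyl M).leg (op a) := by
    intro a M
    have := h.natural (corep a) M a
    rw [comp_gcomp, this]
    simp [yonedaIso]
  have hleg : ∀ (a b : A), F.map (op a) (op b) ⋄ (h.cocyl (corep b)).leg (op b) =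
      ((β_ (b ⟶[V] a) (b ⟶[V] b)).hom ≫ eComp V b b a) ≫ (h.cocyl (corep b)).leg (op a) := by
    intro a b
    rw [← (h.cocyl (corep b)).lact_leg (op a) (op b), lact_opp, act_corep]
  -- Up to a unitor, both sides are the leg at `a` of the coend for `A(b, -)`: one by `hp`, the
  -- other by compatibility of the legs with the action.
  have nat : ∀ a b : A, (β_ (𝟙_ V) (b ⟶[V] a)).hom ≫ F.map (op a) (op b) ⋄ p b =
      p a ⋄ (homLift (corepMap a b) ≫ T.map (corep a) (corep b)) := by
    intro a b
    have h2 : eId V b ▷ (b ⟶[V] a) ≫ eComp V b b a = (λ_ _).hom := by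
      rw [← cancel_epi (λ_ _).inv, e_id_comp, Iso.inv_hom_id]
    have e1 : p a ⋄ (homLift (corepMap a b) ≫ T.map (corep a) (corep b)) =
        (λ_ _).hom ≫ (h.cocyl (corep b)).leg (op a) := by
      rw [gcomp_comp, hp, leftUnitor_naturality_assoc, reassoc_of% corepMap_yonedaIso_inv]
    rw [e1, gcomp_comp]
    change _ ≫ (b ⟶[V] a) ◁ eId V b ≫ _ = _
    have := hleg a b
    rw [this, ← BraidedCategory.braiding_naturality_left_assoc]
    rw [Category.assoc, SymmetricCategory.symmetry_assoc, reassoc_of% h2]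
  refine ⟨⟨fun a => p a.unop, fun a b => nat a.unop b.unop⟩, fun M => ?_⟩
  refine (h.isColimit M).of_weight_iso _ (fun a => (nerveIso M a).symm) (fun k l => ?_)
      fun a => ?_
  · rw [Iso.symm_hom, Iso.comp_inv_eq, Category.assoc, lact_nerveIso]
    simp
  · rw [leg_kanCocyl]
    exact (Iso.inv_comp_eq _).2 (hp a.unop M)

end TensorFunctor

/-! ### Exchanging the two factors of a coend -/

section Swap

variable {V : Type v} [Category.{w} V] [MonoidalCategory V] [SymmetricCategory V] [MonoidalClosed V]
  {A : Type u₁} [EnrichedCategory V A] {M : EnrichedFunctor V A V} {F : EnrichedFunctor V Aᵒᵖ V}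
  {z : V}

/-- Each side of the first equation is a side of the second precomposed with one and the same
isomorphism, which cancels. -/
lemma balanced_swap_iff (σ : ∀ a : A, F.obj (op a) ⊗ M.obj a ⟶ z) (a b : A) :
    (act M b a ▷ F.obj (op a) ≫ (β_ _ _).hom ≫ σ a =
      (α_ _ _ _).hom ≫ M.obj b ◁ lact F b a ≫ (β_ _ _).hom ≫ σ b) ↔
    (ract F b a ▷ M.obj b ≫ σ b =
      (α_ _ _ _).hom ≫ F.obj (op a) ◁ ((β_ (b ⟶[V] a) (M.obj b)).hom ≫ act M b a) ≫ σ a) := by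
  have e1 : act M b a ▷ F.obj (op a) ≫ (β_ _ _).hom ≫ σ a =
      ((β_ _ _).hom ≫ F.obj (op a) ◁ (β_ _ _).hom ≫ (α_ _ _ _).inv) ≫
      (α_ _ _ _).hom ≫ F.obj (op a) ◁ ((β_ (b ⟶[V] a) (M.obj b)).hom ≫ act M b a) ≫ σ a := by
    rw [BraidedCategory.braiding_naturality_left_assoc, MonoidalCategory.whiskerLeft_comp]
    simp only [Category.assoc, Iso.inv_hom_id_assoc]
    rw [← MonoidalCategory.whiskerLeft_comp_assoc _ (β_ _ _).hom (β_ _ _).hom,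
      SymmetricCategory.symmetry]
    simp
  have e2 : (α_ _ _ _).hom ≫ M.obj b ◁ lact F b a ≫ (β_ _ _).hom ≫ σ b =
      ((β_ _ _).hom ≫ F.obj (op a) ◁ (β_ _ _).hom ≫ (α_ _ _ _).inv) ≫
        ract F b a ▷ M.obj b ≫ σ b := by
    rw [BraidedCategory.braiding_naturality_right_assoc, lact, comp_whiskerRight,
      Category.assoc, reassoc_of% braiding_hexagon (M.obj b)]
    simp
  rw [e1, e2, cancel_epi, eq_comm]

/-- A balanced family `F a ⊗ M a ⟶ z` with the factors exchanged. -/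
@[simps]
def Bal.swap (τ : Bal F (opp M) z) : Bal M F z where
  app a := (β_ _ _).hom ≫ τ.app (op a)
  balanced k l := (balanced_swap_iff (fun a => τ.app (op a)) l k).2 (τ.balanced (op l) (op k))

/-- A balanced family `M a ⊗ F a ⟶ z` with the factors exchanged. -/
@[simps]
def Bal.unswap (τ : Bal M F z) : Bal F (opp M) z where
  app a := (β_ (F.obj a) (M.obj a.unop)).hom ≫ τ.app a.unop
  balanced k l := (balanced_swap_iff (fun a => (β_ _ _).hom ≫ τ.app a) k.unop l.unop).1 (by
    rw [SymmetricCategory.symmetry_assoc, SymmetricCategory.symmetry_assoc]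
    exact τ.balanced l.unop k.unop)

lemma Bal.IsTensor.swap {τ : Bal F (opp M) z} (h : τ.IsTensor) : τ.swap.IsTensor := by
  intro v σ hσ
  obtain ⟨f, hf, hf'⟩ := h (fun k => (β_ (F.obj k) (M.obj k.unop)).hom ≫ σ k.unop) fun k l =>
    (balanced_swap_iff (fun a => (β_ _ _).hom ≫ σ a) k.unop l.unop).1 (by
      rw [SymmetricCategory.symmetry_assoc, SymmetricCategory.symmetry_assoc]
      exact hσ l.unop k.unop)
  refine ⟨f, fun k => ?_, fun g hg => hf' g fun k => ?_⟩
  · rw [Bal.swap_app, Category.assoc, hf, SymmetricCategory.symmetry_assoc]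
  · rw [← hg k.unop, Bal.swap_app, Category.assoc]
    exact (SymmetricCategory.symmetry_assoc (F.obj k) (M.obj k.unop) _).symm

lemma Bal.IsTensor.unswap {τ : Bal M F z} (h : τ.IsTensor) : τ.unswap.IsTensor := by
  intro v σ hσ
  obtain ⟨f, hf, hf'⟩ := h (fun k => (β_ _ _).hom ≫ σ (op k)) fun k l =>
    (balanced_swap_iff (fun a => σ (op a)) l k).2 (hσ (op l) (op k))
  refine ⟨f, fun k => ?_, fun g hg => hf' g fun k => ?_⟩
  · rw [Bal.unswap_app, Category.assoc, hf]
    exact SymmetricCategory.symmetry_assoc (F.obj k) (M.obj k.unop) _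
  · rw [← hg (op k), Bal.unswap_app, Category.assoc, SymmetricCategory.symmetry_assoc]

end Swap

/-! ### Tensoring with F, with F as the right-hand factor -/

section TensorData

variable {V : Type v} [Category.{w} V] [MonoidalCategory V] [SymmetricCategory V] [MonoidalClosed V]
  [HasLimits V] {A : Type w} [EnrichedCategory V A]

/-- The `V`-functor `T` is `M ↦ ∫^a M a ⊗ F a`. -/
structure TensorData (F : EnrichedFunctor V Aᵒᵖ V)
    (T : EnrichedFunctor V (EnrichedFunctor V A V) V) where
  bal : ∀ M, Bal M F (T.obj M)
  isTensor : ∀ M, (bal M).IsTensor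
  natural : ∀ (M N : EnrichedFunctor V A V) (a : A),
    M.obj a ◁ (β_ (F.obj (op a)) (M ⟶[V] N)).hom ≫ (α_ _ _ _).inv ≫
      huncurry ((homπ M N).app a) ▷ F.obj (op a) ≫ (bal N).app a =
    (α_ _ _ _).inv ≫ (bal M).app a ▷ (M ⟶[V] N) ≫ act T M N

-- The naturality conditions of `TensorData` and `TensorFunctor` differ only by invertible structure
-- maps at the source.
omit [MonoidalClosed V] [HasLimits V] in
lemma natural_swap_iff {F M N X TM TN : V} (e : M ⊗ X ⟶ N) (κ : F ⊗ M ⟶ TM) (κ' : F ⊗ N ⟶ TN)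
    (t : TM ⊗ X ⟶ TN) :
    M ◁ (β_ F X).hom ≫ (α_ _ _ _).inv ≫ e ▷ F ≫ (β_ _ _).hom ≫ κ' =
      (α_ _ _ _).inv ≫ ((β_ _ _).hom ≫ κ) ▷ X ≫ t ↔
    F ◁ e ≫ κ' = (α_ _ _ _).inv ≫ κ ▷ X ≫ t := by
  rw [BraidedCategory.braiding_naturality_left_assoc, BraidedCategory.braiding_tensor_left_hom,
    comp_whiskerRight, Category.assoc]
  simp only [Category.assoc, Iso.inv_hom_id_assoc]
  rw [← MonoidalCategory.whiskerLeft_comp_assoc, SymmetricCategory.symmetry]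
  simp only [MonoidalCategory.whiskerLeft_id, Category.id_comp]
  rw [cancel_epi, cancel_epi, Iso.eq_inv_comp]

variable {F : EnrichedFunctor V Aᵒᵖ V} {T : EnrichedFunctor V (EnrichedFunctor V A V) V}

/-- Tensoring with `F`, with the factors exchanged. -/
def TensorFunctor.tensorData (h : TensorFunctor F T) : TensorData F T where
  bal M := (h.cocyl M).toBal.swap
  isTensor M := ((h.cocyl M).isColimit_iff_isTensor.1 (h.isColimit M)).swap
  natural M N a := (natural_swap_iff _ _ _ _).2 (by
    have := congrArg huncurry (h.natural M N a)
    rw [huncurry_gcomp, huncurry_comp] at this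
    exact this.symm)

/-- Tensoring with `F`, with the factors exchanged. -/
def TensorData.tensorFunctor (h : TensorData F T) : TensorFunctor F T where
  cocyl M := (h.bal M).unswap.toCocyl
  isColimit M := Bal.isColimit_toCocyl.2 (h.isTensor M).unswap
  natural M N a := huncurry_injective (by
    rw [huncurry_gcomp, huncurry_comp]
    refine ((natural_swap_iff _ _ _ _).1 ?_).symm
    have := h.natural M N a
    rw [Bal.leg_toCocyl, Bal.leg_toCocyl, huncurry_hcurry, huncurry_hcurry, Bal.unswap_app,
      Bal.unswap_app]
    refine Eq.trans ?_ (this.trans ?_)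
    · exact congrArg (fun t => _ ≫ _ ≫ _ ≫ t) (SymmetricCategory.symmetry_assoc _ _ _)
    · exact congrArg (fun t => _ ≫ t ▷ _ ≫ _) (SymmetricCategory.symmetry_assoc _ _ _).symm)

end TensorData

/-! ### Functoriality of coends in the covariant factor -/

section TensorMap

variable {V : Type v} [Category.{w} V] [MonoidalCategory V] [SymmetricCategory V] [MonoidalClosed V]
  {A : Type u₁} [EnrichedCategory V A] {F F' : EnrichedFunctor V A V}
  {N : EnrichedFunctor V Aᵒᵖ V} {z z' X : V}

/-- The candidate family applies `γ` and then `τ'`; it is balanced because `γ` is natural and `τ'`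
is balanced, and `τ` stays universal after tensoring with `X`. -/
lemma exists_tensorMap (γ : GTrans X F F') {τ : Bal F N z} (hτ : τ.IsTensor) (τ' : Bal F' N z') :
    ∃ f : z ⊗ X ⟶ z', ∀ a, (α_ _ _ _).inv ≫ τ.app a ▷ X ≫ f =
      F.obj a ◁ (β_ (N.obj (op a)) X).hom ≫ (α_ _ _ _).inv ≫
        huncurry (γ.app a) ▷ N.obj (op a) ≫ τ'.app a := by
  obtain ⟨f, hf, -⟩ := hτ.existsUnique_right (X := X) (fun a => (α_ _ _ _).hom ≫
      F.obj a ◁ (β_ (N.obj (op a)) X).hom ≫ (α_ _ _ _).inv ≫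
        huncurry (γ.app a) ▷ N.obj (op a) ≫ τ'.app a) fun a b => by
    have h := γ.huncurry_nat a b
    have h' : act F a b ▷ X ≫ huncurry (γ.app b) = (α_ _ _ _).hom ≫
        F.obj a ◁ (β_ _ _).hom ≫ (α_ _ _ _).inv ≫ huncurry (γ.app a) ▷ _ ≫ act F' a b := by
      rw [← h, ← MonoidalCategory.whiskerLeft_comp_assoc, SymmetricCategory.symmetry]
      simp
    rw [associator_naturality_left_assoc, ← whisker_exchange_assoc,
      associator_inv_naturality_left_assoc, ← comp_whiskerRight_assoc, h']
    simp only [comp_whiskerRight, Category.assoc]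
    rw [τ'.balanced, associator_naturality_middle_assoc,
      ← MonoidalCategory.whiskerLeft_comp_assoc (F.obj a) (lact N a b ▷ X),
      BraidedCategory.braiding_naturality_left, MonoidalCategory.whiskerLeft_comp_assoc,
      BraidedCategory.braiding_tensor_left_hom]
    simp only [Category.assoc, MonoidalCategory.whiskerLeft_comp]
    rw [associator_inv_naturality_right_assoc, whisker_exchange_assoc]
    simp
  refine ⟨f, fun a => ?_⟩
  rw [hf, Iso.inv_hom_id_assoc]

/-- The action of a graded transformation on tensor products. -/
def tensorMap (γ : GTrans X F F') {τ : Bal F N z} (hτ : τ.IsTensor) (τ' : Bal F' N z') :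
    z ⊗ X ⟶ z' :=
  (exists_tensorMap γ hτ τ').choose

lemma tensorMap_spec (γ : GTrans X F F') {τ : Bal F N z} (hτ : τ.IsTensor) (τ' : Bal F' N z')
    (a : A) : τ.app a ▷ X ≫ tensorMap γ hτ τ' = (α_ _ _ _).hom ≫
      F.obj a ◁ (β_ (N.obj (op a)) X).hom ≫ (α_ _ _ _).inv ≫
        huncurry (γ.app a) ▷ N.obj (op a) ≫ τ'.app a := by
  rw [← (exists_tensorMap γ hτ τ').choose_spec a, Iso.hom_inv_id_assoc]
  rfl

lemma whiskerLeft_tensorMap (γ : GTrans X F F') {τ : Bal F N z} (hτ : τ.IsTensor)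
    (τ' : Bal F' N z') {Y : V} (p : Y ⟶ X) :
    z ◁ p ≫ tensorMap γ hτ τ' = tensorMap (γ.precomp p) hτ τ' := by
  refine hτ.hom_ext_right fun a => ?_
  rw [← whisker_exchange_assoc, tensorMap_spec, tensorMap_spec, GTrans.precomp_app, huncurry_comp,
    associator_naturality_right_assoc, ← MonoidalCategory.whiskerLeft_comp_assoc (F.obj a),
    BraidedCategory.braiding_naturality_right]
  simp

lemma tensorMap_refl {τ : Bal F N z} (hτ : τ.IsTensor) :
    tensorMap (GTrans.refl F) hτ τ = (ρ_ z).hom := by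
  refine hτ.hom_ext_right fun a => ?_
  rw [tensorMap_spec, GTrans.refl_app, huncurry_eId]
  simp

lemma tensorMap_comp {Y z'' : V} {F'' : EnrichedFunctor V A V} (γ : GTrans X F F')
    (δ : GTrans Y F' F'') {τ : Bal F N z} (hτ : τ.IsTensor) {τ' : Bal F' N z'} (hτ' : τ'.IsTensor)
    (τ'' : Bal F'' N z'') :
    tensorMap (γ.comp δ) hτ τ'' =
      (α_ _ _ _).inv ≫ tensorMap γ hτ τ' ▷ Y ≫ tensorMap δ hτ' τ'' := by
  refine hτ.hom_ext_right fun a => ?_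
  rw [tensorMap_spec, associator_inv_naturality_left_assoc, ← comp_whiskerRight_assoc,
    tensorMap_spec, GTrans.comp_app, gcomp_def, huncurry_gcomp]
  simp only [comp_whiskerRight, Category.assoc]
  rw [tensorMap_spec, associator_naturality_left_assoc, BraidedCategory.braiding_tensor_right_hom,
    ← whisker_exchange_assoc]
  simp

end TensorMap

/-! ### Families of coends as functors of the parameter -/

section TensorFamily

variable {V : Type v} [Category.{w} V] [MonoidalCategory V] [SymmetricCategory V] [MonoidalClosed V]
  [HasLimits V] {A : Type w} [EnrichedCategory V A] {K : Type u₁} [EnrichedCategory V K]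

/-- The values of a `V`-functor on hom-objects, as graded transformations. -/
def mapTrans {D : Type u₂} [EnrichedCategory V D]
    (G : EnrichedFunctor V K (EnrichedFunctor V A D)) (k l : K) :
    GTrans (k ⟶[V] l) (G.obj k) (G.obj l) :=
  (homπ _ _).precomp (G.map k l)

lemma mapTrans_id {D : Type u₂} [EnrichedCategory V D]
    (G : EnrichedFunctor V K (EnrichedFunctor V A D)) (k : K) :
    (mapTrans G k k).precomp (eId V k) = GTrans.refl _ := by
  ext a
  rw [mapTrans, GTrans.precomp_app, GTrans.precomp_app, G.map_id_assoc, eId_π]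
  rfl

lemma mapTrans_comp {D : Type u₂} [EnrichedCategory V D]
    (G : EnrichedFunctor V K (EnrichedFunctor V A D)) (k l m : K) :
    (mapTrans G k m).precomp (eComp V k l m) = (mapTrans G k l).comp (mapTrans G l m) := by
  ext a
  rw [mapTrans, GTrans.precomp_app, GTrans.precomp_app, G.map_comp_assoc, eComp_π,
    MonoidalCategory.tensorHom_comp_tensorHom_assoc]
  rfl

variable (G : EnrichedFunctor V K (EnrichedFunctor V A V)) {N : EnrichedFunctor V Aᵒᵖ V}
  {z : K → V} {τ : ∀ k, Bal (G.obj k) N (z k)} (hτ : ∀ k, (τ k).IsTensor)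

/-- The `V`-functor `k ↦ ∫^a (G k) a ⊗ N a`. -/
abbrev tensorFamily : EnrichedFunctor V K V :=
  ofAct z (fun k l => tensorMap (mapTrans G k l) (hτ k) (τ l))
    (fun k => by rw [whiskerLeft_tensorMap, mapTrans_id, tensorMap_refl])
    (fun k l m => by rw [whiskerLeft_tensorMap, mapTrans_comp, tensorMap_comp])

lemma act_tensorFamily (k l : K) :
    act (tensorFamily G hτ) k l = tensorMap (mapTrans G k l) (hτ k) (τ l) :=
  act_ofAct _ _ _ _ _ _

end TensorFamily

/-! ### The functor M ↦ (k ↦ M * G k), and cocylinders of presheaves -/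

section ColimitOfFlat

variable {V : Type v} [Category.{w} V] [MonoidalCategory V] [SymmetricCategory V] [MonoidalClosed V]
  [HasLimits V] {A : Type w} [EnrichedCategory V A] {K : Type w} [EnrichedCategory V K]

lemma TensorData.spec {F : EnrichedFunctor V Aᵒᵖ V}
    {T : EnrichedFunctor V (EnrichedFunctor V A V) V} (h : TensorData F T)
    (M N : EnrichedFunctor V A V) (a : A) :
    (h.bal M).app a ▷ (M ⟶[V] N) ≫ act T M N = (α_ _ _ _).hom ≫
      M.obj a ◁ (β_ (F.obj (op a)) (M ⟶[V] N)).hom ≫ (α_ _ _ _).inv ≫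
      huncurry ((homπ M N).app a) ▷ F.obj (op a) ≫ (h.bal N).app a := by
  rw [h.natural, Iso.hom_inv_id_assoc]

variable {G : EnrichedFunctor V K (EnrichedFunctor V Aᵒᵖ V)}
  {T : K → EnrichedFunctor V (EnrichedFunctor V A V) V} (d : ∀ k, TensorData (G.obj k) (T k))

/-- The action of `K` on the values of `G`. -/
abbrev diagAct (G : EnrichedFunctor V K (EnrichedFunctor V Aᵒᵖ V)) (k l : K) (a : A) :
    (G.obj k).obj (op a) ⊗ (k ⟶[V] l) ⟶ (G.obj l).obj (op a) :=
  huncurry ((mapTrans G k l).app (op a))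

/-- The `V`-functor `k ↦ ∫^a M a ⊗ (G k) a`. -/
abbrev flatFamily (M : EnrichedFunctor V A V) : EnrichedFunctor V K V :=
  tensorFamily G fun k => ((d k).isTensor M).unswap

/-- `tensorFamily` acts on the left-hand factor; exchanging the factors shows `K` acting on `(G k)
a` next to an inert `M a`. -/
lemma act_flatFamily (M : EnrichedFunctor V A V) (k l : K) (a : A) :
    ((d k).bal M).app a ▷ (k ⟶[V] l) ≫ act (flatFamily d M) k l =
      (α_ _ _ _).hom ≫ M.obj a ◁ diagAct G k l a ≫ ((d l).bal M).app a := by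
  rw [← Iso.inv_comp_eq, eq_comm, ← natural_swap_iff, Iso.eq_inv_comp, eq_comm, act_tensorFamily]
  exact tensorMap_spec (mapTrans G k l) ((d k).isTensor M).unswap ((d l).bal M).unswap (op a)

/-- Transformations out of `M` and the arrows of `K` act on different factors of `M a ⊗ (G k) a`, so
the two actions commute. -/
lemma flatFamily_natural (M N : EnrichedFunctor V A V) (k l : K) :
    (T k).obj M ◁ (β_ (M ⟶[V] N) (k ⟶[V] l)).hom ≫ (α_ _ _ _).inv ≫
        act (flatFamily d M) k l ▷ (M ⟶[V] N) ≫ act (T l) M N =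
      (α_ _ _ _).inv ≫ act (T k) M N ▷ (k ⟶[V] l) ≫ act (flatFamily d N) k l := by
  refine ((d k).isTensor M).hom_ext_right fun a => ?_
  rw [← whisker_exchange_assoc, associator_inv_naturality_left_assoc,
    associator_inv_naturality_left_assoc, ← comp_whiskerRight_assoc, ← comp_whiskerRight_assoc,
    act_flatFamily, (d k).spec]
  simp only [comp_whiskerRight, Category.assoc]
  rw [(d l).spec, act_flatFamily, associator_naturality_middle_assoc,
    ← MonoidalCategory.whiskerLeft_comp_assoc (M.obj a) (_ ▷ _),
    BraidedCategory.braiding_naturality_left, MonoidalCategory.whiskerLeft_comp_assoc,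
    BraidedCategory.braiding_tensor_left_hom, associator_naturality_left_assoc,
    ← whisker_exchange_assoc, associator_inv_naturality_right_assoc, whisker_exchange_assoc,
    MonoidalCategory.whiskerLeft_comp]
  simp
  -- What remains is a double braiding of the two grading objects, trivial by symmetry.
  rw [← MonoidalCategory.whiskerLeft_comp_assoc (M.obj a) (_ ◁ _) (_ ◁ _),
    ← MonoidalCategory.whiskerLeft_comp (G.obj k |>.obj (op a)), SymmetricCategory.symmetry]
  simp

/-- The `V`-functor `M ↦ (k ↦ ∫^a M a ⊗ (G k) a)`. -/
abbrev flatFamilyFunctor :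
    EnrichedFunctor V (EnrichedFunctor V A V) (EnrichedFunctor V K V) where
  obj M := flatFamily d M
  map M N := homLift ⟨fun k => (T k).map M N, fun k l => huncurry_injective (by
    rw [huncurry_comp, gcomp_def, gcomp_def, huncurry_gcomp, huncurry_gcomp]
    exact flatFamily_natural d M N k l)⟩
  map_id M := homπ_ext fun k => by
    rw [Category.assoc, homLift_π, eId_π]
    exact (T k).map_id M
  map_comp M N L := homπ_ext fun k => by
    rw [Category.assoc, Category.assoc, eComp_π, homLift_π,
      MonoidalCategory.tensorHom_comp_tensorHom_assoc, homLift_π, homLift_π]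
    exact (T k).map_comp M N L

lemma flatFamilyFunctor_map_π (M N : EnrichedFunctor V A V) (k : K) :
    (flatFamilyFunctor d).map M N ≫ (homπ (flatFamily d M) (flatFamily d N)).app k =
      (T k).map M N :=
  homLift_π _ _

variable {W : EnrichedFunctor V Kᵒᵖ V} {H : EnrichedFunctor V Aᵒᵖ V} (t : Cocyl W G H)

/-- The components `(G k) a ⊗ W k ⟶ H a` of a cocylinder of presheaves. -/
abbrev pointLeg (k : K) (a : A) : (G.obj k).obj (op a) ⊗ W.obj (op k) ⟶ H.obj (op a) :=
  huncurry (t.leg k ≫ (homπ (G.obj k) H).app (op a))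

/-- Compatibility with `K`, from the cocylinder condition; `lact_pointLeg` is the compatibility with
`A`, from naturality of each leg as a transformation of presheaves. -/
lemma diagAct_pointLeg (k l : K) (a : A) :
    diagAct G k l a ▷ W.obj (op l) ≫ pointLeg t l a =
      (α_ _ _ _).hom ≫ (G.obj k).obj (op a) ◁ lact W k l ≫ pointLeg t k a := by
  rw [← huncurry_comp, reassoc_of% t.lact_leg, gcomp_π, huncurry_gcomp]
  simp [diagAct, mapTrans]

lemma lact_pointLeg (k : K) (a b : A) :
    (a ⟶[V] b) ◁ pointLeg t k b ≫ lact H a b =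
      (α_ _ _ _).inv ≫ lact (G.obj k) a b ▷ W.obj (op k) ≫ pointLeg t k a := by
  have h : (G.obj k).obj (op b) ◁ (β_ (W.obj (op k)) (a ⟶[V] b)).hom ≫ (α_ _ _ _).inv ≫
      ract (G.obj k) a b ▷ W.obj (op k) ≫ pointLeg t k a =
      (α_ _ _ _).inv ≫ pointLeg t k b ▷ (a ⟶[V] b) ≫ ract H a b :=
    ((homπ (G.obj k) H).precomp (t.leg k)).huncurry_nat (op b) (op a)
  rw [Iso.eq_inv_comp] at h
  rw [lact, BraidedCategory.braiding_naturality_right_assoc, ← h,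
    BraidedCategory.braiding_tensor_right_hom, lact]
  simp only [Category.assoc, Iso.inv_hom_id_assoc]
  rw [← MonoidalCategory.whiskerLeft_comp_assoc, SymmetricCategory.symmetry]
  simp

/-- The diagram `k ↦ (G k) a`. -/
abbrev pointDiag (G : EnrichedFunctor V K (EnrichedFunctor V Aᵒᵖ V)) (a : A) :
    EnrichedFunctor V K V where
  obj k := (G.obj k).obj (op a)
  map k l := G.map k l ≫ (homπ (G.obj k) (G.obj l)).app (op a)
  map_id k := (G.comp V (ev (op a))).map_id k
  map_comp k l m := (G.comp V (ev (op a))).map_comp k l m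

lemma act_pointDiag (k l : K) (a : A) : act (pointDiag G a) k l = diagAct G k l a := rfl

/-- The balanced family `(G k) a ⊗ W k ⟶ H a` given by a cocylinder of presheaves. -/
def pointBal (a : A) : Bal (pointDiag G a) W (H.obj (op a)) where
  app k := pointLeg t k a
  balanced k l := diagAct_pointLeg t k l a

lemma pointBal_app (a : A) (k : K) : (pointBal t a).app k = pointLeg t k a := rfl

variable {t} (ht : ∀ a, (t.map (ev a)).IsColimit)

include ht in
lemma isTensor_pointBal (a : A) : (pointBal t a).IsTensor :=
  (Cocyl.isColimit_iff_isTensor _).1 (ht (op a))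

end ColimitOfFlat

/-! ### Fubini: tensoring commutes with weighted colimits of presheaves -/

section ColimitTensor

variable {V : Type v} [Category.{w} V] [MonoidalCategory V] [SymmetricCategory V] [MonoidalClosed V]
  [HasLimits V] {A : Type w} [EnrichedCategory V A] {K : Type w} [EnrichedCategory V K]
  {G : EnrichedFunctor V K (EnrichedFunctor V Aᵒᵖ V)}
  {T : K → EnrichedFunctor V (EnrichedFunctor V A V) V} (d : ∀ k, TensorData (G.obj k) (T k))
  {W : EnrichedFunctor V Kᵒᵖ V} {TW : EnrichedFunctor V (EnrichedFunctor V K V) V}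
  (e : TensorData W TW) {H : EnrichedFunctor V Aᵒᵖ V} {t : Cocyl W G H}
  (ht : ∀ a, (t.map (ev a)).IsColimit)

-- `H a` is the coend of `(G k) a ⊗ W k`, and remains one after applying `M a ⊗ -`, so the map may
-- be prescribed on each `M a ⊗ (G k) a ⊗ W k`.
include ht in
lemma exists_colimBal (M : EnrichedFunctor V A V) (a : A) :
    ∃ f : M.obj a ⊗ H.obj (op a) ⟶ TW.obj (flatFamily d M), ∀ k,
      M.obj a ◁ pointLeg t k a ≫ f = (α_ _ _ _).inv ≫
        ((d k).bal M).app a ▷ W.obj (op k) ≫ (e.bal (flatFamily d M)).app k := by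
  obtain ⟨f, hf, -⟩ := (isTensor_pointBal ht a).existsUnique_left (X := M.obj a)
    (fun k => (α_ _ _ _).inv ≫
        ((d k).bal M).app a ▷ W.obj (op k) ≫ (e.bal (flatFamily d M)).app k) fun k l => by
    have h1 : M.obj a ◁ diagAct G k l a ≫ ((d l).bal M).app a = (α_ _ _ _).inv ≫
        ((d k).bal M).app a ▷ (k ⟶[V] l) ≫ act (flatFamily d M) k l := by
      rw [act_flatFamily, Iso.inv_hom_id_assoc]
    rw [act_pointDiag, associator_inv_naturality_middle_assoc, ← comp_whiskerRight_assoc, h1]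
    simp only [comp_whiskerRight, Category.assoc]
    rw [(e.bal (flatFamily d M)).balanced, associator_inv_naturality_right_assoc,
      whisker_exchange_assoc, associator_naturality_left_assoc]
    simp
  exact ⟨f, hf⟩

/-- The map `M a ⊗ H a ⟶ ∫^k (∫^b M b ⊗ (G k) b) ⊗ W k`, for `H = ∫^k G k ⊗ W k`. -/
def colimMap (M : EnrichedFunctor V A V) (a : A) :
    M.obj a ⊗ H.obj (op a) ⟶ TW.obj (flatFamily d M) :=
  (exists_colimBal d e ht M a).choose

lemma colimMap_spec (M : EnrichedFunctor V A V) (a : A) (k : K) :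
    M.obj a ◁ pointLeg t k a ≫ colimMap d e ht M a = (α_ _ _ _).inv ≫
        ((d k).bal M).app a ▷ W.obj (op k) ≫ (e.bal (flatFamily d M)).app k :=
  (exists_colimBal d e ht M a).choose_spec k

/-- The balanced family exhibiting `∫^k (∫^b M b ⊗ (G k) b) ⊗ W k` as `∫^b M b ⊗ H b`. -/
def colimBal (M : EnrichedFunctor V A V) : Bal M H (TW.obj (flatFamily d M)) where
  app a := colimMap d e ht M a
  balanced a b := by
    refine (isTensor_pointBal ht b).hom_ext_left fun k => ?_
    rw [pointBal_app, whisker_exchange_assoc, colimMap_spec, tensor_whiskerLeft]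
    simp only [Category.assoc, Iso.inv_hom_id_assoc]
    rw [← MonoidalCategory.whiskerLeft_comp_assoc (M.obj a) (_ ◁ _), lact_pointLeg,
      MonoidalCategory.whiskerLeft_comp_assoc, MonoidalCategory.whiskerLeft_comp_assoc,
      colimMap_spec, associator_inv_naturality_left_assoc, ← comp_whiskerRight_assoc,
      ((d k).bal M).balanced, associator_inv_naturality_middle_assoc]
    simp

lemma colimBal_spec (M : EnrichedFunctor V A V) (a : A) (k : K) :
    M.obj a ◁ pointLeg t k a ≫ (colimBal d e ht M).app a = (α_ _ _ _).inv ≫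
        ((d k).bal M).app a ▷ W.obj (op k) ≫ (e.bal (flatFamily d M)).app k :=
  colimMap_spec d e ht M a k

/-- Maps out of either iterated coend are families `M a ⊗ (G k) a ⊗ W k ⟶ v` balanced in both `a`
and `k`. -/
lemma isTensor_colimBal (M : EnrichedFunctor V A V) : (colimBal d e ht M).IsTensor := by
  intro v s hs
  -- First the inner coend over `a`, with `k` fixed and `W k` as a spectator.
  have hk : ∀ k, ∃ f : (flatFamily d M).obj k ⊗ W.obj (op k) ⟶ v, ∀ a,
      ((d k).bal M).app a ▷ W.obj (op k) ≫ f =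
        (α_ _ _ _).hom ≫ M.obj a ◁ pointLeg t k a ≫ s a := by
    intro k
    obtain ⟨f, hf, -⟩ := ((d k).isTensor M).existsUnique_right (X := W.obj (op k))
      (fun a => (α_ _ _ _).hom ≫ M.obj a ◁ pointLeg t k a ≫ s a) fun a b => by
      rw [associator_naturality_left_assoc, ← whisker_exchange_assoc, hs, tensor_whiskerLeft]
      simp only [Category.assoc, Iso.inv_hom_id_assoc]
      rw [← MonoidalCategory.whiskerLeft_comp_assoc (M.obj a) (_ ◁ _), lact_pointLeg]
      simp
    exact ⟨f, hf⟩
  choose s' hs' using hk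
  -- Then the outer coend over `k`; balancedness is tested on the inner legs, where it reduces to
  -- that of the legs of `t`.
  obtain ⟨f, hf, hf'⟩ := e.isTensor (flatFamily d M) s' fun k l => by
    rw [← cancel_epi (α_ _ _ _).inv, Iso.inv_hom_id_assoc]
    refine ((d k).isTensor M).hom_ext_right fun a => ?_
    rw [associator_inv_naturality_left_assoc, ← comp_whiskerRight_assoc, act_flatFamily,
      ← whisker_exchange_assoc, hs']
    simp only [comp_whiskerRight, Category.assoc]
    rw [hs', associator_naturality_middle_assoc, ← MonoidalCategory.whiskerLeft_comp_assoc,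
      diagAct_pointLeg, associator_naturality_right_assoc]
    simp
  refine ⟨f, fun a => ?_, fun g hg => hf' g fun k => ?_⟩
  · refine (isTensor_pointBal ht a).hom_ext_left fun k => ?_
    rw [pointBal_app, reassoc_of% colimBal_spec d e ht M a k, hf, hs', Iso.inv_hom_id_assoc]
  · refine ((d k).isTensor M).hom_ext_right fun a => ?_
    rw [hs', ← hg a, reassoc_of% colimBal_spec d e ht M a k, Iso.hom_inv_id_assoc]

-- The coherence core of `colimBal_natural`: naturality of tensoring with `G` persists in the
-- presence of an extra factor `W`.
omit [MonoidalClosed V] [HasLimits V] in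
lemma natural_tensor_of_natural {M N G W X TM TN z : V} {e : M ⊗ X ⟶ N} {κ : M ⊗ G ⟶ TM}
    {κ' : N ⊗ G ⟶ TN} {s : TM ⊗ X ⟶ TN}
    (h : κ ▷ X ≫ s = (α_ _ _ _).hom ≫ M ◁ (β_ G X).hom ≫ (α_ _ _ _).inv ≫ e ▷ G ≫ κ')
    (q : TN ⊗ W ⟶ z) :
    M ◁ (β_ (G ⊗ W) X).hom ≫ (α_ _ _ _).inv ≫ e ▷ (G ⊗ W) ≫ (α_ _ _ _).inv ≫ κ' ▷ W ≫ q =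
      (α_ _ _ _).inv ≫ (α_ _ _ _).inv ▷ X ≫ κ ▷ W ▷ X ≫ (α_ _ _ _).hom ≫
        TM ◁ (β_ W X).hom ≫ (α_ _ _ _).inv ≫ s ▷ W ≫ q := by
  rw [associator_naturality_left_assoc, ← whisker_exchange_assoc,
    associator_inv_naturality_left_assoc κ, ← comp_whiskerRight_assoc (κ ▷ X), h,
    BraidedCategory.braiding_tensor_left_hom]
  simp

lemma colimBal_natural (M N : EnrichedFunctor V A V) (a : A) :
    M.obj a ◁ (β_ (H.obj (op a)) (M ⟶[V] N)).hom ≫ (α_ _ _ _).inv ≫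
      huncurry ((homπ M N).app a) ▷ H.obj (op a) ≫ (colimBal d e ht N).app a =
    (α_ _ _ _).inv ≫ (colimBal d e ht M).app a ▷ (M ⟶[V] N) ≫
      TW.obj (flatFamily d M) ◁ (flatFamilyFunctor d).map M N ≫
        act TW (flatFamily d M) (flatFamily d N) := by
  refine (isTensor_pointBal ht a).hom_ext_middle fun k => ?_
  have h2 : (flatFamily d M).obj k ◁ (flatFamilyFunctor d).map M N ≫
      huncurry ((homπ (flatFamily d M) (flatFamily d N)).app k) = act (T k) M N := by
    rw [← huncurry_comp, flatFamilyFunctor_map_π]; rfl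
  rw [pointBal_app, associator_inv_naturality_middle_assoc, ← comp_whiskerRight_assoc,
    colimBal_spec]
  simp only [comp_whiskerRight, Category.assoc]
  rw [← whisker_exchange_assoc, e.spec,
    ← MonoidalCategory.whiskerLeft_comp_assoc (M.obj a) (_ ▷ _),
    BraidedCategory.braiding_naturality_left, MonoidalCategory.whiskerLeft_comp_assoc,
    associator_inv_naturality_right_assoc, whisker_exchange_assoc, colimBal_spec,
    associator_naturality_right_assoc,
    ← MonoidalCategory.whiskerLeft_comp_assoc _ (_ ◁ _) (β_ _ _).hom,
    BraidedCategory.braiding_naturality_right, MonoidalCategory.whiskerLeft_comp_assoc,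
    associator_inv_naturality_middle_assoc, ← comp_whiskerRight_assoc (_ ◁ _), h2]
  exact natural_tensor_of_natural ((d k).spec M N a) _

/-- Tensoring with `H = ∫^k G k ⊗ W k`. -/
def colimTensorData : TensorData H ((flatFamilyFunctor d).comp V TW) where
  bal M := colimBal d e ht M
  isTensor M := isTensor_colimBal d e ht M
  natural M N a := by
    rw [act_compFunctor]
    exact colimBal_natural d e ht M N a

end ColimitTensor

/-! ### Preservation of limits by composites -/

section ContinuousComp

variable {V : Type v} [Category.{w} V] [MonoidalCategory V] [MonoidalClosed V]
  {K : Type u₁} [EnrichedCategory V K] {B : Type u₂} [EnrichedCategory V B]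
  {D : Type u₃} [EnrichedCategory V D] {E : Type u₄} [EnrichedCategory V E]

/-- The two cylinders lie over differently bracketed composites of functors, which agree only by
associativity of `≫`; the comparison therefore goes through the elementwise criterion. -/
lemma Cyl.isLimit_map_comp {W : EnrichedFunctor V K V} {G : EnrichedFunctor V K B} {c : B}
    (t : Cyl W G c) (S : EnrichedFunctor V B D) (R : EnrichedFunctor V D E) :
    (t.map (S.comp V R)).IsLimit ↔ ((t.map S).map R).IsLimit := by
  rw [Cyl.isLimit_map_iff (t.map S) R, Cyl.isLimit_map_iff t (S.comp V R)]
  have h1 : ∀ k l, (G.comp V S).map k l ≫ R.map (S.obj (G.obj k)) (S.obj (G.obj l)) =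
      G.map k l ≫ (S.comp V R).map (G.obj k) (G.obj l) := fun k l => Category.assoc _ _ _
  have h2 : ∀ k, (t.map S).app k ≫ R.map (S.obj c) (S.obj (G.obj k)) =
      t.app k ≫ (S.comp V R).map c (G.obj k) := fun k => Category.assoc _ _ _
  constructor
  · intro h X b s hs
    obtain ⟨f, hf, hf'⟩ := h s fun k l => (hs k l).trans (congrArg (fun u => s k ⋄ u) (h1 k l))
    exact ⟨f, fun k => (congrArg (fun u => f ⋄ u) (h2 k)).trans (hf k),
      fun g hg => hf' g fun k => (congrArg (fun u => g ⋄ u) (h2 k)).symm.trans (hg k)⟩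
  · intro h X b s hs
    obtain ⟨f, hf, hf'⟩ := h s fun k l => (hs k l).trans (congrArg (fun u => s k ⋄ u) (h1 k l).symm)
    exact ⟨f, fun k => (congrArg (fun u => f ⋄ u) (h2 k)).symm.trans (hf k),
      fun g hg => hf' g fun k => (congrArg (fun u => g ⋄ u) (h2 k)).trans (hg k)⟩

/-- Preservation of a limit depends on a `V`-functor only up to equality of its values on the
diagram. -/
lemma Cyl.isLimit_map_congr {W : EnrichedFunctor V K V} {G : EnrichedFunctor V K B} {c : B}
    (t : Cyl W G c) {S S' : EnrichedFunctor V B D} (h : S = S') (hS : (t.map S).IsLimit) :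
    (t.map S').IsLimit := h ▸ hS

end ContinuousComp

/-! ### Flat colimits of flat presheaves are flat -/

section Flat

variable {V : Type v} [Category.{w} V] [MonoidalCategory V] [SymmetricCategory V] [MonoidalClosed V]
  [HasLimits V] {P : LimitClass V} {A : Type w} [EnrichedCategory V A]

lemma IsFlat.exists_tensorData {F : EnrichedFunctor V Aᵒᵖ V} (h : IsFlat P F) :
    ∃ T : EnrichedFunctor V (EnrichedFunctor V A V) V, Nonempty (TensorData F T) ∧
      Continuous P T := by
  obtain ⟨T, φ, hT, hP⟩ := h
  exact ⟨T, ⟨hT.tensorFunctor.tensorData⟩, hP⟩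

lemma TensorData.isFlat {F : EnrichedFunctor V Aᵒᵖ V}
    {T : EnrichedFunctor V (EnrichedFunctor V A V) V} (h : TensorData F T)
    (hT : Continuous P T) : IsFlat P F := by
  obtain ⟨φ, hφ⟩ := h.tensorFunctor.exists_isLan
  exact ⟨T, φ, hφ, hT⟩

variable {K : Type w} [EnrichedCategory V K] {G : EnrichedFunctor V K (EnrichedFunctor V Aᵒᵖ V)}

/-- A cylinder in [K, V] is a limit once all its evaluations are, and evaluating the first functor
at `k` gives `T k`, which preserves `P`-limits. -/
lemma continuous_flatFamilyFunctor_comp {T : K → EnrichedFunctor V (EnrichedFunctor V A V) V}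
    (d : ∀ k, TensorData (G.obj k) (T k)) (hT : ∀ k, Continuous P (T k))
    {TW : EnrichedFunctor V (EnrichedFunctor V K V) V} (hTW : Continuous P TW) :
    Continuous P ((flatFamilyFunctor d).comp V TW) := by
  intro L _ U hU D c t ht
  rw [Cyl.isLimit_map_comp]
  refine hTW L U hU _ _ _ (Cyl.isLimit_of_ev _ fun k => ?_)
  have hk : (flatFamilyFunctor d).comp V (ev k) = T k := by
    have : ∀ M N, ((flatFamilyFunctor d).comp V (ev k)).map M N = (T k).map M N :=
      fun M N => flatFamilyFunctor_map_π d M N k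
    exact EnrichedFunctor.ext V (fun _ => rfl) fun M N => (Category.comp_id _).trans (this M N)
  exact (t.isLimit_map_comp _ _).1 (t.isLimit_map_congr hk.symm (hT k L U hU D c t ht))

/-- A pointwise colimit of flat presheaves with flat index is flat. -/
lemma isFlat_of_isColimit_ev (hG : ∀ k, IsFlat P (G.obj k)) {W : EnrichedFunctor V Kᵒᵖ V}
    (hW : IsFlat P W) {H : EnrichedFunctor V Aᵒᵖ V} (t : Cocyl W G H)
    (ht : ∀ a, (t.map (ev a)).IsColimit) : IsFlat P H := by
  choose T d hT using fun k => (hG k).exists_tensorData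
  obtain ⟨TW, ⟨e⟩, hTW⟩ := hW.exists_tensorData
  exact (colimTensorData (fun k => (d k).some) e ht).isFlat
    (continuous_flatFamilyFunctor_comp _ hT hTW)

end Flat

/-! ### Representables are flat -/

section Representable

variable {V : Type v} [Category.{w} V] [MonoidalCategory V] [SymmetricCategory V] [MonoidalClosed V]

omit [SymmetricCategory V] [MonoidalClosed V] in
lemma eId_whiskerRight_eComp {C : Type u₁} [EnrichedCategory V C] (a b : C) :
    eId V a ▷ (a ⟶[V] b) ≫ eComp V a a b = (λ_ _).hom := by
  rw [← cancel_epi (λ_ _).inv, e_id_comp, Iso.inv_hom_id]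

omit [SymmetricCategory V] [MonoidalClosed V] in
lemma whiskerLeft_eId_eComp {C : Type u₁} [EnrichedCategory V C] (a b : C) :
    (a ⟶[V] b) ◁ eId V b ≫ eComp V a b b = (ρ_ _).hom := by
  rw [← cancel_epi (ρ_ _).inv, e_comp_id, Iso.inv_hom_id]

variable [HasLimits V] {A : Type w} [EnrichedCategory V A]

/-- The presheaf `A(-, a)`. -/
abbrev rep (a : A) : EnrichedFunctor V Aᵒᵖ V := corep (op a)

omit [HasLimits V] in
lemma lact_rep (a k l : A) : lact (rep (V := V) a) k l = eComp V k l a := by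
  have h : ract (rep (V := V) a) k l = (β_ _ _).hom ≫ eComp V k l a :=
    act_corep (op a) (op l) (op k)
  rw [lact, h]
  exact SymmetricCategory.symmetry_assoc _ _ _

/-- The balanced family `M b ⊗ A(b, a) ⟶ M a`. -/
def repBal (M : EnrichedFunctor V A V) (a : A) : Bal M (rep a) (M.obj a) where
  app b := act M b a
  balanced k l := by
    rw [lact_rep]
    exact act_act M k l a

omit [HasLimits V] in
lemma repBal_app (M : EnrichedFunctor V A V) (a b : A) : (repBal M a).app b = act M b a := rfl

-- The co-Yoneda lemma.
omit [HasLimits V] in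
lemma isTensor_repBal (M : EnrichedFunctor V A V) (a : A) : (repBal M a).IsTensor := by
  intro v σ hσ
  have hσ' : ∀ k, act M k a ▷ (a ⟶[V] a) ≫ σ a =
      (α_ _ _ _).hom ≫ M.obj k ◁ eComp V k a a ≫ σ k := fun k => by
    have := hσ k a
    rwa [lact_rep] at this
  -- The induced map inserts the identity of `a` and uses the member `M a ⊗ A(a, a)` of the family.
  refine ⟨(ρ_ _).inv ≫ M.obj a ◁ eId V a ≫ σ a, fun k => ?_, fun g hg => ?_⟩
  · have h : act M k a ≫ (ρ_ _).inv ≫ M.obj a ◁ eId V a =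
        (ρ_ _).inv ≫ (M.obj k ⊗ (k ⟶[V] a)) ◁ eId V a ≫ act M k a ▷ (a ⟶[V] a) := by
      rw [rightUnitor_inv_naturality_assoc, whisker_exchange]
    rw [repBal_app, reassoc_of% h, hσ', associator_naturality_right_assoc,
      ← MonoidalCategory.whiskerLeft_comp_assoc, whiskerLeft_eId_eComp]
    simp
  · rw [← hg a, repBal_app, reassoc_of% act_id M a, Iso.inv_hom_id_assoc]

/-- Tensoring with a representable presheaf is evaluation. -/
def repTensorData (a : A) : TensorData (rep a) (ev (D := V) a) where
  bal M := repBal M a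
  isTensor M := isTensor_repBal M a
  natural M N b := by
    have := congrArg (fun t => M.obj b ◁ (β_ _ _).hom ≫ t) ((homπ M N).huncurry_nat b a)
    rw [← MonoidalCategory.whiskerLeft_comp_assoc, SymmetricCategory.symmetry,
      MonoidalCategory.whiskerLeft_id, Category.id_comp] at this
    exact this.symm

/-- Evaluation preserves limits. -/
lemma continuous_ev (P : LimitClass V) (a : A) : Continuous P (ev (D := V) a) := by
  intro K _ W _ G c t ht
  rw [Cyl.isLimit_map_iff]
  intro X b s hs
  let π : ∀ M N : EnrichedFunctor V A V, (M ⟶[V] N) ⟶ EnrichedCategory.Hom (M.obj a) (N.obj a) :=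
    fun M N => (homπ M N).app a
  -- Evaluation at `a` is represented by `A(a, -)`. An `X`-graded cylinder with vertex `b` in V thus
  -- becomes a cylinder with vertex `A(a, -)` graded by `b ⊗ X`.
  let y : ∀ M : EnrichedFunctor V A V, M.obj a ≅ (corep a ⟶[V] M) := fun M => yonedaIso M a
  have hy : ∀ {M N : EnrichedFunctor V A V} {Y Z : V} (f : Y ⟶ M.obj a) (g : Z ⟶ (M ⟶[V] N)),
      (f ≫ (y M).hom) ⋄ g = f ▷ Z ≫ huncurry (g ≫ π M N) ≫ (y N).hom := yonedaIso_gcomp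
  have key : ∀ (f : X ⟶ EnrichedCategory.Hom b (c.obj a)) (k : K),
      f ⋄ (t.app k ≫ π c (G.obj k)) = s k ↔
        (huncurry f ≫ (y c).hom) ⋄ t.app k = (α_ _ _ _).hom ≫ huncurry (s k) ≫ (y _).hom := by
    intro f k
    rw [hy, ← Category.assoc, ← Category.assoc, cancel_mono, ← Iso.inv_comp_eq]
    constructor
    · intro h
      rw [← h, huncurry_gcomp]
    · intro h
      exact huncurry_injective ((huncurry_gcomp _ _).trans h)
  obtain ⟨f, hf, hf'⟩ := t.isLimit_iff.1 ht
    (fun k => (α_ _ _ _).hom ≫ huncurry (s k) ≫ (y _).hom) fun k l => by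
      have := congrArg huncurry (hs k l)
      rw [huncurry_comp, huncurry_comp, huncurry_gcomp, Iso.eq_inv_comp] at this
      rw [← Category.assoc (α_ b X (W.obj k)).hom, hy]
      rw [associator_naturality_right_assoc, comp_whiskerRight, Category.assoc]
      have h : huncurry (s k) ▷ (k ⟶[V] l) ≫ huncurry (G.map k l ≫ π (G.obj k) (G.obj l)) = _ :=
        this.symm
      rw [reassoc_of% h]
      simp
  refine ⟨hcurry (f ≫ (y c).inv), fun k => (key _ k).2 ?_, fun g hg => ?_⟩
  · rw [huncurry_hcurry, Category.assoc, Iso.inv_hom_id, Category.comp_id, hf]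
  · rw [← hf' (huncurry g ≫ (y c).hom) fun k => (key g k).1 (hg k), Category.assoc,
      Iso.hom_inv_id, Category.comp_id, hcurry_huncurry]

lemma isFlat_rep (P : LimitClass V) (a : A) : IsFlat P (rep (V := V) a) :=
  (repTensorData a).isFlat (continuous_ev P a)

end Representable

/-! ### Existence of pointwise flat colimits -/

section PointwiseColimit

variable {V : Type v} [Category.{w} V] [MonoidalCategory V] [SymmetricCategory V] [MonoidalClosed V]
  [HasLimits V] {A : Type w} [EnrichedCategory V A] {K : Type w} [EnrichedCategory V K]
  (G : EnrichedFunctor V K (EnrichedFunctor V A V))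

/-- The transpose `A ⟶ [K, V]` of a `V`-functor `K ⟶ [A, V]`. -/
abbrev flip : EnrichedFunctor V A (EnrichedFunctor V K V) where
  obj a := G.comp V (ev a)
  map a b := homLift ⟨fun k => (G.obj k).map a b, fun k l => by
    have h := homπ_nat (G.obj k) (G.obj l) (G.map k l) a b
    change (β_ _ _).hom ≫ (G.map k l ≫ (homπ (G.obj k) (G.obj l)).app a) ⋄ (G.obj l).map a b =
      (G.obj k).map a b ⋄ (G.map k l ≫ (homπ (G.obj k) (G.obj l)).app b)
    rw [← h, SymmetricCategory.symmetry_assoc]⟩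
  map_id a := homπ_ext fun k => by
    rw [Category.assoc, homLift_π, eId_π]
    exact (G.obj k).map_id a
  map_comp a b c := homπ_ext fun k => by
    rw [Category.assoc, Category.assoc, eComp_π, homLift_π,
      MonoidalCategory.tensorHom_comp_tensorHom_assoc, homLift_π, homLift_π]
    exact (G.obj k).map_comp a b c

lemma flip_map_π (a b : A) (k : K) :
    (flip G).map a b ≫ (homπ ((flip G).obj a) ((flip G).obj b)).app k = (G.obj k).map a b :=
  homLift_π _ _

variable {W : EnrichedFunctor V Kᵒᵖ V} {TW : EnrichedFunctor V (EnrichedFunctor V K V) V}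
  (e : TensorData W TW)

/-- The pointwise colimit `a ↦ ∫^k (G k) a ⊗ W k`. -/
abbrev pointColim : EnrichedFunctor V A V :=
  tensorFamily (flip G) fun a => e.isTensor ((flip G).obj a)

/-- The components of the pointwise colimit cocylinder. -/
def pointColimLeg (k : K) : GTrans (W.obj (op k)) (G.obj k) (pointColim G e) :=
  GTrans.ofMaps (fun a => (e.bal ((flip G).obj a)).app k) fun a b => by
    have h := tensorMap_spec (mapTrans (flip G) a b) (e.isTensor ((flip G).obj a))
      (e.bal ((flip G).obj b)) k
    have h' : huncurry ((mapTrans (flip G) a b).app k) = act (G.obj k) a b :=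
      congrArg huncurry (flip_map_π G a b k)
    rw [← Iso.inv_comp_eq, h'] at h
    rw [act_tensorFamily]
    exact h.symm

/-- The pointwise colimit cocylinder. -/
def pointColimCocyl : Cocyl W G (pointColim G e) :=
  Cocyl.ofLegs (fun k => homLift (pointColimLeg G e k)) fun k l => homπ_ext fun a => by
    rw [gcomp_π, Category.assoc, homLift_π, homLift_π]
    exact (e.bal ((flip G).obj a)).toCocyl.lact_leg k l

lemma isColimit_pointColimCocyl_map_ev (a : A) : ((pointColimCocyl G e).map (ev a)).IsColimit := by
  have h : (pointColimCocyl G e).map (ev a) = (e.bal ((flip G).obj a)).toCocyl :=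
    Cyl.ext (funext fun k => homLift_π (pointColimLeg G e k.unop) a)
  rw [h]
  exact Bal.isColimit_toCocyl.2 (e.isTensor _)

variable {P : LimitClass V}

/-- The coends at each `a` are values of `- * W` on the transposed diagram. Only the existence half
of flatness is used. -/
lemma exists_isColimit_ev (hW : IsFlat P W) : ∃ (Z : EnrichedFunctor V A V) (t : Cocyl W G Z),
    ∀ a, (t.map (ev a)).IsColimit := by
  obtain ⟨TW, ⟨e⟩, -⟩ := hW.exists_tensorData
  exact ⟨_, pointColimCocyl G e, isColimit_pointColimCocyl_map_ev G e⟩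

variable {G}

/-- Colimits with flat index in functor categories `[A, V]` are computed pointwise. -/
lemma Cocyl.IsColimit.map_ev (hW : IsFlat P W) {Z : EnrichedFunctor V A V} {t : Cocyl W G Z}
    (ht : t.IsColimit) (a : A) : (t.map (ev a)).IsColimit := by
  -- Preservation of one colimit of the diagram implies preservation of all, so comparison with a
  -- pointwise one is enough.
  obtain ⟨Z', t', ht'⟩ := exists_isColimit_ev G hW
  exact Cyl.IsLimit.map_of_map (S := opFunctor (ev a)) ht (t'.isColimit_of_ev ht') (ht' a)

end PointwiseColimit

section Closed

variable {V : Type v} [Category.{w} V] [MonoidalCategory V] [SymmetricCategory V] [MonoidalClosed V]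
  [HasLimits V] (A : Type w) [EnrichedCategory V A] (P : LimitClass V)

lemma closedUnderColimits_isFlat : ClosedUnderColimits (flatClass P)
    {F : EnrichedFunctor V Aᵒᵖ V | IsFlat P F} := by
  intro K _ W hW G hG
  refine ⟨?_, fun H t ht => isFlat_of_isColimit_ev hG hW t fun a => ht.map_ev hW a⟩
  obtain ⟨Z, t, ht⟩ := exists_isColimit_ev G hW
  exact ⟨Z, t, t.isColimit_of_ev ht⟩

end Closed

/-! ### Presheaves as colimits of representables; the closure statement -/

section Density

variable {V : Type v} [Category.{w} V] [MonoidalCategory V] [SymmetricCategory V] [MonoidalClosed V]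

-- Translates compatibility with left actions into the naturality condition of `GTrans.ofMaps`; the
-- two differ by an isomorphism of the source.
omit [MonoidalClosed V] in
lemma whiskerLeft_comp_lact_iff {F F' H H' X Y : V} (p : Y ⊗ F ⟶ F') (q : Y ⊗ H ⟶ H')
    (s : F ⊗ X ⟶ H) (s' : F' ⊗ X ⟶ H') :
    p ▷ X ≫ s' = (α_ _ _ _).hom ≫ Y ◁ s ≫ q ↔
      F ◁ (β_ X Y).hom ≫ (α_ _ _ _).inv ≫ ((β_ _ _).hom ≫ p) ▷ X ≫ s' =
        (α_ _ _ _).inv ≫ s ▷ Y ≫ (β_ _ _).hom ≫ q := by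
  have h : (α_ _ _ _).inv ≫ s ▷ Y ≫ (β_ _ _).hom ≫ q =
      (F ◁ (β_ X Y).hom ≫ (α_ _ _ _).inv ≫ (β_ _ _).hom ▷ X) ≫ (α_ _ _ _).hom ≫ Y ◁ s ≫ q := by
    rw [BraidedCategory.braiding_naturality_left_assoc, BraidedCategory.braiding_tensor_left_hom]
    simp
  rw [h, comp_whiskerRight, ← cancel_epi (F ◁ (β_ X Y).hom ≫ (α_ _ _ _).inv ≫ (β_ _ _).hom ▷ X)]
  simp only [Category.assoc]

variable [HasLimits V] {A : Type w} [EnrichedCategory V A]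

variable (V A) in
/-- The Yoneda embedding, with transparent values. -/
abbrev repFunctor : EnrichedFunctor V A (EnrichedFunctor V Aᵒᵖ V) where
  obj a := rep a
  map k l := (yoneda V A).map k l
  map_id := (yoneda V A).map_id
  map_comp := (yoneda V A).map_comp

lemma lact_yonedaIso (H : EnrichedFunctor V Aᵒᵖ V) (k l : A) :
    lact H k l ≫ (yonedaIso H (op k)).hom =
      (repFunctor V A).map k l ⋄ (yonedaIso H (op l)).hom := by
  have h : (repFunctor V A).map k l = homLift (corepMap (op k) (op l)) := Category.id_comp _
  rw [h]
  exact act_yonedaIso H (op k) (op l)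

/-- The cocylinder exhibiting a presheaf as a colimit of representables. -/
def densityCocyl (F : EnrichedFunctor V Aᵒᵖ V) : Cocyl F (repFunctor V A) F :=
  Cocyl.ofLegs (fun k => (yonedaIso F (op k)).hom) fun k l => lact_yonedaIso F k l

lemma leg_densityCocyl (F : EnrichedFunctor V Aᵒᵖ V) (k : A) :
    (densityCocyl F).leg k = (yonedaIso F (op k)).hom := rfl

lemma isColimit_densityCocyl (F : EnrichedFunctor V Aᵒᵖ V) : (densityCocyl F).IsColimit := by
  rw [Cocyl.isColimit_iff]
  intro X H s hs
  -- By Yoneda, a cocylinder on representables with vertex `H` is a family `F k ⊗ X ⟶ H k`; its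
  -- compatibility is exactly naturality in `k`.
  let s' : ∀ k, F.obj (op k) ⊗ X ⟶ H.obj (op k) := fun k => s k ≫ (yonedaIso H (op k)).inv
  have hs' : ∀ k, s k = s' k ≫ (yonedaIso H (op k)).hom := fun k => by
    rw [Category.assoc, Iso.inv_hom_id, Category.comp_id]
  have hc : ∀ k l : A, lact F k l ▷ X ≫ s' k = (α_ _ _ _).hom ≫ (k ⟶[V] l) ◁ s' l ≫ lact H k l := by
    intro k l
    rw [← cancel_mono (yonedaIso H (op k)).hom]
    have h1 := hs k l
    rw [hs', hs', gcomp_comp] at h1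
    simp only [Category.assoc]
    rw [lact_yonedaIso]
    exact h1
  have key : ∀ (f : X ⟶ (F ⟶[V] H)) (k : A), (densityCocyl F).leg k ⋄ f = s k ↔
      huncurry (f ≫ (homπ F H).app (op k)) = s' k := by
    intro f k
    have h1 : (densityCocyl F).leg k ⋄ f = F.obj (op k) ◁ f ≫
        huncurry ((homπ F H).app (op k)) ≫ (yonedaIso H (op k)).hom := by
      rw [yonedaIso_natural, ← gcomp_comp, Category.comp_id, leg_densityCocyl]
    rw [h1, hs', ← Category.assoc, cancel_mono, huncurry_comp]
  have nat : ∀ a b : A, F.obj (op b) ◁ (β_ X (a ⟶[V] b)).hom ≫ (α_ _ _ _).inv ≫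
      ract F a b ▷ X ≫ s' a = (α_ _ _ _).inv ≫ s' b ▷ _ ≫ ract H a b := by
    intro a b
    rw [ract_eq, ract_eq]
    exact (whiskerLeft_comp_lact_iff _ _ _ _).1 (hc a b)
  refine ⟨homLift (GTrans.ofMaps (fun a => s' a.unop) fun a b => nat b.unop a.unop),
    fun k => (key _ k).2 ?_, fun g hg => homπ_ext fun a => huncurry_injective ?_⟩
  · rw [homLift_π]
    exact huncurry_hcurry _
  · rw [homLift_π]
    exact ((key g a.unop).1 (hg a.unop)).trans (huncurry_hcurry _).symm

end Density

section Closure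

variable {V : Type v} [Category.{w} V] [MonoidalCategory V] [SymmetricCategory V] [MonoidalClosed V]
  [HasLimits V] (A : Type w) [EnrichedCategory V A] (P : LimitClass V)

/-- The flat presheaves are the closure of the representables under flat colimits. -/
lemma isClosure_isFlat : IsClosure A (flatClass P) {F | IsFlat P F} := by
  refine ⟨⟨isFlat_rep P, closedUnderColimits_isFlat A P⟩, ?_⟩
  rintro Q ⟨hQ, hQ'⟩ F hF
  -- The flat presheaf `F` itself serves as the weight, so a single colimit of representables
  -- reaches it.
  exact (hQ' A F hF (yoneda V A) hQ).2 F (densityCocyl F) (isColimit_densityCocyl F)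

end Closure

/-! ### Invertible elements and invertible transformations -/

section Postcompose

variable {V : Type v} [Category.{w} V] [MonoidalCategory V] {D : Type u₂} [EnrichedCategory V D]
  {x y z t : D} {X Y : V}

/-- Postcomposition `D(x, y) ⟶ D(x, z)` with an element `𝟙_ V ⟶ D(y, z)`. -/
def postcompose (x : D) (q : 𝟙_ V ⟶ (y ⟶[V] z)) : (x ⟶[V] y) ⟶ (x ⟶[V] z) :=
  (ρ_ _).inv ≫ (x ⟶[V] y) ◁ q ≫ eComp V x y z

lemma comp_postcompose (f : X ⟶ (x ⟶[V] y)) (q : 𝟙_ V ⟶ (y ⟶[V] z)) :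
    f ≫ postcompose x q = (ρ_ X).inv ≫ f ⋄ q := by
  rw [postcompose, rightUnitor_inv_naturality_assoc, gcomp, MonoidalCategory.tensorHom_def,
    Category.assoc]

lemma gcomp_elem (f : X ⟶ (x ⟶[V] y)) (q : 𝟙_ V ⟶ (y ⟶[V] z)) :
    f ⋄ q = (ρ_ X).hom ≫ f ≫ postcompose x q := by
  rw [comp_postcompose, Iso.hom_inv_id_assoc]

lemma elem_gcomp (p : 𝟙_ V ⟶ (x ⟶[V] y)) (f : X ⟶ (y ⟶[V] z)) :
    p ⋄ f = (λ_ X).hom ≫ f ≫ precompose p z := by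
  rw [precompose_eq, Iso.hom_inv_id_assoc]

lemma gcomp_postcompose (f : X ⟶ (x ⟶[V] y)) (g : Y ⟶ (y ⟶[V] z)) (q : 𝟙_ V ⟶ (z ⟶[V] t)) :
    f ⋄ (g ≫ postcompose y q) = (f ⋄ g) ≫ postcompose x q := by
  rw [comp_postcompose, comp_postcompose, gcomp_comp, gcomp_assoc]
  simp

lemma precompose_gcomp (p : 𝟙_ V ⟶ (x ⟶[V] y)) (f : X ⟶ (y ⟶[V] z)) (g : Y ⟶ (z ⟶[V] t)) :
    (f ≫ precompose p z) ⋄ g = (f ⋄ g) ≫ precompose p t := by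
  rw [precompose_eq, precompose_eq, comp_gcomp, gcomp_assoc]
  simp

lemma postcompose_gcomp (f : X ⟶ (x ⟶[V] y)) (q : 𝟙_ V ⟶ (y ⟶[V] z)) (g : Y ⟶ (z ⟶[V] t)) :
    (f ≫ postcompose x q) ⋄ g = f ⋄ (g ≫ precompose q t) := by
  rw [comp_postcompose, precompose_eq, comp_gcomp, gcomp_assoc, gcomp_comp]
  simp

lemma precompose_postcompose (p : 𝟙_ V ⟶ (x ⟶[V] y)) (q : 𝟙_ V ⟶ (z ⟶[V] t)) :
    precompose p z ≫ postcompose x q = postcompose y q ≫ precompose p t := by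
  rw [comp_postcompose, ← Category.id_comp (precompose p z), precompose_gcomp, gcomp_elem]
  simp

lemma eId_precompose (p : 𝟙_ V ⟶ (x ⟶[V] y)) : eId V y ≫ precompose p y = p := by
  rw [precompose_eq, gcomp_eId, ← unitors_equal, Iso.inv_hom_id_assoc]

lemma precompose_gcomp_postcompose (p : 𝟙_ V ⟶ (x ⟶[V] y)) {w : D}
    (q : 𝟙_ V ⟶ (t ⟶[V] w)) :
    precompose p z ⋄ postcompose z q = eComp V y z t ≫ precompose p t ≫ postcompose x q := by
  rw [← Category.id_comp (precompose p z), precompose_gcomp, ← Category.id_comp (postcompose z q),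
    gcomp_postcompose, id_gcomp_id, precompose_postcompose, Category.assoc]

/-- Two elements of hom-objects are mutually inverse. -/
structure IsInversePair (p : 𝟙_ V ⟶ (x ⟶[V] y)) (q : 𝟙_ V ⟶ (y ⟶[V] x)) : Prop where
  hom_inv : p ≫ postcompose x q = eId V x
  inv_hom : q ≫ postcompose y p = eId V y

namespace IsInversePair

variable {p : 𝟙_ V ⟶ (x ⟶[V] y)} {q : 𝟙_ V ⟶ (y ⟶[V] x)}

lemma symm (h : IsInversePair p q) : IsInversePair q p := ⟨h.inv_hom, h.hom_inv⟩

lemma postcompose_postcompose (h : IsInversePair p q) (t : D) :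
    postcompose t p ≫ postcompose t q = 𝟙 _ := by
  have := gcomp_postcompose (𝟙 (t ⟶[V] x)) p q
  rw [h.hom_inv, gcomp_eId, gcomp_elem, Category.assoc, cancel_epi] at this
  simpa using this.symm

lemma precompose_precompose (h : IsInversePair p q) (t : D) :
    precompose q t ≫ precompose p t = 𝟙 _ := by
  have := postcompose_gcomp p q (𝟙 (x ⟶[V] t))
  rw [h.hom_inv, eId_gcomp, elem_gcomp, cancel_epi] at this
  simpa using this.symm

end IsInversePair

lemma EnrichedFunctor.map_postcompose {C : Type u₁} [EnrichedCategory V C]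
    (F : EnrichedFunctor V D C) (q : 𝟙_ V ⟶ (y ⟶[V] z)) :
    postcompose x q ≫ F.map x z = F.map x y ≫ postcompose (F.obj x) (q ≫ F.map y z) := by
  rw [comp_postcompose, ← Category.id_comp (postcompose x q), comp_postcompose, Category.assoc,
    gcomp_map, Category.id_comp]

lemma EnrichedFunctor.map_precompose {C : Type u₁} [EnrichedCategory V C]
    (F : EnrichedFunctor V D C) (p : 𝟙_ V ⟶ (x ⟶[V] y)) :
    precompose p z ≫ F.map x z = F.map y z ≫ precompose (p ≫ F.map x y) (F.obj z) := by
  rw [precompose_eq, ← Category.id_comp (precompose p z), precompose_eq, Category.assoc,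
    gcomp_map, Category.id_comp]

variable {C : Type u₁} [EnrichedCategory V C] [BraidedCategory V] {F G : EnrichedFunctor V C D}

/-- Naturality of a family of elements. -/
lemma nat_unit_iff (p : ∀ a, 𝟙_ V ⟶ (F.obj a ⟶[V] G.obj a)) (a b : C) :
    (β_ (𝟙_ V) (a ⟶[V] b)).hom ≫ F.map a b ⋄ p b = p a ⋄ G.map a b ↔
      F.map a b ≫ postcompose _ (p b) = G.map a b ≫ precompose (p a) _ := by
  rw [gcomp_elem, elem_gcomp, braiding_tensorUnit_left]
  simp

lemma GTrans.nat_unit (σ : GTrans (𝟙_ V) F G) (a b : C) :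
    F.map a b ≫ postcompose _ (σ.app b) = G.map a b ≫ precompose (σ.app a) _ :=
  (nat_unit_iff σ.app a b).1 (σ.nat a b)

/-- A natural transformation given by elements. -/
abbrev GTrans.ofElems (p : ∀ a, 𝟙_ V ⟶ (F.obj a ⟶[V] G.obj a))
    (h : ∀ a b, F.map a b ≫ postcompose _ (p b) = G.map a b ≫ precompose (p a) _) :
    GTrans (𝟙_ V) F G where
  app := p
  naturality a b := (nat_unit_iff p a b).2 (h a b)

/-- The inverse of an objectwise invertible natural transformation. -/
abbrev GTrans.inverse (σ : GTrans (𝟙_ V) F G) (q : ∀ a, 𝟙_ V ⟶ (G.obj a ⟶[V] F.obj a))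
    (h : ∀ a, IsInversePair (σ.app a) (q a)) : GTrans (𝟙_ V) G F :=
  GTrans.ofElems q fun a b => by
    -- Composing the naturality square of `σ` with both inverses leaves that of `q`.
    have := congrArg (fun t => t ≫ postcompose _ (q b) ≫ precompose (q a) _) (σ.nat_unit a b)
    rw [Category.assoc, reassoc_of% (h b).postcompose_postcompose, Category.assoc,
      reassoc_of% precompose_postcompose (σ.app a) (q b),
      (h a).symm.precompose_precompose, Category.comp_id] at this
    exact this.symm

lemma GTrans.isInvertible (σ : GTrans (𝟙_ V) F G) (q : ∀ a, 𝟙_ V ⟶ (G.obj a ⟶[V] F.obj a))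
    (h : ∀ a, IsInversePair (σ.app a) (q a)) : σ.IsInvertible := by
  refine ⟨σ.inverse q h, ?_, ?_⟩
  · ext a
    have := (h a).hom_inv
    rw [comp_postcompose, ← unitors_inv_equal] at this
    exact this
  · ext a
    have := (h a).inv_hom
    rw [comp_postcompose, ← unitors_inv_equal] at this
    exact this

end Postcompose

/-! ### Inverting fully faithful, essentially surjective V-functors -/

section Equivalence

variable {V : Type v} [Category.{w} V] [MonoidalCategory V] [BraidedCategory V]
  {C : Type u₁} [EnrichedCategory V C] {D : Type u₂} [EnrichedCategory V D]

variable (R : EnrichedFunctor V D C) [∀ d d', IsIso (R.map d d')] (L : C → D)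
    {p : ∀ c, 𝟙_ V ⟶ (c ⟶[V] R.obj (L c))} {q : ∀ c, 𝟙_ V ⟶ (R.obj (L c) ⟶[V] c)}
    (h : ∀ c, IsInversePair (p c) (q c))

-- Conjugation by isomorphisms respects composition: `p c'` and `q c'` cancel in the middle.
omit [BraidedCategory V] [∀ d d', IsIso (R.map d d')] in
include h in
lemma conj_comp (c c' c'' : C) :
    (precompose (q c) c' ≫ postcompose _ (p c')) ⋄ (precompose (q c') c'' ≫ postcompose _ (p c'')) =
      eComp V c c' c'' ≫ precompose (q c) c'' ≫ postcompose _ (p c'') := by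
  rw [postcompose_gcomp, Category.assoc, ← precompose_postcompose,
    reassoc_of% (h c').precompose_precompose, precompose_gcomp_postcompose]

/-- The inverse of a fully faithful and essentially surjective `V`-functor. -/
abbrev inverseFunctor : EnrichedFunctor V C D where
  obj := L
  map c c' := precompose (q c) c' ≫ postcompose _ (p c') ≫ inv (R.map (L c) (L c'))
  map_id c := by
    rw [reassoc_of% eId_precompose (q c), reassoc_of% (h c).inv_hom, IsIso.comp_inv_eq, R.map_id]
  map_comp c c' c'' := by
    have e := gcomp_map R
      (precompose (q c) c' ≫ postcompose _ (p c') ≫ inv (R.map (L c) (L c')))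
      (precompose (q c') c'' ≫ postcompose _ (p c'') ≫ inv (R.map (L c') (L c'')))
    simp only [Category.assoc, IsIso.inv_hom_id, Category.comp_id] at e
    rw [conj_comp R L h, ← IsIso.eq_comp_inv] at e
    simp only [Category.assoc] at e
    exact e.symm

/-- The unit of the inverse of a fully faithful and essentially surjective `V`-functor. -/
def inverseUnit : GTrans (𝟙_ V) (EnrichedFunctor.id V C) ((inverseFunctor R L h).comp V R) :=
  GTrans.ofElems p fun a b => by
    change 𝟙 _ ≫ postcompose _ (p b) =
      ((precompose (q a) b ≫ postcompose _ (p b) ≫ inv (R.map (L a) (L b))) ≫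
        R.map (L a) (L b)) ≫ precompose (p a) _
    simp only [Category.assoc, IsIso.inv_hom_id_assoc]
    rw [← precompose_postcompose, reassoc_of% (h a).precompose_precompose, Category.id_comp]

lemma inverseUnit_isInvertible : (inverseUnit R L h).IsInvertible := GTrans.isInvertible _ q h

-- Since the `R.map` are monic, both inverse laws may be checked after applying `R`.
omit [BraidedCategory V] in
lemma IsInversePair.of_map {x y : D} {p : 𝟙_ V ⟶ (x ⟶[V] y)} {q : 𝟙_ V ⟶ (y ⟶[V] x)}
    (h : IsInversePair (p ≫ R.map x y) (q ≫ R.map y x)) : IsInversePair p q := by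
  constructor
  · rw [← cancel_mono (R.map x x), Category.assoc, EnrichedFunctor.map_postcompose, ← Category.assoc,
      h.hom_inv, R.map_id]
  · rw [← cancel_mono (R.map y y), Category.assoc, EnrichedFunctor.map_postcompose, ← Category.assoc,
      h.inv_hom, R.map_id]

/-- The components of the counit of the inverse of a `V`-functor. -/
def counitElem (q : ∀ c, 𝟙_ V ⟶ (R.obj (L c) ⟶[V] c)) (d : D) : 𝟙_ V ⟶ (L (R.obj d) ⟶[V] d) :=
  q (R.obj d) ≫ inv (R.map (L (R.obj d)) d)

omit [BraidedCategory V] in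
lemma counitElem_map (q : ∀ c, 𝟙_ V ⟶ (R.obj (L c) ⟶[V] c)) (d : D) :
    counitElem R L q d ≫ R.map (L (R.obj d)) d = q (R.obj d) := by
  rw [counitElem, Category.assoc, IsIso.inv_hom_id, Category.comp_id]

/-- The counit of the inverse of a fully faithful and essentially surjective `V`-functor. -/
def inverseCounit : GTrans (𝟙_ V) (R.comp V (inverseFunctor R L h)) (EnrichedFunctor.id V D) :=
  GTrans.ofElems (counitElem R L q) fun a b => by
    change (R.map a b ≫ precompose (q (R.obj a)) (R.obj b) ≫ postcompose _ (p (R.obj b)) ≫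
      inv (R.map (L (R.obj a)) (L (R.obj b)))) ≫ postcompose _ (counitElem R L q b) =
        𝟙 _ ≫ precompose (counitElem R L q a) _
    rw [← cancel_mono (R.map _ _)]
    simp only [Category.assoc, EnrichedFunctor.map_postcompose, EnrichedFunctor.map_precompose,
      counitElem_map, IsIso.inv_hom_id_assoc, Category.id_comp]
    rw [(h _).postcompose_postcompose, Category.comp_id]

lemma inverseCounit_isInvertible : (inverseCounit R L h).IsInvertible :=
  GTrans.isInvertible _ (fun d => (p (R.obj d) ≫ inv (R.map d (L (R.obj d))) :
      𝟙_ V ⟶ (d ⟶[V] L (R.obj d)))) fun d =>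
    IsInversePair.of_map (p := counitElem R L q d) (q := p (R.obj d) ≫ inv (R.map d _)) R (by
      rw [counitElem_map, Category.assoc, IsIso.inv_hom_id, Category.comp_id]
      exact (h (R.obj d)).symm)

end Equivalence

/-! ### Universal properties of pointwise left Kan extensions -/

section Lan

variable {V : Type v} [Category.{w} V] [MonoidalCategory V] [SymmetricCategory V] [MonoidalClosed V]
  {A : Type u₁} [EnrichedCategory V A] {C : Type u₂} [EnrichedCategory V C]
  {B : Type u₃} [EnrichedCategory V B] {J : EnrichedFunctor V A C} {F : EnrichedFunctor V A B}

/-- The universal property of `C(J -, c) * F`, for a cocylinder with components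
`C(J a, c) ⟶ B(F a, x)`. -/
lemma Cocyl.isColimit_nerve_iff {c : C} {x : B} (t : Cocyl (nerve J c) F x)
    (κ : ∀ a, (J.obj a ⟶[V] c) ⟶ (F.obj a ⟶[V] x)) (hκ : ∀ a, t.leg a = κ a) :
    t.IsColimit ↔ ∀ ⦃X : V⦄ ⦃b : B⦄ (s : ∀ a, (J.obj a ⟶[V] c) ⊗ X ⟶ (F.obj a ⟶[V] b)),
      (∀ k l : A, (J.map k l ⋄ 𝟙 (J.obj l ⟶[V] c)) ▷ X ≫ s k =
        (α_ _ _ _).hom ≫ F.map k l ⋄ s l) →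
      ∃! f : X ⟶ (x ⟶[V] b), ∀ a, κ a ⋄ f = s a := by
  obtain rfl : t.leg = κ := funext hκ
  rw [Cocyl.isColimit_iff]
  constructor
  · exact fun h X b s hs => h s fun k l =>
      (congrArg (fun u => u ▷ X ≫ s k) (lact_nerve J c k l)).trans (hs k l)
  · exact fun h X b s hs => h s fun k l =>
      (congrArg (fun u => u ▷ X ≫ s k) (lact_nerve J c k l)).symm.trans (hs k l)

variable {T : EnrichedFunctor V C B} {φ : GTrans (𝟙_ V) F (J.comp V T)}

/-- The map `C(J a, c) ⟶ B(F a, T c)` induced by a transformation `F ⟶ T J`. -/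
def kanLeg (φ : GTrans (𝟙_ V) F (J.comp V T)) (c : C) (a : A) :
    (J.obj a ⟶[V] c) ⟶ (F.obj a ⟶[V] T.obj c) :=
  T.map (J.obj a) c ≫ precompose (lanUnit φ a) (T.obj c)

omit [MonoidalClosed V] in
lemma gcomp_kanLeg {X Y : V} {c d : C} {a : A} (f : X ⟶ (J.obj a ⟶[V] c)) (g : Y ⟶ (c ⟶[V] d)) :
    (f ⋄ g) ≫ kanLeg φ d a = (f ≫ kanLeg φ c a) ⋄ (g ≫ T.map c d) := by
  rw [kanLeg, kanLeg, ← Category.assoc, gcomp_map, ← Category.assoc f, precompose_gcomp]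

omit [MonoidalClosed V] in
lemma kanLeg_gcomp_map {Y : V} {c d : C} {a : A} (g : Y ⟶ (c ⟶[V] d)) :
    kanLeg φ c a ⋄ (g ≫ T.map c d) = (𝟙 _ ⋄ g) ≫ kanLeg φ d a := by
  rw [gcomp_kanLeg, Category.id_comp]

omit [MonoidalClosed V] in
lemma map_gcomp_kanLeg (k l : A) {c : C} {X : V} (f : X ⟶ (J.obj l ⟶[V] c)) :
    (J.map k l ⋄ f) ≫ kanLeg φ c k = F.map k l ⋄ (f ≫ kanLeg φ c l) := by
  have h : F.map k l ≫ postcompose _ (lanUnit φ l) =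
      (J.map k l ≫ T.map _ _) ≫ precompose (lanUnit φ k) _ := φ.nat_unit k l
  rw [gcomp_kanLeg, kanLeg, ← Category.assoc, ← h, postcompose_gcomp, kanLeg, Category.assoc]

omit [MonoidalClosed V] in
lemma eId_kanLeg (a : A) : eId V (J.obj a) ≫ kanLeg φ (J.obj a) a = lanUnit φ a := by
  rw [kanLeg, ← Category.assoc, T.map_id, eId_precompose]

lemma isLan_iff : IsLan J F T φ ↔ ∀ ⦃c : C⦄ ⦃X : V⦄ ⦃b : B⦄
    (s : ∀ a, (J.obj a ⟶[V] c) ⊗ X ⟶ (F.obj a ⟶[V] b)),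
    (∀ k l : A, (J.map k l ⋄ 𝟙 (J.obj l ⟶[V] c)) ▷ X ≫ s k =
      (α_ _ _ _).hom ≫ F.map k l ⋄ s l) →
    ∃! f : X ⟶ (T.obj c ⟶[V] b), ∀ a, kanLeg φ c a ⋄ f = s a :=
  forall_congr' fun c => (kanCocyl J F T φ c).isColimit_nerve_iff (kanLeg φ c) fun _ => rfl

omit [MonoidalClosed V] in
lemma kanLeg_balanced {c : C} {X : V} {b : B} (f : X ⟶ (T.obj c ⟶[V] b)) (k l : A) :
    (J.map k l ⋄ 𝟙 (J.obj l ⟶[V] c)) ▷ X ≫ kanLeg φ c k ⋄ f =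
      (α_ _ _ _).hom ≫ F.map k l ⋄ kanLeg φ c l ⋄ f := by
  rw [← comp_gcomp, map_gcomp_kanLeg, Category.id_comp, gcomp_assoc]

lemma IsLan.hom_ext (h : IsLan J F T φ) {c : C} {X : V} {b : B} {f g : X ⟶ (T.obj c ⟶[V] b)}
    (hfg : ∀ a, kanLeg φ c a ⋄ f = kanLeg φ c a ⋄ g) : f = g :=
  (isLan_iff.1 h (fun a => kanLeg φ c a ⋄ g) fun k l => kanLeg_balanced g k l).unique hfg
    fun _ => rfl

/-- Graded transformations out of a left Kan extension. -/
lemma IsLan.existsUnique (h : IsLan J F T φ) {X : V} {S : EnrichedFunctor V C B}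
    (ρ : ∀ a, X ⟶ (F.obj a ⟶[V] S.obj (J.obj a)))
    (hρ : ∀ a b : A, (β_ X (a ⟶[V] b)).hom ≫ F.map a b ⋄ ρ b =
      ρ a ⋄ (J.map a b ≫ S.map (J.obj a) (J.obj b))) :
    ∃! σ : GTrans X T S, ∀ a, σ.app (J.obj a) ≫ precompose (lanUnit φ a) _ = ρ a := by
  -- Naturality forces this: the component at `c`, composed with the leg at `a`, must be `ρ a`
  -- followed by the action of `S` on `C(J a, c)`.
  let s : ∀ c a, (J.obj a ⟶[V] c) ⊗ X ⟶ (F.obj a ⟶[V] S.obj c) :=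
    fun c a => (β_ _ _).hom ≫ ρ a ⋄ S.map (J.obj a) c
  have hs : ∀ c k l, (J.map k l ⋄ 𝟙 (J.obj l ⟶[V] c)) ▷ X ≫ s c k =
      (α_ _ _ _).hom ≫ F.map k l ⋄ s c l := by
    intro c k l
    rw [BraidedCategory.braiding_naturality_left_assoc, ← gcomp_comp, gcomp_map, Category.id_comp,
      gcomp_assoc', ← hρ, comp_gcomp, gcomp_assoc, gcomp_comp, BraidedCategory.braiding_tensor_left_hom]
    simp only [Category.assoc, Iso.hom_inv_id_assoc]
    rw [← comp_whiskerRight_assoc, SymmetricCategory.symmetry]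
    simp
  have hc : ∀ c, ∃! f : X ⟶ (T.obj c ⟶[V] S.obj c), ∀ a, kanLeg φ c a ⋄ f = s c a :=
    fun c => isLan_iff.1 h (s c) (hs c)
  choose f hf hf' using hc
  dsimp only at hf
  refine ⟨⟨f, fun c d => h.hom_ext fun a => ?_⟩, fun a => ?_, fun τ hτ => ?_⟩
  · have h1 : kanLeg φ c a ⋄ T.map c d = (𝟙 _ ⋄ 𝟙 _) ≫ kanLeg φ d a := by
      rw [← kanLeg_gcomp_map, Category.id_comp]
    rw [gcomp_def, gcomp_def, gcomp_comp, gcomp_assoc', gcomp_assoc', hf, h1, comp_gcomp, hf,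
      comp_gcomp, BraidedCategory.braiding_naturality_left_assoc, ← gcomp_comp, gcomp_map,
      Category.id_comp, Category.id_comp, gcomp_assoc, BraidedCategory.braiding_tensor_left_hom]
    simp only [Category.assoc, Iso.inv_hom_id_assoc]
    rw [← MonoidalCategory.whiskerLeft_comp_assoc, SymmetricCategory.symmetry]
    simp
  -- The unit at `a` is the leg at `c = J a` evaluated at the identity.
  · rw [precompose_eq, ← eId_kanLeg, comp_gcomp, hf, BraidedCategory.braiding_naturality_left_assoc,
      ← gcomp_comp, S.map_id, gcomp_eId]
    simp
  · ext c
    refine hf' c _ fun a => ?_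
    have h1 : T.map (J.obj a) c ⋄ τ.app c = (β_ _ _).hom ≫ τ.app (J.obj a) ⋄ S.map _ _ := by
      rw [← τ.nat, SymmetricCategory.symmetry_assoc]
    have h2 : τ.app (J.obj a) ≫ precompose (lanUnit φ a) _ = ρ a := hτ a
    rw [kanLeg, precompose_gcomp, h1, Category.assoc, ← precompose_gcomp, h2]

lemma IsLan.hom_ext_elem (h : IsLan J F T φ) {X : V} {S : EnrichedFunctor V C B}
    {σ τ : GTrans X T S} (hστ : ∀ a, σ.app (J.obj a) ≫ precompose (lanUnit φ a) _ =
      τ.app (J.obj a) ≫ precompose (lanUnit φ a) _) : σ = τ :=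
  (h.existsUnique (fun a => τ.app (J.obj a) ≫ precompose (lanUnit φ a) _) fun a b => by
    have h1 := τ.nat (J.obj a) (J.obj b)
    have h2 : F.map a b ≫ postcompose _ (lanUnit φ b) =
      (J.map a b ≫ T.map _ _) ≫ precompose (lanUnit φ a) _ := φ.nat_unit a b
    rw [← postcompose_gcomp, h2, precompose_gcomp, precompose_gcomp, comp_gcomp, gcomp_comp, ← h1,
      BraidedCategory.braiding_naturality_right_assoc]
    simp only [Category.assoc]).unique hστ fun _ => rfl

/-- If `J` is fully faithful, then the unit of a left Kan extension along `J` is invertible. -/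
lemma IsLan.exists_isInversePair (h : IsLan J F T φ) [∀ a b, IsIso (J.map a b)] (b : A) :
    ∃ q, IsInversePair (lanUnit φ b) q := by
  have hinv : ∀ k l : A, (J.map k l ⋄ 𝟙 (J.obj l ⟶[V] J.obj b)) ≫ inv (J.map k b) =
      (k ⟶[V] l) ◁ inv (J.map l b) ≫ eComp V k l b := by
    intro k l
    rw [IsIso.comp_inv_eq, Category.assoc, eComp_map, ← gcomp_comp, IsIso.inv_hom_id]
  have hs : ∀ k l : A, (J.map k l ⋄ 𝟙 (J.obj l ⟶[V] J.obj b)) ▷ 𝟙_ V ≫ (ρ_ _).hom ≫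
      inv (J.map k b) ≫ F.map k b =
      (α_ _ _ _).hom ≫ F.map k l ⋄ ((ρ_ _).hom ≫ inv (J.map l b) ≫ F.map l b) := by
    intro k l
    rw [rightUnitor_naturality_assoc, reassoc_of% hinv, eComp_map, gcomp_comp, gcomp_comp]
    simp
  -- Full faithfulness turns `C(J a, J b)` back into `A(a, b)`, on which `F` acts; the induced map
  -- from `T (J b)` to `F b` is the inverse of the unit.
  obtain ⟨f, hf, -⟩ := isLan_iff.1 h (fun a => (ρ_ _).hom ≫ inv (J.map a b) ≫ F.map a b) hs
  have hf' : ∀ a, kanLeg φ (J.obj b) a ≫ postcompose _ f = inv (J.map a b) ≫ F.map a b := by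
    intro a
    rw [comp_postcompose, hf, Iso.inv_hom_id_assoc]
  refine ⟨f, ?_, ?_⟩
  · rw [← eId_kanLeg, Category.assoc, hf', ← J.map_id, Category.assoc, IsIso.hom_inv_id_assoc,
      F.map_id]
  · refine h.hom_ext fun a => ?_
    have h2 : F.map a b ≫ postcompose _ (lanUnit φ b) =
      (J.map a b ≫ T.map _ _) ≫ precompose (lanUnit φ a) _ := φ.nat_unit a b
    rw [gcomp_postcompose, gcomp_elem, gcomp_eId, hf', Category.assoc, Category.assoc, h2,
      Category.assoc, IsIso.inv_hom_id_assoc, kanLeg]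

end Lan

/-! ### Assembling pointwise colimits into a Kan extension -/

section LanExistence

variable {V : Type v} [Category.{w} V] [MonoidalCategory V] [SymmetricCategory V] [MonoidalClosed V]
  {A : Type u₁} [EnrichedCategory V A] {C : Type u₂} [EnrichedCategory V C]
  {B : Type u₃} [EnrichedCategory V B] {J : EnrichedFunctor V A C} {F : EnrichedFunctor V A B}

/-- A left Kan extension exists if the colimits computing it pointwise do. -/
lemma admitsLan_of_isColimit (h : ∀ c, ∃ (x : B) (t : Cocyl (nerve J c) F x), t.IsColimit) :
    AdmitsLan J F := by
  choose T t ht using h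
  let κ : ∀ c a, (J.obj a ⟶[V] c) ⟶ (F.obj a ⟶[V] T c) := fun c a => (t c).leg a
  have hκ : ∀ c k l {X : V} (f : X ⟶ (J.obj l ⟶[V] c)), (J.map k l ⋄ f) ≫ κ c k =
      F.map k l ⋄ (f ≫ κ c l) := by
    intro c k l X f
    have h1 : (J.map k l ⋄ 𝟙 (J.obj l ⟶[V] c)) ≫ κ c k = F.map k l ⋄ κ c l :=
      (congrArg (fun u => u ≫ κ c k) (lact_nerve J c k l)).symm.trans ((t c).lact_leg k l)
    rw [gcomp_comp, ← h1, ← reassoc_of% gcomp_comp f (J.map k l) (𝟙 _)]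
  have hu := fun c => ((t c).isColimit_nerve_iff (κ c) fun _ => rfl).1 (ht c)
  -- The action on `C(c, d)` is induced by composing legs, using the universal property graded by
  -- `C(c, d)`.
  have hm : ∀ c d : C, ∃ f : (c ⟶[V] d) ⟶ (T c ⟶[V] T d), ∀ a,
      κ c a ⋄ f = eComp V (J.obj a) c d ≫ κ d a := by
    intro c d
    obtain ⟨f, hf, -⟩ := hu c (fun a => eComp V (J.obj a) c d ≫ κ d a) fun k l => by
      rw [← id_gcomp_id, ← id_gcomp_id, ← hκ, gcomp_assoc' (J.map k l), Category.assoc,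
        Iso.hom_inv_id_assoc, ← Category.assoc, ← comp_gcomp, Category.comp_id]
    exact ⟨f, hf⟩
  choose m hm using hm
  have hext : ∀ {c : C} {b : B} {X : V} {f g : X ⟶ (T c ⟶[V] b)}, (∀ a, κ c a ⋄ f = κ c a ⋄ g) →
      f = g := fun h => (ht _).hom_ext h
  have hid : ∀ c, eId V c ≫ m c c = eId V (T c) := by
    refine fun c => hext fun a => ?_
    rw [gcomp_comp, hm, reassoc_of% whiskerLeft_eId_eComp, gcomp_eId]
  have hcomp : ∀ c d e, eComp V c d e ≫ m c e = m c d ⋄ m d e := by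
    refine fun c d e => hext fun a => ?_
    rw [gcomp_comp, hm, gcomp_assoc', hm, comp_gcomp, hm, reassoc_of% e_assoc V]
  let p : ∀ a, 𝟙_ V ⟶ (F.obj a ⟶[V] T (J.obj a)) := fun a => eId V _ ≫ κ (J.obj a) a
  have hp : ∀ a c, m (J.obj a) c ≫ precompose (p a) (T c) = κ c a := by
    intro a c
    rw [precompose_eq, comp_gcomp, hm, reassoc_of% eId_whiskerRight_eComp, Iso.inv_hom_id_assoc]
  let TF : EnrichedFunctor V C B := ⟨T, m, hid, hcomp⟩
  let φ : GTrans (𝟙_ V) F (J.comp V TF) := GTrans.ofElems p fun a b => by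
    change _ = (J.map a b ≫ m (J.obj a) (J.obj b)) ≫ precompose (p a) (T (J.obj b))
    rw [Category.assoc, hp]
    change F.map a b ≫ postcompose _ (p b) = _
    rw [comp_postcompose, ← hκ, gcomp_eId]
    simp
  refine ⟨TF, φ, fun c => ?_⟩
  have : kanCocyl J F TF φ c = t c := Cyl.ext (funext fun a => hp a.unop c)
  rw [this]
  exact ht c

end LanExistence

/-! ### Colimits preserved by Kan extensions -/

section LanCocontinuous

variable {V : Type v} [Category.{w} V] [MonoidalCategory V] [SymmetricCategory V] [MonoidalClosed V]
  {A : Type u₁} [EnrichedCategory V A] {C : Type u₂} [EnrichedCategory V C]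
  {B : Type u₃} [EnrichedCategory V B] {J : EnrichedFunctor V A C} {F : EnrichedFunctor V A B}
  {T : EnrichedFunctor V C B} {φ : GTrans (𝟙_ V) F (J.comp V T)}

/-- The diagram `k ↦ C(x, G k)`. -/
abbrev corepDiag {K : Type u₄} [EnrichedCategory V K] (G : EnrichedFunctor V K C) (x : C) :
    EnrichedFunctor V K V where
  obj k := (x ⟶[V] G.obj k)
  map k l := G.map k l ≫ hcurry (eComp V x (G.obj k) (G.obj l))
  map_id k := (G.comp V (corep x)).map_id k
  map_comp k l m := (G.comp V (corep x)).map_comp k l m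

omit [SymmetricCategory V] in
lemma act_corepDiag {K : Type u₄} [EnrichedCategory V K] (G : EnrichedFunctor V K C) (x : C)
    (k l : K) : act (corepDiag G x) k l = 𝟙 _ ⋄ G.map k l := by
  change huncurry (G.map k l ≫ hcurry (eComp V x (G.obj k) (G.obj l))) = _
  rw [huncurry_comp, huncurry_hcurry, gcomp, id_tensorHom]

/-- The balanced family `C(x, G k) ⊗ W k ⟶ C(x, c)` given by a cocylinder. -/
def corepBal {K : Type u₄} [EnrichedCategory V K] {G : EnrichedFunctor V K C}
    {W : EnrichedFunctor V Kᵒᵖ V} {c : C} (t : Cocyl W G c) (x : C) :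
    Bal (corepDiag G x) W (x ⟶[V] c) where
  app k := 𝟙 _ ⋄ t.leg k
  balanced k l := by
    rw [← comp_gcomp, act_corepDiag, Category.comp_id, gcomp_assoc, ← t.lact_leg, gcomp_comp]

lemma corepBal_app {K : Type u₄} [EnrichedCategory V K] {G : EnrichedFunctor V K C}
    {W : EnrichedFunctor V Kᵒᵖ V} {c : C} (t : Cocyl W G c) (x : C) (k : K) :
    (corepBal t x).app k = 𝟙 _ ⋄ t.leg k := rfl

lemma isTensor_corepBal_iff {K : Type u₄} [EnrichedCategory V K] {G : EnrichedFunctor V K C}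
    {W : EnrichedFunctor V Kᵒᵖ V} {c : C} (t : Cocyl W G c) (x : C) :
    (corepBal t x).IsTensor ↔ (t.map (corep x)).IsColimit := by
  have h : (t.map (corep x)).toBal = corepBal t x := Bal.ext (funext fun k => by
    change huncurry (t.leg k ≫ hcurry (eComp V x (G.obj k) c)) = _
    rw [huncurry_comp, huncurry_hcurry, corepBal_app, gcomp, id_tensorHom])
  rw [Cocyl.isColimit_iff_isTensor, ← h]
  rfl

/-- A left Kan extension along `J` preserves the colimits preserved by the `C(J a, -)`. -/
lemma IsLan.isColimit_map (h : IsLan J F T φ) {K : Type u₄} [EnrichedCategory V K]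
    {G : EnrichedFunctor V K C} {W : EnrichedFunctor V Kᵒᵖ V} {c : C} (t : Cocyl W G c)
    (ht : ∀ a, (t.map (corep (J.obj a))).IsColimit) : (t.map T).IsColimit := by
  have ht' := fun a => (isTensor_corepBal_iff t (J.obj a)).2 (ht a)
  rw [Cocyl.isColimit_map_iff]
  intro X b s hs
  -- By hypothesis `C(J a, c)` is the coend of `C(J a, G k) ⊗ W k`, so the family obtained from the
  -- legs at the `G k` followed by `s k` extends to `C(J a, c)`.
  have hr : ∀ a, ∃ r : (J.obj a ⟶[V] c) ⊗ X ⟶ (F.obj a ⟶[V] b), ∀ k,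
      (𝟙 _ ⋄ t.leg k) ▷ X ≫ r = (α_ _ _ _).hom ≫ kanLeg φ (G.obj k) a ⋄ s k := by
    intro a
    obtain ⟨r, hr, -⟩ := (ht' a).existsUnique_right (X := X)
      (fun k => (α_ _ _ _).hom ≫ kanLeg φ (G.obj k) a ⋄ s k) fun k l => by
        rw [act_corepDiag, associator_naturality_left_assoc, ← comp_gcomp, ← kanLeg_gcomp_map,
          gcomp_assoc, associator_naturality_middle_assoc, ← gcomp_comp, hs, gcomp_comp]
        simp
    exact ⟨r, hr⟩
  choose r hr using hr
  -- Compatibility of `r` with `A` is tested on the same coend, now between two spectator factors.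
  obtain ⟨f, hf, hf'⟩ := isLan_iff.1 h r fun k l => by
    rw [← cancel_epi (α_ _ _ _).inv, Iso.inv_hom_id_assoc]
    refine (ht' l).hom_ext_middle fun m => ?_
    have h1 : (k ⟶[V] l) ◁ (corepBal t (J.obj l)).app m ≫ J.map k l ⋄ 𝟙 _ =
        (α_ _ _ _).inv ≫ (J.map k l ⋄ 𝟙 _) ▷ _ ≫ 𝟙 _ ⋄ t.leg m := by
      rw [← gcomp_comp, Category.comp_id, ← comp_gcomp, Category.comp_id, corepBal_app,
        gcomp_assoc']
    rw [associator_inv_naturality_middle_assoc, ← comp_whiskerRight_assoc, h1, ← gcomp_comp,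
      corepBal_app, hr, gcomp_comp, gcomp_assoc']
    simp only [comp_whiskerRight, Category.assoc]
    rw [hr, associator_naturality_left_assoc, ← comp_gcomp, map_gcomp_kanLeg, Category.id_comp]
    simp
  refine ⟨f, fun k => h.hom_ext fun a => ?_, fun g hg => hf' g fun a => ?_⟩
  · rw [gcomp_assoc', kanLeg_gcomp_map, comp_gcomp, hf, hr, Iso.inv_hom_id_assoc]
  · refine (ht' a).hom_ext_right fun k => ?_
    rw [corepBal_app, hr, ← hg, ← comp_gcomp, ← kanLeg_gcomp_map, gcomp_assoc]

end LanCocontinuous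

/-! ### Reflection of colimits by fully faithful functors -/

section Reflect

variable {V : Type v} [Category.{w} V] [MonoidalCategory V] [SymmetricCategory V] [MonoidalClosed V]
  {K : Type u₁} [EnrichedCategory V K] {B : Type u₂} [EnrichedCategory V B]
  {D : Type u₃} [EnrichedCategory V D]

/-- Fully faithful `V`-functors reflect colimits. -/
lemma Cocyl.isColimit_of_map {W : EnrichedFunctor V Kᵒᵖ V} {G : EnrichedFunctor V K B} {c : B}
    (t : Cocyl W G c) (S : EnrichedFunctor V B D) [∀ x y, IsIso (S.map x y)]
    (h : (t.map S).IsColimit) : t.IsColimit := by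
  rw [Cocyl.isColimit_map_iff] at h
  rw [Cocyl.isColimit_iff]
  intro X b s hs
  obtain ⟨f, hf, hf'⟩ := h (fun k => s k ≫ S.map _ _) fun k l => by
    rw [reassoc_of% hs, gcomp_map]
  refine ⟨f ≫ inv (S.map c b), fun k => ?_, fun g hg => ?_⟩
  · rw [← cancel_mono (S.map _ _), gcomp_map, Category.assoc, IsIso.inv_hom_id, Category.comp_id, hf]
  · rw [IsIso.eq_comp_inv]
    exact hf' _ fun k => by rw [← gcomp_map, hg]

end Reflect

/-! ### Functors that are Kan extensions of their restrictions -/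

section LanNatObj

variable {V : Type v} [Category.{w} V] [MonoidalCategory V] [SymmetricCategory V] [MonoidalClosed V]
  {A : Type u₁} [EnrichedCategory V A] {C : Type u₂} [EnrichedCategory V C]
  {B : Type u₃} [EnrichedCategory V B] {J : EnrichedFunctor V A C}

omit [SymmetricCategory V] [MonoidalClosed V] in
lemma precompose_eId {D : Type u₄} [EnrichedCategory V D] (x y : D) :
    precompose (eId V x) y = 𝟙 (x ⟶[V] y) := by
  rw [← Category.id_comp (precompose _ _), precompose_eq, eId_gcomp, Iso.inv_hom_id_assoc]

/-- `T` is the left Kan extension of its own restriction. -/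
def IsSelfLan (J : EnrichedFunctor V A C) (T : EnrichedFunctor V C B) : Prop :=
  IsLan J (J.comp V T) T (GTrans.refl _)

omit [MonoidalClosed V] in
lemma precompose_lanUnit_refl (T : EnrichedFunctor V C B) (a : A) (y : B) :
    precompose (lanUnit (J := J) (T := T) (GTrans.refl (J.comp V T)) a) y = 𝟙 _ :=
  precompose_eId _ _

lemma IsSelfLan.hom_ext {T S : EnrichedFunctor V C B} (h : IsSelfLan J T) {X : V}
    {σ τ : GTrans X T S} (hστ : ∀ a, σ.app (J.obj a) = τ.app (J.obj a)) : σ = τ :=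
  IsLan.hom_ext_elem h fun a => by rw [hστ]

lemma IsSelfLan.exists_extension {T S : EnrichedFunctor V C B} (h : IsSelfLan J T) {X : V}
    (ρ : GTrans X (J.comp V T) (J.comp V S)) :
    ∃ σ : GTrans X T S, ∀ a, σ.app (J.obj a) = ρ.app a := by
  obtain ⟨σ, hσ, -⟩ := IsLan.existsUnique h (S := S) ρ.app ρ.nat
  refine ⟨σ, fun a => ?_⟩
  exact (Category.comp_id _).symm.trans
    ((congrArg (fun u => σ.app (J.obj a) ≫ u) (precompose_lanUnit_refl T a _).symm).trans (hσ a))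

/-- The object of transformations between the restrictions serves: its universal transformation
extends from `A` to `C`, and uniqueness of extensions gives the universal property. Nothing is asked
of `S`. -/
lemma IsSelfLan.hasNatObj {T S : EnrichedFunctor V C B} (h : IsSelfLan J T)
    [HasNatObj (J.comp V T) (J.comp V S)] : HasNatObj T S := by
  obtain ⟨σ, hσ⟩ := h.exists_extension (S := S) (NatObj.π (J.comp V T) (J.comp V S))
  refine ⟨_, σ, fun X τ => ?_⟩
  let p : ∀ a, _ ⟶ (T.obj (J.obj a) ⟶[V] S.obj (J.obj a)) :=
    (NatObj.π (J.comp V T) (J.comp V S)).app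
  have hσ' : ∀ a, σ.app (J.obj a) = p a := hσ
  have hl : ∀ a, NatObj.lift (τ.whisker J) ≫ p a = τ.app (J.obj a) := NatObj.lift_π (τ.whisker J)
  refine ⟨NatObj.lift (τ.whisker J), ?_, fun g hg => NatObj.hom_ext fun a => ?_⟩
  · have : σ.precomp (NatObj.lift (τ.whisker J)) = τ := h.hom_ext fun a => by
      rw [GTrans.precomp_app, hσ', hl]
    exact fun a => congrArg (fun u => u.app a) this
  · change g ≫ p a = _ ≫ p a
    rw [hl, ← hσ']
    exact hg _

variable {Q : EnrichedFunctor V C B → Prop} {Q' : EnrichedFunctor V A B → Prop}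
  [∀ S T : FullSub Q, HasNatObj S.functor T.functor]
  [∀ S T : FullSub Q', HasNatObj S.functor T.functor]

/-- The inverse classifies the extension to `C` of the universal transformation between the
restrictions. -/
lemma isIso_restriction_map (hQ : ∀ S : FullSub Q, IsSelfLan J S.functor)
    (hJ : ∀ S : FullSub Q, Q' (J.comp V S.functor)) (S T : FullSub Q) :
    IsIso ((FullSub.restriction J hJ).map S T) := by
  let S' : FullSub Q' := ⟨J.comp V S.functor, hJ S⟩
  let T' : FullSub Q' := ⟨J.comp V T.functor, hJ T⟩
  obtain ⟨σ, hσ⟩ := (hQ S).exists_extension (S := T.functor) (FullSub.homπ S' T')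
  let p : ∀ a, (S' ⟶[V] T') ⟶ (S.functor.obj (J.obj a) ⟶[V] T.functor.obj (J.obj a)) :=
    (FullSub.homπ S' T').app
  let r : (S ⟶[V] T) ⟶ (S' ⟶[V] T') := (FullSub.restriction J hJ).map S T
  have hσ' : ∀ a, σ.app (J.obj a) = p a := hσ
  have h1 : ∀ a, r ≫ p a = (FullSub.homπ S T).app (J.obj a) :=
    FullSub.homLift_π (S := S') (T := T') ((FullSub.homπ S T).whisker J)
  change IsIso r
  refine ⟨FullSub.homLift σ, FullSub.homπ_ext fun c => ?_, FullSub.homπ_ext fun a => ?_⟩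
  · rw [Category.assoc, FullSub.homLift_π, Category.id_comp]
    have : σ.precomp r = FullSub.homπ S T := (hQ S).hom_ext fun a => by
      rw [GTrans.precomp_app, hσ', h1]
    exact congrArg (fun u => u.app c) this
  · change (_ ≫ r) ≫ p a = 𝟙 _ ≫ p a
    rw [Category.assoc, h1, FullSub.homLift_π, hσ', Category.id_comp]

omit [MonoidalClosed V] in
/-- An invertible transformation, as an invertible element of a hom-object. -/
lemma isInversePair_homLift {S T : FullSub Q} (σ : GTrans (𝟙_ V) S.functor T.functor)
    (q : ∀ a, 𝟙_ V ⟶ (T.functor.obj a ⟶[V] S.functor.obj a))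
    (h : ∀ a, IsInversePair (σ.app a) (q a)) :
    IsInversePair (FullSub.homLift σ) (FullSub.homLift (σ.inverse q h)) := by
  have key : ∀ {S T : FullSub Q} (σ : GTrans (𝟙_ V) S.functor T.functor)
      (τ : GTrans (𝟙_ V) T.functor S.functor)
      (_ : ∀ a, σ.app a ≫ postcompose _ (τ.app a) = eId V (S.functor.obj a)),
      FullSub.homLift σ ≫ postcompose S (FullSub.homLift τ) = eId V S := by
    intro S T σ τ h
    refine FullSub.homπ_ext fun a => ?_
    rw [comp_postcompose, gcomp, Category.assoc, Category.assoc, FullSub.eComp_π,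
      MonoidalCategory.tensorHom_comp_tensorHom_assoc, FullSub.homLift_π, FullSub.homLift_π,
      FullSub.eId_π, ← h a, comp_postcompose]
    rfl
  exact ⟨key _ _ fun a => (h a).hom_inv, key _ _ fun a => (h a).inv_hom⟩

end LanNatObj

/-! ### The equivalence between Kan extension and restriction -/

section LanEquivalence

variable {V : Type v} [Category.{w} V] [MonoidalCategory V] [SymmetricCategory V] [MonoidalClosed V]
  [HasLimits V] (Φ : ColimitClass V) {A : Type w} [EnrichedCategory V A] {M : Type u₁}
  [EnrichedCategory V M] {J : EnrichedFunctor V A M} [∀ a b, IsIso (J.map a b)]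
  {B : Type uB} [EnrichedCategory V B]

/-- If `J` is fully faithful, the `M(J a, -)` are `Φ`-cocontinuous and the `Φ`-cocontinuous
`V`-functors are left Kan extensions along `J`, then left Kan extension along `J` is an
equivalence. -/
lemma lanEquivalence_of_isSelfLan (hc : ∀ a, Cocontinuous Φ (corep (V := V) (J.obj a)))
    (hS : ∀ S : FullSub (Cocontinuous (B := M) (D := B) Φ), IsSelfLan J S.functor)
    [∀ S T : FullSub (Cocontinuous (B := M) (D := B) Φ), HasNatObj S.functor T.functor]
    (hJ : ∀ S : FullSub (Cocontinuous (B := M) (D := B) Φ), AdmitsLan J (J.comp V S.functor)) :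
    LanEquivalence Φ J B hJ := by
  have := isIso_restriction_map hS hJ
  choose T φ hφ using fun F : FullSub (AdmitsLan (B := B) J) => F.property
  choose q hq using fun F a => (hφ F).exists_isInversePair a
  let L : FullSub (AdmitsLan (B := B) J) → FullSub (Cocontinuous (B := M) (D := B) Φ) :=
    fun F => ⟨T F, fun K _ W hW G c t ht => (hφ F).isColimit_map t fun a => hc a K W hW G c t ht⟩
  let R := FullSub.restriction J hJ
  -- Essential surjectivity: the units are objectwise invertible, hence invertible as elements of
  -- hom-objects of functors.
  have h := fun F : FullSub (AdmitsLan (B := B) J) =>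
    isInversePair_homLift (S := F) (T := R.obj (L F)) (φ F) (q F) (hq F)
  refine ⟨inverseFunctor R L h, inverseUnit R L h, inverseCounit R L h,
    inverseUnit_isInvertible R L h, inverseCounit_isInvertible R L h, fun F => ?_⟩
  -- The unit of the equivalence at `F` classifies `φ F`, so it still exhibits the Kan extension.
  have : (FullSub.homπ F (R.obj (L F))).precomp (FullSub.homLift (T := R.obj (L F)) (φ F)) =
      φ F := by
    ext a
    exact FullSub.homLift_π _ _
  exact this ▸ hφ F

end LanEquivalence

/-! ### The category of flat presheaves as a free cocompletion -/

section FlatCategory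

variable {V : Type v} [Category.{w} V] [MonoidalCategory V] [SymmetricCategory V] [MonoidalClosed V]
  [HasLimits V] {P : LimitClass V} {A : Type w} [EnrichedCategory V A]

variable (P A) in
/-- The inclusion of the flat presheaves into all presheaves. -/
abbrev flatInclusion : EnrichedFunctor V (FlatCat P A) (EnrichedFunctor V Aᵒᵖ V) where
  obj F := F.functor
  map F G := 𝟙 (F.functor ⟶[V] G.functor)
  map_id F := Category.comp_id _
  map_comp F G H := by
    have h : ∀ {X Y Z : V} (f : X ⊗ Y ⟶ Z), f = (𝟙 X ⊗ₘ 𝟙 Y) ≫ f := by simp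
    exact (Category.comp_id _).trans (h (eComp V F.functor G.functor H.functor))

instance (F G : FlatCat P A) : IsIso ((flatInclusion P A).map F G) :=
  inferInstanceAs (IsIso (𝟙 (F.functor ⟶[V] G.functor)))

variable (P A) in
/-- The Yoneda embedding into the flat presheaves. -/
abbrev flatYoneda : EnrichedFunctor V A (FlatCat P A) :=
  corestrict (Q := IsFlat P) (repFunctor V A) (isFlat_rep P)

/-- The action of the embedding on `A(a, b)` is the Yoneda isomorphism for the presheaf `A(-, b)`.
-/
instance (a b : A) : IsIso ((flatYoneda P A).map a b) := by
  have h : (flatYoneda P A).map a b = (yonedaIso (rep b) (op a)).hom := by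
    have h1 : (repFunctor V A).map a b = homLift (corepMap (op a) (op b)) := Category.id_comp _
    have h2 := corepMap_yonedaIso_inv (V := V) (op a) (op b)
    rw [Iso.comp_inv_eq] at h2
    exact h1.trans (h2.trans (Category.id_comp _))
  rw [h]
  exact (yonedaIso (rep b) (op a)).isIso_hom

variable {K : Type w} [EnrichedCategory V K] {W : EnrichedFunctor V Kᵒᵖ V}
  {G : EnrichedFunctor V K (FlatCat P A)}

/-- A cocylinder of presheaves over flat presheaves with flat vertex, as a cocylinder of flat
presheaves. -/
def Cocyl.toFlat {c : FlatCat P A} (t : Cocyl W (G.comp V (flatInclusion P A)) c.functor) :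
    Cocyl W G c :=
  Cocyl.ofLegs (fun k => t.leg k) fun k l => by
    have h := t.lact_leg k l
    have h' : (G.comp V (flatInclusion P A)).map k l = G.map k l := Category.comp_id _
    rw [h'] at h
    exact h

lemma Cocyl.toFlat_map {c : FlatCat P A} (t : Cocyl W (G.comp V (flatInclusion P A)) c.functor) :
    (t.toFlat.map (flatInclusion P A)) = t :=
  Cyl.ext (funext fun k => Category.comp_id (t.app k))

lemma Cocyl.IsColimit.toFlat {c : FlatCat P A}
    {t : Cocyl W (G.comp V (flatInclusion P A)) c.functor} (ht : t.IsColimit) :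
    t.toFlat.IsColimit :=
  t.toFlat.isColimit_of_map (flatInclusion P A) (by rwa [Cocyl.toFlat_map])

lemma cocomplete_flatCat : Cocomplete (FlatCat P A) (flatClass P) := by
  intro K _ W hW G
  obtain ⟨Z, t, ht⟩ := exists_isColimit_ev (G.comp V (flatInclusion P A)) hW
  have hZ : IsFlat P Z := isFlat_of_isColimit_ev (fun k => (G.obj k).property) hW t ht
  exact ⟨⟨Z, hZ⟩, Cocyl.toFlat (c := ⟨Z, hZ⟩) t, Cocyl.IsColimit.toFlat (t.isColimit_of_ev ht)⟩

/-- The pointwise colimit of presheaves is itself flat, hence also a colimit among flat presheaves;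
the inclusion preserves this one and therefore every other. -/
lemma isColimit_map_flatInclusion (hW : IsFlat P W) {c : FlatCat P A} {t : Cocyl W G c}
    (ht : t.IsColimit) : (t.map (flatInclusion P A)).IsColimit := by
  obtain ⟨Z, t', ht'⟩ := exists_isColimit_ev (G.comp V (flatInclusion P A)) hW
  have hZ : IsFlat P Z := isFlat_of_isColimit_ev (fun k => (G.obj k).property) hW t' ht'
  have h := t'.isColimit_of_ev ht'
  refine Cyl.IsLimit.map_of_map (S := opFunctor (flatInclusion P A)) ht
    (Cocyl.IsColimit.toFlat (c := ⟨Z, hZ⟩) h) ?_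
  have h' : ((Cocyl.toFlat (c := ⟨Z, hZ⟩) t').map (flatInclusion P A)).IsColimit := by
    rwa [Cocyl.toFlat_map]
  exact h'

/-- Homming out of a representable preserves colimits of flat presheaves with flat index. -/
lemma cocontinuous_corep_flatYoneda (a : A) :
    Cocontinuous (flatClass P) (corep (V := V) ((flatYoneda P A).obj a)) := by
  intro K _ W hW G c t ht
  -- The colimit is pointwise, so its value at `a` is a coend in V; Yoneda identifies evaluation at
  -- `a` with homming out of the representable.
  have h1 := isTensor_pointBal (fun b => (isColimit_map_flatInclusion hW ht).map_ev hW b) a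
  rw [← isTensor_corepBal_iff]
  let x : FlatCat P A := (flatYoneda P A).obj a
  let y : ∀ c : FlatCat P A, c.functor.obj (op a) ≅ (x ⟶[V] c) :=
    fun c => yonedaIso c.functor (op a)
  let π : ∀ c d : FlatCat P A, (c ⟶[V] d) ⟶
      EnrichedCategory.Hom (c.functor.obj (op a)) (d.functor.obj (op a)) :=
    fun c d => (homπ c.functor d.functor).app (op a)
  have hy : ∀ {c d : FlatCat P A} {Y Z : V} (f : Y ⟶ (x ⟶[V] c)) (g : Z ⟶ (c ⟶[V] d)),
      (f ⋄ g) ≫ (y d).inv = (f ≫ (y c).inv) ▷ Z ≫ huncurry (g ≫ π c d) := gcomp_yonedaIso_inv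
  refine h1.of_iso _ (fun k => (y (G.obj k)).symm) (fun k l => ?_) (y c).symm fun k => ?_
  · have e := hy (𝟙 (x ⟶[V] G.obj k)) (G.map k l)
    rw [Category.id_comp] at e
    refine (congrArg (fun u => u ≫ (y (G.obj l)).inv) (act_corepDiag G x k l)).trans (e.trans ?_)
    have : G.map k l = (G.comp V (flatInclusion P A)).map k l := (Category.comp_id _).symm
    exact congrArg (fun u => (y (G.obj k)).inv ▷ _ ≫ huncurry (u ≫ π (G.obj k) (G.obj l))) this
  · have e := hy (𝟙 (x ⟶[V] G.obj k)) (t.leg k)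
    rw [Category.id_comp] at e
    refine e.trans ?_
    have : t.leg k = (t.map (flatInclusion P A)).leg k := (Category.comp_id _).symm
    exact congrArg (fun u => (y (G.obj k)).inv ▷ _ ≫ huncurry (u ≫ π (G.obj k) c)) this

/-- A presheaf as a colimit of representables, in the category of flat presheaves. -/
def flatDensityCocyl (c : FlatCat P A) : Cocyl c.functor (flatYoneda P A) c :=
  Cocyl.ofLegs (fun k => (yonedaIso c.functor (op k)).hom) fun k l => lact_yonedaIso c.functor k l

/-- A colimit in all presheaves remains one in a full subcategory containing its diagram and vertex:
there are only fewer test objects. -/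
lemma isColimit_flatDensityCocyl (c : FlatCat P A) : (flatDensityCocyl c).IsColimit :=
  have h := (Cocyl.isColimit_iff _).1 (isColimit_densityCocyl c.functor)
  (Cocyl.isColimit_iff _).2 fun X b s hs => @h X b.functor s hs

/-- The weight `c` is isomorphic to the weight `M(Y -, c)`, for `Y` the Yoneda embedding into the
category `M` of flat presheaves. -/
lemma lact_nerve_flatYoneda (c : FlatCat P A) (k l : A) :
    lact (nerve (flatYoneda P A) c) k l ≫ (yonedaIso c.functor (op k)).inv =
      _ ◁ (yonedaIso c.functor (op l)).inv ≫ lact c.functor k l := by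
  have h : ((repFunctor V A).map k l ⋄ 𝟙 (rep l ⟶[V] c.functor)) ≫
      (yonedaIso c.functor (op k)).inv =
        _ ◁ (yonedaIso c.functor (op l)).inv ≫ lact c.functor k l := by
    rw [Iso.comp_inv_eq, Category.assoc, lact_yonedaIso, ← gcomp_comp, Iso.inv_hom_id]
  exact (congrArg (fun u => u ≫ (yonedaIso c.functor (op k)).inv)
    (lact_nerve (flatYoneda P A) c k l)).trans h

/-- As a weight `c` is flat, so `S` preserves the density colimit of `c`; by Yoneda that weight is
`M(Y -, c)`, the one computing the Kan extension at `c`. -/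
lemma isSelfLan_of_cocontinuous {B : Type uB} [EnrichedCategory V B]
    {S : EnrichedFunctor V (FlatCat P A) B} (hS : Cocontinuous (flatClass P) S) :
    IsSelfLan (flatYoneda P A) S := by
  intro c
  have h := hS A c.functor c.property _ c _ (isColimit_flatDensityCocyl c)
  refine h.of_weight_iso _ (fun k => (yonedaIso c.functor (op k)).symm)
    (lact_nerve_flatYoneda c) fun k => ?_
  have h1 : (kanCocyl (flatYoneda P A) _ S (GTrans.refl _) c).leg k =
      S.map ((flatYoneda P A).obj k) c :=
    (congrArg (fun u => S.map ((flatYoneda P A).obj k) c ≫ u)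
      (precompose_lanUnit_refl S k (S.obj c))).trans (Category.comp_id _)
  exact h1.trans (Iso.inv_hom_id_assoc (yonedaIso c.functor (op k)) _).symm

lemma admitsLan_of_cocomplete {B : Type uB} [EnrichedCategory V B] (hB : Cocomplete B (flatClass P))
    (F : EnrichedFunctor V A B) : AdmitsLan (flatYoneda P A) F := by
  refine admitsLan_of_isColimit fun c => ?_
  obtain ⟨x, t, ht⟩ := hB A c.functor c.property F
  exact ⟨x, t.weightComp _ (lact_nerve_flatYoneda c), ht.of_weight_iso _
    (fun k => (yonedaIso c.functor (op k)).symm) (lact_nerve_flatYoneda c) fun k => rfl⟩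

end FlatCategory

end PFlat

end

theorem theorem2p5 {V : Type v} [Category.{w} V] [MonoidalCategory V] [SymmetricCategory V]
    [MonoidalClosed V] [HasLimits V] (P : PFlat.LimitClass V) (A : Type w)
    [EnrichedCategory V A] :
    PFlat.IsClosure A (PFlat.flatClass P) {F | PFlat.IsFlat P F} ∧
      ∃ h : ∀ a : A, PFlat.IsFlat P ((PFlat.yoneda V A).obj a),
        PFlat.IsFreeCocompletion.{w, v, max v w, uB} (PFlat.flatClass P)
          (PFlat.corestrict (Q := PFlat.IsFlat P) (PFlat.yoneda V A) h) := by
  refine ⟨PFlat.isClosure_isFlat A P, PFlat.isFlat_rep P, ?_⟩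
  have hS : ∀ (B : Type uB) [EnrichedCategory V B] (S : PFlat.FullSub (PFlat.Cocontinuous
      (B := PFlat.FlatCat P A) (D := B) (PFlat.flatClass P))),
      PFlat.IsSelfLan (PFlat.flatYoneda P A) S.functor :=
    fun B _ S => PFlat.isSelfLan_of_cocontinuous S.property
  -- Smallness of `A` supplies the object of transformations between the restrictions.
  have hN : ∀ (B : Type uB) [EnrichedCategory V B] (S T : PFlat.FullSub (PFlat.Cocontinuous
      (B := PFlat.FlatCat P A) (D := B) (PFlat.flatClass P))),
      PFlat.HasNatObj S.functor T.functor := fun B _ S _ => (hS B S).hasNatObj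
  exact {
    fullyFaithful := fun a b => inferInstanceAs (IsIso ((PFlat.flatYoneda P A).map a b))
    cocomplete := PFlat.cocomplete_flatCat
    hasNatObj := hN
    restrict := fun B _ S => ⟨_, _, hS B S⟩
    lanEquivalence := fun B _ =>
      haveI := hN B
      PFlat.lanEquivalence_of_isSelfLan (J := PFlat.flatYoneda P A) _
        PFlat.cocontinuous_corep_flatYoneda (hS B) _
    admitsLan := fun B _ hB F => PFlat.admitsLan_of_cocomplete hB F }
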